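/- **Setting.** Let $\mathcal D$ be a complete dataset of $|\mathcal D|\ge 1$ records over $n$ discrete variables with finite domains $\mathrm{dom}(X)$. For a variable $X$ and a set $\mathbf Z$ of variables let $|\mathrm{dom}(\mathbf Z)|=\prod_{Y\in\mathbf Z}|\mathrm{dom}(Y)|$, and let $$S(X|\mathbf Z)=\sum_{x,\mathbf z}N_{x\mathbf z}\log\frac{N_{x\mathbf z}}{N_{\mathbf z}}-\tfrac12\log(|\mathcal D|)\,(|\mathrm{dom}(X)|-1)\,|\mathrm{dom}(\mathbf Z)|$$ be the BIC score, where $N_{x\mathbf z}$ is the number of records with $X=x$, $\mathbf Z=\mathbf z$, and $N_{\mathbf z}=\sum_xN_{x\mathbf z}$ (terms with $N_{x\mathbf z}=0$ are $0$). Put $\delta(U,V,\mathbf Z)=(|\mathrm{dom}(U)|-1)(|\mathrm{dom}(V)|-1)|\mathrm{dom}(\mathbf Z)|$ and $$f_{BIC}(U,V|\mathbf Z)=2\bigl(S(U|\mathbf Z\cup\{V\})-S(U|\mathbf Z)+\tfrac12\log(|\mathcal D|)\,\delta(U,V,\mathbf Z)\bigr).$$ For a risk level $\alpha\in(0,1)$,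 $U$ and $V$ are *judged independent* given $\mathbf Z$ if $f_{BIC}(U,V|\mathbf Z)<\chi^2_{\delta(U,V,\mathbf Z)}(\alpha)$, the critical value at level $\alpha$ of the $\chi^2$ distribution with $\delta(U,V,\mathbf Z)$ degrees of freedom (the point mass at $0$ for $0$ degrees of freedom). **Algorithm 2** (input: $U,V$, compulsory set $\mathbf C$, forbidden set $\mathbf F$, maximal size $h$). Start with $\mathbf Z=\mathbf C$. If $|\mathbf Z|>h$, return False. If $U,V$ are judged independent given $\mathbf Z$, return $\mathbf Z$. While $|\mathbf Z|<h$: add to $\mathbf Z$ the variable $Y\notin\mathbf Z\cup\mathbf F\cup\{U,V\}$ that minimizes $f_{BIC}(U,V|\mathbf Z\cup\{Y\})$ (the first one in case of ties; if there is no such $Y$, return False), and return $\mathbf Z$ if $U,V$ are now judged independent given $\mathbf Z$. After the loop, return False. **Algorithm 1.** 1. A DAG $\mathcal G$ on the $n$ variables is learnt from $\mathcal D$ by some score-based algorithm. 2. A triple $(A,B,C)$ is of Type 1 if $\mathcal G$ contains $C\to A$, $A\to B$, $C\to B$, and of Type 3 if $\mathcal G$ contains $A\to B$, $B\to C$, $A\to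 C$. Let $\mathbf T$ be the set of triples of Type 1 or 3 such that Algorithm 2 with $\mathbf C=\emptyset$ finds a set $\mathbf Z$ for $(B,C)$ with $\mathbf F=\{A\}$, and $B,C$ are not judged independent given $\mathbf Z\cup\{A\}$, while it returns False for $(A,B)$ with $\mathbf F=\{C\}$ and for $(A,C)$ with $\mathbf F=\{B\}$. 3. Let $\mathbf T_1$ be the set of triples of Type 1 in $\mathbf T$ for which $B$ has at least $3$ parents in $\mathcal G$. Let $\mathbf T_3$ be the set of triples of Type 3 in $\mathbf T$ for which there is a parent $E\ne A$ or a child $E\neq C$ of $B$ in $\mathcal G$ such that Algorithm 2 finds a set for $(E,C)$ with $\mathbf C=\{A\}$, $\mathbf F=\emptyset$. 4. For each $(A,B,C)\in\mathbf T_1\cup\mathbf T_3$, remove from $\mathcal G$ the arc $A\to B$ and the arc between $B$ and $C$, and add a new node $L$ with arcs $L\to A$ and $L\to B$. 5. Return the CPDAG of the resulting DAG, i.e., its skeleton in which an edge is oriented if all DAGs with the same skeleton and the same v-structures orient it in this direction, and is undirected otherwise. **Proposition 6.** Let $n$ and $m$ be the numbers of nodes and arcs of the DAG $\mathcal G$ learnt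 in step 1, and let $k$ be the maximum, over the nodes of $\mathcal G$, of the number of parents and of the number of children. Assume $k\ge1$ and $h\ge1$. Then Algorithm 1, with Algorithm 2 used to find the conditioning sets, runs in time $$O\bigl(n^2k^3h|\mathcal D|+m\log n\bigr),$$ not counting the call of the score-based learner in step 1, whose result may be an arbitrary DAG $\mathcal G$. That is, there are an absolute constant $c$ and one program for a uniform-cost random access machine over the natural and the real numbers (with arithmetic operations, comparisons, logarithms and the critical values $\chi^2_\delta(\alpha)$ as elementary operations) which, for every $\mathcal D$, $\mathcal G$, $h$ and $\alpha$ as above in its memory, computes the output of Algorithm 1, together with the list $\mathbf T_1\cup\mathbf T_3$, in at most $c\,(n^2k^3h|\mathcal D|+m\log n)$ steps. -/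

import Mathlib

namespace ConfounderSearch

/-! ### Data, the BIC score and the independence test -/

/-- A complete dataset over the `n` observed discrete variables: variable `i` takes its values
in `{0, …, dom i - 1}`, and there are `size` records. -/
structure Dataset (n : ℕ) where
  size : ℕ
  dom : Fin n → ℕ
  record : Fin size → (i : Fin n) → Fin (dom i)

namespace Dataset

variable {n : ℕ} (D : Dataset n)

/-- The joint values of the variables of `Z`. -/
abbrev Config (Z : Finset (Fin n)) : Type := (i : {i // i ∈ Z}) → Fin (D.dom i)

/-- `N_{xz}`: the number of records with `X = x` and `Z = z`. -/
def count (X : Fin n) (Z : Finset (Fin n)) (x : Fin (D.dom X)) (z : D.Config Z) : ℕ :=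
  (Finset.univ.filter fun r => D.record r X = x ∧ ∀ i : {i // i ∈ Z}, D.record r i = z i).card

/-- `N_z = ∑_x N_{xz}`. -/
def countSum (X : Fin n) (Z : Finset (Fin n)) (z : D.Config Z) : ℕ :=
  ∑ x : Fin (D.dom X), D.count X Z x z

/-- The BIC score `S(X | Z)`. Terms with `N_{xz} = 0` are zero. -/
noncomputable def score (X : Fin n) (Z : Finset (Fin n)) : ℝ :=
  (∑ x : Fin (D.dom X), ∑ z : D.Config Z,
    (D.count X Z x z : ℝ) * Real.log ((D.count X Z x z : ℝ) / (D.countSum X Z z : ℝ)))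
  - 1 / 2 * Real.log (D.size : ℝ) * (((D.dom X - 1) * ∏ i ∈ Z, D.dom i : ℕ) : ℝ)

/-- The number of degrees of freedom `δ = (|dom U| - 1) (|dom V| - 1) |dom Z|`. -/
def dof (U V : Fin n) (Z : Finset (Fin n)) : ℕ :=
  (D.dom U - 1) * (D.dom V - 1) * ∏ i ∈ Z, D.dom i

/-- `f_BIC(U, V | Z)`. -/
noncomputable def fBIC (U V : Fin n) (Z : Finset (Fin n)) : ℝ :=
  2 * (D.score U (insert V Z) - D.score U Z
    + 1 / 2 * Real.log (D.size : ℝ) * (D.dof U V Z : ℝ))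

end Dataset

/-- The chi-squared distribution with `δ` degrees of freedom; for `δ = 0` it is the point mass
at `0`. -/
noncomputable def chiSquare (δ : ℕ) : MeasureTheory.Measure ℝ :=
  if δ = 0 then MeasureTheory.Measure.dirac 0
  else ProbabilityTheory.gammaMeasure ((δ : ℝ) / 2) (1 / 2)

/-- The critical value of the chi-squared distribution at risk level `α`: the least `t` such
that a value larger than `t` has probability at most `α`. -/
noncomputable def chiCrit (δ : ℕ) (α : ℝ) : ℝ :=
  sInf {t : ℝ | (chiSquare δ).real (Set.Ioi t) ≤ α}

section Procedures

variable {n : ℕ} (D : Dataset n)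

/-- `U` and `V` are judged independent given `Z` at risk level `α`. -/
def JudgedIndep (α : ℝ) (U V : Fin n) (Z : Finset (Fin n)) : Prop :=
  D.fBIC U V Z < chiCrit (D.dof U V Z) α

noncomputable instance (α : ℝ) (U V : Fin n) (Z : Finset (Fin n)) :
    Decidable (JudgedIndep D α U V Z) :=
  inferInstanceAs (Decidable (D.fBIC U V Z < chiCrit (D.dof U V Z) α))

/-- The variable outside `Z ∪ F` whose addition to `Z` makes `f_BIC(U, V | ·)` minimal (the first
one in case of ties), or `none` if every variable lies in `Z ∪ F`. -/
noncomputable def bestVar (U V : Fin n) (F Z : Finset (Fin n)) : Option (Fin n) :=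
  ((List.finRange n).filter fun Y => Y ∉ Z ∪ F).argmin fun Y => D.fBIC U V (insert Y Z)

/-- The `while` loop of the search for a conditioning set. The first explicit argument is the
number `h - |Z|` of variables that may still be added. -/
noncomputable def growLoop (α : ℝ) (U V : Fin n) (F : Finset (Fin n)) :
    ℕ → Finset (Fin n) → Option (Finset (Fin n))
  | 0, _ => none
  | s + 1, Z =>
    match bestVar D U V F Z with
    | none => none
    | some X =>
      if JudgedIndep D α U V (insert X Z) then some (insert X Z)
      else growLoop α U V F s (insert X Z)

/-- The greedy search for a set `Z` of at most `h` variables, containing the compulsory set `C`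
and avoiding the forbidden set `F`, given which `U` and `V` are judged independent. The value
`none` stands for `False`. -/
noncomputable def findSet (h : ℕ) (α : ℝ) (U V : Fin n) (C F : Finset (Fin n)) :
    Option (Finset (Fin n)) :=
  if h < C.card then none
  else if JudgedIndep D α U V C then some C
  else growLoop D α U V (F ∪ {U, V}) (h - C.card) C

end Procedures

/-! ### Directed graphs, Markov equivalence and CPDAGs -/

section Graphs

variable {V : Type*}

/-- A digraph without directed cycles (in particular without loops). -/
def IsDAG (G : Digraph V) : Prop := ∀ v, ¬ Relation.TransGen G.Adj v v

/-- The parents of `v`. -/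
def parents (G : Digraph V) (v : V) : Set V := {u | G.Adj u v}

/-- The children of `v`. -/
def children (G : Digraph V) (v : V) : Set V := {u | G.Adj v u}

/-- The number of arcs. -/
noncomputable def numArcs (G : Digraph V) : ℕ := {p : V × V | G.Adj p.1 p.2}.ncard

/-- The maximum over all nodes of the number of parents and of the number of children. -/
noncomputable def maxDegree [Fintype V] (G : Digraph V) : ℕ :=
  Finset.univ.sup fun v => max (parents G v).ncard (children G v).ncard

/-- Adjacency in the skeleton. -/
def SkelAdj (G : Digraph V) (x y : V) : Prop := G.Adj x y ∨ G.Adj y x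

/-- `⟨x, z, y⟩` is a v-structure. -/
def IsVStructure (G : Digraph V) (x z y : V) : Prop :=
  x ≠ y ∧ G.Adj x z ∧ G.Adj y z ∧ ¬ SkelAdj G x y

/-- Same skeleton and same v-structures. -/
def SameClass (G H : Digraph V) : Prop :=
  (∀ x y, SkelAdj G x y ↔ SkelAdj H x y) ∧ ∀ x z y, IsVStructure G x z y ↔ IsVStructure H x z y

/-- The CPDAG of a DAG `G`. It has the skeleton of `G`, and an edge is oriented `x → y` if all the
DAGs with the skeleton and the v-structures of `G` orient it so. An edge that stays undirected is
represented by the two opposite arcs. -/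
def cpdag (G : Digraph V) : Digraph V where
  Adj x y := SkelAdj G x y ∧ ¬ ∀ H : Digraph V, IsDAG H → SameClass G H → H.Adj y x

end Graphs

/-! ### The learning algorithm, after the DAG `G` has been learnt -/

/-- A triangle with its nodes labelled `A`, `B`, `C`. -/
structure Triangle (n : ℕ) where
  A : Fin n
  B : Fin n
  C : Fin n

section Algorithm

variable {n : ℕ} (D : Dataset n) (G : Digraph (Fin n)) (h : ℕ) (α : ℝ)

def IsTypeOne (T : Triangle n) : Prop := G.Adj T.C T.A ∧ G.Adj T.A T.B ∧ G.Adj T.C T.B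

def IsTypeThree (T : Triangle n) : Prop := G.Adj T.A T.B ∧ G.Adj T.B T.C ∧ G.Adj T.A T.C

/-- The triangles that look latent: a set avoiding `A` is found given which `B` and `C` are
independent, they are dependent given this set and `A`, and no set avoiding the third node is
found that makes `A` independent of `B`, or `A` independent of `C`. -/
def Candidate (T : Triangle n) : Prop :=
  (IsTypeOne G T ∨ IsTypeThree G T) ∧
  (∃ Z, findSet D h α T.B T.C ∅ {T.A} = some Z ∧ ¬ JudgedIndep D α T.B T.C (insert T.A Z)) ∧
  findSet D h α T.A T.B ∅ {T.C} = none ∧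
  findSet D h α T.A T.C ∅ {T.B} = none

/-- The latent triangles of type 1. -/
def latentOne : Set (Triangle n) :=
  {T | Candidate D G h α T ∧ IsTypeOne G T ∧ 3 ≤ (parents G T.B).ncard}

/-- The latent triangles of type 3. -/
def latentThree : Set (Triangle n) :=
  {T | Candidate D G h α T ∧ IsTypeThree G T ∧
    ∃ E ∈ (parents G T.B \ {T.A}) ∪ (children G T.B \ {T.C}),
      ∃ Z, findSet D h α E T.C {T.A} ∅ = some Z}

/-- All the latent triangles; each of them gives rise to one new node, a latent confounder. -/
def latent : Set (Triangle n) := latentOne D G h α ∪ latentThree D G h α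

/-- The observed variables and the recreated confounders. -/
abbrev Node : Type := Fin n ⊕ {T : Triangle n // T ∈ latent D G h α}

/-- The graph obtained from `G` when, for each latent triangle `(A, B, C)`, the arc `A → B` and the
arc between `B` and `C` are removed, and a new node `L` with arcs `L → A` and `L → B` is added. -/
def withConfounders : Digraph (Node D G h α) where
  Adj
    | .inl x, .inl y => G.Adj x y ∧ ∀ T ∈ latent D G h α,
        ¬ (x = T.A ∧ y = T.B) ∧ ¬ (x = T.B ∧ y = T.C) ∧ ¬ (x = T.C ∧ y = T.B)
    | .inr T, .inl x => x = T.1.A ∨ x = T.1.B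
    | _, .inr _ => False

/-- The returned CPDAG. -/
def learntCPDAG : Digraph (Node D G h α) := cpdag (withConfounders D G h α)

end Algorithm

/-! ### The machine model

A random access machine with uniform costs that works on natural numbers and on real numbers.
Its memory consists of arrays with two indices, infinitely many for natural numbers and infinitely
many for real numbers. A program is a fixed finite piece of code which addresses
the arrays by constant names and computed indices. -/

/-- A memory state: `nat a i j` is the entry `(i, j)` of the array `a` of natural numbers. -/
structure State where
  nat : ℕ → ℕ → ℕ → ℕ
  real : ℕ → ℕ → ℕ → ℝ

/-- Expressions of natural number type. -/
inductive NExpr : Type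
  | const (c : ℕ) : NExpr
  | get (a : ℕ) (i j : NExpr) : NExpr
  | add (e f : NExpr) : NExpr
  | sub (e f : NExpr) : NExpr
  | mul (e f : NExpr) : NExpr

/-- Expressions of real number type: the four operations, the logarithm, and the critical
values of the chi-squared distributions. There is no rounding of a real to a natural number. -/
inductive RExpr : Type
  | get (a : ℕ) (i j : NExpr) : RExpr
  | ofNat (e : NExpr) : RExpr
  | add (e f : RExpr) : RExpr
  | sub (e f : RExpr) : RExpr
  | mul (e f : RExpr) : RExpr
  | div (e f : RExpr) : RExpr
  | log (e : RExpr) : RExpr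
  | crit (δ : NExpr) (e : RExpr) : RExpr

/-- Tests. -/
inductive Test : Type
  | natEq (e f : NExpr) : Test
  | natLt (e f : NExpr) : Test
  | realLt (e f : RExpr) : Test
  | not (b : Test) : Test
  | and (b c : Test) : Test

/-- Programs. -/
inductive Program : Type
  | skip : Program
  | setNat (a : ℕ) (i j e : NExpr) : Program
  | setReal (a : ℕ) (i j : NExpr) (e : RExpr) : Program
  | seq (p q : Program) : Program
  | ite (b : Test) (p q : Program) : Program
  | loop (b : Test) (p : Program) : Program

def NExpr.eval (s : State) : NExpr → ℕ
  | const c => c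
  | get a i j => s.nat a (i.eval s) (j.eval s)
  | add e f => e.eval s + f.eval s
  | sub e f => e.eval s - f.eval s
  | mul e f => e.eval s * f.eval s

/-- The number of elementary operations in the evaluation of an expression. -/
def NExpr.cost : NExpr → ℕ
  | const _ => 1
  | get _ i j => i.cost + j.cost + 1
  | add e f => e.cost + f.cost + 1
  | sub e f => e.cost + f.cost + 1
  | mul e f => e.cost + f.cost + 1

noncomputable def RExpr.eval (s : State) : RExpr → ℝ
  | get a i j => s.real a (i.eval s) (j.eval s)
  | ofNat e => (e.eval s : ℝ)
  | add e f => e.eval s + f.eval s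
  | sub e f => e.eval s - f.eval s
  | mul e f => e.eval s * f.eval s
  | div e f => e.eval s / f.eval s
  | log e => Real.log (e.eval s)
  | crit δ e => chiCrit (δ.eval s) (e.eval s)

def RExpr.cost : RExpr → ℕ
  | get _ i j => i.cost + j.cost + 1
  | ofNat e => e.cost + 1
  | add e f => e.cost + f.cost + 1
  | sub e f => e.cost + f.cost + 1
  | mul e f => e.cost + f.cost + 1
  | div e f => e.cost + f.cost + 1
  | log e => e.cost + 1
  | crit δ e => δ.cost + e.cost + 1

def Test.Holds (s : State) : Test → Prop
  | natEq e f => e.eval s = f.eval s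
  | natLt e f => e.eval s < f.eval s
  | realLt e f => e.eval s < f.eval s
  | not b => ¬ b.Holds s
  | and b c => b.Holds s ∧ c.Holds s

def Test.cost : Test → ℕ
  | natEq e f => e.cost + f.cost + 1
  | natLt e f => e.cost + f.cost + 1
  | realLt e f => e.cost + f.cost + 1
  | not b => b.cost + 1
  | and b c => b.cost + c.cost + 1

/-- Overwrite the entry `(i, j)` of the array `a` of natural numbers by `v`. -/
def State.setNat (s : State) (a i j v : ℕ) : State where
  nat a' i' j' := if a' = a ∧ i' = i ∧ j' = j then v else s.nat a' i' j'
  real := s.real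

/-- Overwrite the entry `(i, j)` of the array `a` of real numbers by `v`. -/
noncomputable def State.setReal (s : State) (a i j : ℕ) (v : ℝ) : State where
  nat := s.nat
  real a' i' j' := if a' = a ∧ i' = i ∧ j' = j then v else s.real a' i' j'

/-- `Exec p s t s'`: started in the state `s`, the program `p` halts after exactly `t` elementary
steps in the state `s'`. -/
inductive Exec : Program → State → ℕ → State → Prop
  | skip (s : State) : Exec .skip s 1 s
  | setNat (a : ℕ) (i j e : NExpr) (s : State) :
      Exec (.setNat a i j e) s (i.cost + j.cost + e.cost + 1)
        (s.setNat a (i.eval s) (j.eval s) (e.eval s))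
  | setReal (a : ℕ) (i j : NExpr) (e : RExpr) (s : State) :
      Exec (.setReal a i j e) s (i.cost + j.cost + e.cost + 1)
        (s.setReal a (i.eval s) (j.eval s) (e.eval s))
  | seq {p q : Program} {s s' s'' : State} {t t' : ℕ} :
      Exec p s t s' → Exec q s' t' s'' → Exec (.seq p q) s (t + t') s''
  | iteTrue {b : Test} {p q : Program} {s s' : State} {t : ℕ} :
      b.Holds s → Exec p s t s' → Exec (.ite b p q) s (b.cost + t + 1) s'
  | iteFalse {b : Test} {p q : Program} {s s' : State} {t : ℕ} :
      ¬ b.Holds s → Exec q s t s' → Exec (.ite b p q) s (b.cost + t + 1) s'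
  | loopTrue {b : Test} {p : Program} {s s' s'' : State} {t t' : ℕ} :
      b.Holds s → Exec p s t s' → Exec (.loop b p) s' t' s'' →
        Exec (.loop b p) s (b.cost + t + t' + 1) s''
  | loopFalse {b : Test} {p : Program} {s : State} :
      ¬ b.Holds s → Exec (.loop b p) s (b.cost + 1) s

/-! ### Input and output -/

section InputOutput

variable {n : ℕ} (D : Dataset n) (G : Digraph (Fin n)) (h : ℕ) (α : ℝ)

open Classical in
/-- The initial memory: array 0 holds `n`, the number of records and `h`; array 1 the adjacency
matrix of `G`; array 2 the domain sizes; array 3 the records; the real array 0 holds `α`.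
All the other entries are zero. -/
noncomputable def input : State where
  nat
    | 0, 0, 0 => n
    | 0, 1, 0 => D.size
    | 0, 2, 0 => h
    | 1, i, j => if ∃ x y : Fin n, x.val = i ∧ y.val = j ∧ G.Adj x y then 1 else 0
    | 2, i, 0 => if hi : i < n then D.dom ⟨i, hi⟩ else 0
    | 3, r, i => if hr : r < D.size ∧ i < n then (D.record ⟨r, hr.1⟩ ⟨i, hr.2⟩).val else 0
    | _, _, _ => 0
  real
    | 0, 0, 0 => α
    | _, _, _ => 0

/-- The number that stands for a node: observed variables keep their number, and confounders are
numbered from `n` on by `e`. -/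
def label {l : ℕ} (e : {T : Triangle n // T ∈ latent D G h α} ≃ Fin l) : Node D G h α → ℕ
  | .inl x => x.val
  | .inr T => n + (e T).val

/-- The memory holds the output of the algorithm: the entry `(0, 0)` of array 4 is the number of
confounders; row `j` of array 5 holds the nodes `A`, `B`, `C` of the triangle that gave rise to the
`j`-th confounder; the entry `(0, 0)` of array 6 is the length of a list of arcs, and row `j` of
array 7 holds the tail and the head of its `j`-th arc; this list consists of the arcs of the
CPDAG. -/
def IsOutput (s : State) : Prop :=
  ∃ e : {T : Triangle n // T ∈ latent D G h α} ≃ Fin (s.nat 4 0 0),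
    (∀ T, s.nat 5 (e T).val 0 = T.1.A.val ∧ s.nat 5 (e T).val 1 = T.1.B.val ∧
      s.nat 5 (e T).val 2 = T.1.C.val) ∧
    ∀ p q : ℕ, (∃ j < s.nat 6 0 0, s.nat 7 j 0 = p ∧ s.nat 7 j 1 = q) ↔
      ∃ x y, label D G h α e x = p ∧ label D G h α e y = q ∧ (learntCPDAG D G h α).Adj x y

end InputOutput

end ConfounderSearch

/-! The bound rests on a linear-time evaluation of the test statistic, a count of the evaluations,
and a description of the CPDAG that is cheap to compute.

Evaluation. The penalties of the two BIC scores differ by exactly the term that `fBIC` adds back, so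
they cancel (`Dataset.fBIC_eq`), and the weight `N_{xz}` turns each log-likelihood into a sum over
the records (`Dataset.logLik_eq`). Hence the joint values of `Z`, of which there may be
exponentially many, are never enumerated. The values of `Z` in a record are encoded by one number in
mixed radix, which costs one multiplication and one addition per record when a variable is added.
The counts are kept in tables indexed by these codes, and after each evaluation only the cells that
were used are cleared. This gives `O(|D|)` steps per evaluation (`runs_evalStat`).

Counting. A search for a conditioning set consists of at most `h` rounds with at most `n`
evaluations each, so it takes `O(n h |D|)` steps (`runs_search`). A triangle is given by a node `B`,
one of at most `k` parents `A` of `B`, and one of at most `2k` neighbours `C` of `B`. It needs at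
most three searches, and in Type 3 at most `2k` more for the witness `E`. The total is `O(n · k · k
· k · n h |D|)` (`runs_collect`).

CPDAG. In a finite DAG define `K y` recursively: if `y` has a parent `x` such that all other parents
of `y` point to `x` and all of `K x` are parents of `y`, then `K y = K x`; otherwise `K y` consists
of all the parents of `y`. The compelled arcs into `y` are exactly those from `K y`
(`CompelledSpec.cpdag_adj_iff`). That they are compelled follows by induction along the DAG, since
reversing one would create a cycle or a new v-structure (`CompelledSpec.adj`). For the converse,
following the recursion from `y` leads to a base `b` with `K y = parents b`. The nodes with a common
base have the same parents outside their class, and the parents inside form cliques, so the class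
induces a chordal graph. A perfect elimination order of a chordal graph can be made to end with any
prescribed edge (`Perfect.exists_append_clique`), and orienting the class along it reverses any
given arc (`IsDAG.exists_reversal`).

In the graph with confounders, one dummy node without parents stands for all the confounders as a
base. The bases and the list of arcs take `O(n² k)` steps, less than the main term, so the term `m
log n` of the bound is not needed. -/

namespace ConfounderSearch

/-! ### Reasoning about programs -/

section Framework

/-- Started in `s`, the program `p` halts within `T` steps in a state that satisfies `Q`. -/
def Runs (p : Program) (s : State) (T : ℕ) (Q : State → Prop) : Prop :=
  ∃ t final, Exec p s t final ∧ t ≤ T ∧ Q final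

/-- Whether `p` contains an assignment to the array `b` of natural numbers. -/
def Program.writesNat : Program → ℕ → Bool
  | skip, _ => false
  | setNat a _ _ _, b => b == a
  | setReal _ _ _ _, _ => false
  | seq p q, b => p.writesNat b || q.writesNat b
  | ite _ p q, b => p.writesNat b || q.writesNat b
  | loop _ p, b => p.writesNat b

/-- Whether `p` contains an assignment to the array `b` of real numbers. -/
def Program.writesReal : Program → ℕ → Bool
  | skip, _ => false
  | setNat _ _ _ _, _ => false
  | setReal a _ _ _, b => b == a
  | seq p q, b => p.writesReal b || q.writesReal b
  | ite _ p q, b => p.writesReal b || q.writesReal b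
  | loop _ p, b => p.writesReal b

/-- `s` and `s'` agree on all the arrays to which `p` does not assign. -/
def Agree (p : Program) (s s' : State) : Prop :=
  (∀ a, p.writesNat a = false → s'.nat a = s.nat a) ∧
  ∀ a, p.writesReal a = false → s'.real a = s.real a

theorem State.setNat_nat_of_ne (s : State) {a b : ℕ} (i j v : ℕ) (hb : b ≠ a) :
    (s.setNat a i j v).nat b = s.nat b := by
  funext i' j'; simp [State.setNat, hb]

theorem State.setNat_nat_self (s : State) (a i j v i' j' : ℕ) :
    (s.setNat a i j v).nat a i' j' = if i' = i ∧ j' = j then v else s.nat a i' j' := by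
  simp [State.setNat]

theorem State.setNat_real (s : State) (a i j v : ℕ) : (s.setNat a i j v).real = s.real := rfl

theorem State.setReal_real_of_ne (s : State) {a b : ℕ} (i j : ℕ) (v : ℝ) (hb : b ≠ a) :
    (s.setReal a i j v).real b = s.real b := by
  funext i' j'; simp [State.setReal, hb]

theorem State.setReal_real_self (s : State) (a i j : ℕ) (v : ℝ) (i' j' : ℕ) :
    (s.setReal a i j v).real a i' j' = if i' = i ∧ j' = j then v else s.real a i' j' := by
  simp [State.setReal]

theorem State.setReal_nat (s : State) (a i j : ℕ) (v : ℝ) : (s.setReal a i j v).nat = s.nat := rfl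

attribute [simp] State.setNat_nat_of_ne State.setNat_nat_self State.setNat_real
  State.setReal_real_of_ne State.setReal_real_self State.setReal_nat

theorem Agree.refl (p : Program) (s : State) : Agree p s s := ⟨fun _ _ => rfl, fun _ _ => rfl⟩

theorem Agree.trans {p : Program} {s s' s'' : State} (h : Agree p s s') (h' : Agree p s' s'') :
    Agree p s s'' :=
  ⟨fun a ha => (h'.1 a ha).trans (h.1 a ha), fun a ha => (h'.2 a ha).trans (h.2 a ha)⟩

theorem Agree.setNat {p : Program} {s s' : State} (h : Agree p s s') {a : ℕ} (i j v : ℕ)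
    (ha : p.writesNat a = true) : Agree p s (s'.setNat a i j v) := by
  refine ⟨fun b hb => ?_, h.2⟩
  rw [State.setNat_nat_of_ne, h.1 b hb]
  rintro rfl; simp [ha] at hb

/-- The frame rule. `writesNat` and `writesReal` are computable, so for concrete programs and array
names their side conditions are closed by `rfl`. -/
theorem Exec.agree {p : Program} {s s' : State} {t : ℕ} (h : Exec p s t s') : Agree p s s' := by
  induction h with
  | skip s => exact Agree.refl _ _
  | setNat a i j e s => exact (Agree.refl _ s).setNat _ _ _ (by simp [Program.writesNat])
  | setReal a i j e s =>
    refine ⟨fun _ _ => rfl, fun b hb => ?_⟩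
    rw [State.setReal_real_of_ne]
    simpa [Program.writesReal] using hb
  | seq _ _ ih ih' =>
    refine ⟨fun a ha => ?_, fun a ha => ?_⟩
    · simp only [Program.writesNat, Bool.or_eq_false_iff] at ha
      rw [ih'.1 a ha.2, ih.1 a ha.1]
    · simp only [Program.writesReal, Bool.or_eq_false_iff] at ha
      rw [ih'.2 a ha.2, ih.2 a ha.1]
  | iteTrue _ _ ih =>
    refine ⟨fun a ha => ?_, fun a ha => ?_⟩
    · simp only [Program.writesNat, Bool.or_eq_false_iff] at ha
      exact ih.1 a ha.1
    · simp only [Program.writesReal, Bool.or_eq_false_iff] at ha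
      exact ih.2 a ha.1
  | iteFalse _ _ ih =>
    refine ⟨fun a ha => ?_, fun a ha => ?_⟩
    · simp only [Program.writesNat, Bool.or_eq_false_iff] at ha
      exact ih.1 a ha.2
    · simp only [Program.writesReal, Bool.or_eq_false_iff] at ha
      exact ih.2 a ha.2
  | loopTrue _ _ _ ih ih' =>
    refine ⟨fun a ha => ?_, fun a ha => ?_⟩
    · rw [ih'.1 a ha, ih.1 a ha]
    · rw [ih'.2 a ha, ih.2 a ha]
  | loopFalse _ => exact Agree.refl _ _

/-- The consequence rule also hands over `Agree p s s'`, so that postconditions need to mention only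
what the program changes. -/
theorem Runs.mono {p : Program} {s : State} {T T' : ℕ} {Q Q' : State → Prop}
    (h : Runs p s T Q) (hT : T ≤ T') (hQ : ∀ s', Agree p s s' → Q s' → Q' s') :
    Runs p s T' Q' := by
  obtain ⟨t, s', he, ht, hq⟩ := h
  exact ⟨t, s', he, ht.trans hT, hQ s' he.agree hq⟩

theorem Runs.seq {p q : Program} {s : State} {T₁ T₂ T : ℕ} {Q₁ Q : State → Prop}
    (hp : Runs p s T₁ Q₁) (hq : ∀ s', Agree p s s' → Q₁ s' → Runs q s' T₂ Q)
    (hT : T₁ + T₂ ≤ T) : Runs (.seq p q) s T Q := by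
  obtain ⟨t, s', he, ht, hs⟩ := hp
  obtain ⟨t', s'', he', ht', hs'⟩ := hq s' he.agree hs
  exact ⟨t + t', s'', .seq he he', by omega, hs'⟩

/-- Sequences are nested to the right. Regrouping the leading commands allows one weakest
precondition to treat several assignments at once. -/
theorem Runs.assoc {p q r : Program} {s : State} {T : ℕ} {Q : State → Prop}
    (h : Runs (.seq (.seq p q) r) s T Q) : Runs (.seq p (.seq q r)) s T Q := by
  obtain ⟨t, s', he, ht, hs⟩ := h
  cases he with
  | seq he hr =>
    cases he with
    | seq hp hq => exact ⟨_, s', .seq hp (.seq hq hr), by omega, hs⟩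

theorem Runs.ite {b : Test} {p q : Program} {s : State} {T : ℕ} {Q : State → Prop} {T' : ℕ}
    (hp : b.Holds s → Runs p s T Q) (hq : ¬ b.Holds s → Runs q s T Q)
    (hT : b.cost + T + 1 ≤ T') : Runs (.ite b p q) s T' Q := by
  by_cases hb : b.Holds s
  · obtain ⟨t, s', he, ht, hs⟩ := hp hb
    exact ⟨_, s', .iteTrue hb he, by omega, hs⟩
  · obtain ⟨t, s', he, ht, hs⟩ := hq hb
    exact ⟨_, s', .iteFalse hb he, by omega, hs⟩

/-- The weakest precondition of a program without loops. -/
def Program.wp : Program → (State → Prop) → State → Prop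
  | skip, Q, s => Q s
  | setNat a i j e, Q, s => Q (s.setNat a (i.eval s) (j.eval s) (e.eval s))
  | setReal a i j e, Q, s => Q (s.setReal a (i.eval s) (j.eval s) (e.eval s))
  | seq p q, Q, s => p.wp (q.wp Q) s
  | ite b p q, Q, s => (b.Holds s → p.wp Q s) ∧ (¬ b.Holds s → q.wp Q s)
  | loop _ _, _, _ => False

/-- An upper bound for the running time of a program without loops. -/
def Program.maxCost : Program → ℕ
  | skip => 1
  | setNat _ i j e => i.cost + j.cost + e.cost + 1
  | setReal _ i j e => i.cost + j.cost + e.cost + 1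
  | seq p q => p.maxCost + q.maxCost
  | ite b p q => b.cost + p.maxCost + q.maxCost + 1
  -- Any value would do here, as `wp` is `False` for loops.
  | loop _ _ => 0

theorem Runs.of_wp {p : Program} {s : State} {T : ℕ} {Q : State → Prop} (hT : p.maxCost ≤ T)
    (h : p.wp Q s) : Runs p s T Q := by
  induction p generalizing s T Q with
  | skip => exact ⟨_, _, .skip s, hT, h⟩
  | setNat a i j e => exact ⟨_, _, .setNat a i j e s, hT, h⟩
  | setReal a i j e => exact ⟨_, _, .setReal a i j e s, hT, h⟩
  | seq p q ihp ihq =>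
    exact (ihp le_rfl h).seq (fun s' _ hs' => ihq le_rfl hs') hT
  | ite b p q ihp ihq =>
    simp only [Program.maxCost] at hT
    exact Runs.ite (T := p.maxCost + q.maxCost) (fun hb => ihp (by omega) (h.1 hb))
      (fun hb => ihq (by omega) (h.2 hb)) (by omega)
  | loop => exact h.elim

theorem wp_ite_iff {b : Test} {p q : Program} {Q : State → Prop} {s : State} :
    (Program.ite b p q).wp Q s ↔ (b.Holds s → p.wp Q s) ∧ (¬ b.Holds s → q.wp Q s) := Iff.rfl

/-- The value of the scalar variable `a`, the entry `(0, 0)` of the array `a`. -/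
abbrev var (a : ℕ) : NExpr := .get a (.const 0) (.const 0)

/-- Assignment to a scalar variable. -/
abbrev assign (a : ℕ) (e : NExpr) : Program := .setNat a (.const 0) (.const 0) e

/-- `for v = 0, …, b - 1 do p`. -/
def forLoop (v : ℕ) (b : NExpr) (p : Program) : Program :=
  .seq (assign v (.const 0))
    (.loop (.natLt (var v) b) (.seq p (assign v (.add (var v) (.const 1)))))

theorem forLoop_writesNat (v : ℕ) (b : NExpr) (p : Program) (a : ℕ) :
    (forLoop v b p).writesNat a = (a == v || (p.writesNat a || a == v)) := rfl

theorem forLoop_writesReal (v : ℕ) (b : NExpr) (p : Program) (a : ℕ) :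
    (forLoop v b p).writesReal a = p.writesReal a := by
  simp [forLoop, Program.writesReal]

theorem Agree.forLoop_body {v : ℕ} {b : NExpr} {p : Program} {s s' : State} (h : Agree p s s') :
    Agree (forLoop v b p) s s' := by
  refine ⟨fun a ha => h.1 a ?_, fun a ha => h.2 a ?_⟩
  · simp only [forLoop_writesNat, Bool.or_eq_false_iff] at ha; exact ha.2.1
  · rwa [forLoop_writesReal] at ha

/-- The rule for counting loops: `I i` is the invariant at the beginning of the `i`-th run of
the body, which takes `T i` steps. -/
theorem Runs.for {v : ℕ} {b : NExpr} {p : Program} {s : State} {N : ℕ} {T : ℕ → ℕ}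
    (I : ℕ → State → Prop) (hv : p.writesNat v = false) (hbc : b.cost ≤ 3)
    (hb : ∀ s', Agree (forLoop v b p) s s' → b.eval s' = N)
    (hI : ∀ i s' x, I i s' → I i (s'.setNat v 0 0 x)) (h0 : I 0 s)
    (step : ∀ i < N, ∀ s', Agree (forLoop v b p) s s' → s'.nat v 0 0 = i → I i s' →
      Runs p s' (T i) (I (i + 1))) :
    Runs (forLoop v b p) s (∑ i ∈ Finset.range N, (T i + 16) + 12) (I N) := by
  have hvw : (forLoop v b p).writesNat v = true := by simp [forLoop_writesNat]
  have key : ∀ d i s', i + d = N → Agree (forLoop v b p) s s' → s'.nat v 0 0 = i → I i s' →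
      Runs (.loop (.natLt (var v) b) (.seq p (assign v (.add (var v) (.const 1))))) s'
        (∑ j ∈ Finset.Ico i N, (T j + 16) + 8) (I N) := by
    intro d
    induction d with
    | zero =>
      intro i s' hi hA hs hIi
      have hi' : i = N := by omega
      subst hi'
      refine ⟨_, s', .loopFalse ?_, ?_, hIi⟩
      · simp [Test.Holds, NExpr.eval, hs, hb s' hA]
      · simp [Test.cost, NExpr.cost]; omega
    | succ d ih =>
      intro i s' hi hA hs hIi
      obtain ⟨t, s₁, he, ht, hs₁⟩ := step i (by omega) s' hA hs hIi
      have hv₁ : s₁.nat v 0 0 = i := by rw [he.agree.1 v hv, hs]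
      have hA₁ : Agree (forLoop v b p) s s₁ := hA.trans he.agree.forLoop_body
      obtain ⟨t', s₂, he', ht', hs₂⟩ := ih (i + 1) (s₁.setNat v 0 0 (i + 1)) (by omega)
        (hA₁.setNat _ _ _ hvw) (by simp) (hI _ _ _ hs₁)
      refine ⟨_, s₂, .loopTrue (t' := t') ?_ (.seq he (.setNat v (.const 0) (.const 0)
        (.add (var v) (.const 1)) s₁)) ?_, ?_, hs₂⟩
      · simp [Test.Holds, NExpr.eval, hs, hb s' hA]; omega
      · simpa [NExpr.eval, hv₁] using he'
      -- The overhead of 16 per run is at most 7 for the test, 1 for the loop step and 8 for the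
      -- increment. The final 12 is 8 for the last, failing test and 4 for the initial assignment.
      · rw [Finset.sum_eq_sum_Ico_succ_bot (by omega)]
        simp only [Test.cost, NExpr.cost]; omega
  obtain ⟨t, s', he, ht, hs⟩ := key N 0 (s.setNat v 0 0 0) (by omega)
    ((Agree.refl _ s).setNat _ _ _ hvw) (by simp) (hI _ _ _ h0)
  refine ⟨_, s', .seq (.setNat v (.const 0) (.const 0) (.const 0) s) he, ?_, hs⟩
  rw [Finset.range_eq_Ico]
  simp only [NExpr.cost]; omega

theorem Runs.for_const {v : ℕ} {b : NExpr} {p : Program} {s : State} {N T : ℕ}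
    (I : ℕ → State → Prop) (hv : p.writesNat v = false) (hbc : b.cost ≤ 3)
    (hb : ∀ s', Agree (forLoop v b p) s s' → b.eval s' = N)
    (hI : ∀ i s' x, I i s' → I i (s'.setNat v 0 0 x)) (h0 : I 0 s)
    (step : ∀ i < N, ∀ s', Agree (forLoop v b p) s s' → s'.nat v 0 0 = i → I i s' →
      Runs p s' T (I (i + 1))) {T' : ℕ} (hT : N * (T + 16) + 12 ≤ T') :
    Runs (forLoop v b p) s T' (I N) :=
  (Runs.for (T := fun _ => T) I hv hbc hb hI h0 step).mono (by simpa using hT)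
    fun _ _ h => h

end Framework

/-! ### The score as a sum over the records -/

section Score

variable {n : ℕ} (D : Dataset n)

/-- The value of the variable `i` in the record `r`, and zero outside the table. -/
def Dataset.entry (r i : ℕ) : ℕ :=
  if hr : r < D.size ∧ i < n then (D.record ⟨r, hr.1⟩ ⟨i, hr.2⟩).val else 0

theorem Dataset.entry_val (r : Fin D.size) (i : Fin n) : D.entry r i = (D.record r i).val := by
  simp [Dataset.entry]

theorem Dataset.entry_lt {r : ℕ} (hr : r < D.size) (i : Fin n) : D.entry r i < D.dom i := by
  simp [Dataset.entry, hr]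

theorem Dataset.entry_eq_iff (r r' : Fin D.size) (i : Fin n) :
    D.entry r i = D.entry r' i ↔ D.record r i = D.record r' i := by
  rw [D.entry_val, D.entry_val, Fin.ext_iff]

/-- The numbers `κ r` encode the values of the variables of `Z` in the records `r`. -/
def Dataset.Codes (κ : ℕ → ℕ) (Z : Finset (Fin n)) : Prop :=
  ∀ r < D.size, ∀ r' < D.size, κ r = κ r' ↔ ∀ i ∈ Z, D.entry r i = D.entry r' i

variable {D}

theorem Dataset.Codes.empty {κ : ℕ → ℕ} {c : ℕ} (hκ : ∀ r < D.size, κ r = c) : D.Codes κ ∅ := by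
  intro r hr r' hr'
  simp [hκ r hr, hκ r' hr']

theorem mul_add_injective {a b v w d : ℕ} (hv : v < d) (hw : w < d) :
    a * d + v = b * d + w ↔ a = b ∧ v = w := by
  refine ⟨fun h => ?_, fun h => by rw [h.1, h.2]⟩
  have h1 := congrArg (· / d) h
  have h2 := congrArg (· % d) h
  have hd : 0 < d := by omega
  simp only [mul_comm _ d, Nat.mul_add_div hd, Nat.mul_add_mod, Nat.div_eq_of_lt hv,
    Nat.div_eq_of_lt hw, Nat.mod_eq_of_lt hv, Nat.mod_eq_of_lt hw] at h1 h2
  exact ⟨by simpa using h1, h2⟩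

/-- One more digit in mixed radix: the value of `Y` is below `dom Y`, so the new number determines
the old one and the value. -/
theorem Dataset.Codes.insert {κ κ' : ℕ → ℕ} {Z : Finset (Fin n)} (h : D.Codes κ Z) (Y : Fin n)
    (hκ : ∀ r < D.size, κ' r = κ r * D.dom Y + D.entry r Y) : D.Codes κ' (insert Y Z) := by
  intro r hr r' hr'
  rw [hκ r hr, hκ r' hr', mul_add_injective (D.entry_lt hr Y) (D.entry_lt hr' Y), h r hr r' hr',
    Finset.forall_mem_insert]
  exact and_comm

/-- The number of `i < N` with the keys `x` and `y`. -/
def tally (N : ℕ) (k₁ k₂ : ℕ → ℕ) (x y : ℕ) : ℕ :=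
  ((Finset.range N).filter fun i => k₁ i = x ∧ k₂ i = y).card

theorem card_filter_range (N : ℕ) (p : ℕ → Prop) [DecidablePred p] :
    ((Finset.range N).filter p).card = (Finset.univ.filter fun i : Fin N => p i).card := by
  rw [Finset.card_filter, Finset.card_filter,
    ← Fin.sum_univ_eq_sum_range (fun i => if p i then 1 else 0) N]

theorem Dataset.count_record (X : Fin n) {Z : Finset (Fin n)} {κ : ℕ → ℕ} (hκ : D.Codes κ Z)
    (r : Fin D.size) :
    D.count X Z (D.record r X) (fun i => D.record r i)
      = tally D.size κ (fun i => D.entry i X) (κ r) (D.entry r X) := by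
  rw [tally, card_filter_range, Dataset.count]
  congr 1
  ext r'
  simp only [Finset.mem_filter, Finset.mem_univ, true_and]
  rw [hκ r' r'.2 r r.2, D.entry_eq_iff, and_comm]
  simp [D.entry_eq_iff]

theorem Dataset.countSum_record (X : Fin n) {Z : Finset (Fin n)} {κ : ℕ → ℕ} (hκ : D.Codes κ Z)
    (r : Fin D.size) :
    D.countSum X Z (fun i => D.record r i) = tally D.size κ (fun _ => 0) (κ r) 0 := by
  rw [tally, card_filter_range, Dataset.countSum]
  simp only [Dataset.count]
  rw [Finset.card_eq_sum_card_fiberwise (f := fun r' => D.record r' X) (t := Finset.univ)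
    (by simp)]
  refine Finset.sum_congr rfl fun x _ => ?_
  congr 1
  ext r'
  simp only [Finset.mem_filter, Finset.mem_univ, true_and, and_true]
  rw [hκ r' r'.2 r r.2, and_comm]
  simp [D.entry_eq_iff]

/-- A configuration is attained by exactly `N_{xz}` records, so its weight disappears when the sum
runs over records instead; configurations without records have weight zero. -/
theorem Dataset.logLik_eq (X : Fin n) {Z : Finset (Fin n)} {κ : ℕ → ℕ} (hκ : D.Codes κ Z) :
    (∑ x : Fin (D.dom X), ∑ z : D.Config Z,
      (D.count X Z x z : ℝ) * Real.log ((D.count X Z x z : ℝ) / (D.countSum X Z z : ℝ)))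
    = ∑ r ∈ Finset.range D.size,
      Real.log ((tally D.size κ (fun i => D.entry i X) (κ r) (D.entry r X) : ℝ)
        / (tally D.size κ (fun _ => 0) (κ r) 0 : ℝ)) := by
  rw [← Fin.sum_univ_eq_sum_range (fun r =>
    Real.log ((tally D.size κ (fun i => D.entry i X) (κ r) (D.entry r X) : ℝ)
        / (tally D.size κ (fun _ => 0) (κ r) 0 : ℝ))) D.size, ← Fintype.sum_prod_type',
    ← Finset.sum_fiberwise (s := (Finset.univ : Finset (Fin D.size)))
      (g := fun r => ((D.record r X, fun i => D.record r i) : Fin (D.dom X) × D.Config Z))]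
  refine Finset.sum_congr rfl fun p _ => ?_
  rw [Finset.sum_congr rfl (g := fun _ =>
    Real.log ((D.count X Z p.1 p.2 : ℝ) / (D.countSum X Z p.2 : ℝ)))]
  · rw [Finset.sum_const, nsmul_eq_mul, Dataset.count]
    congr 3
    ext r
    simp [Prod.ext_iff, funext_iff]
  · intro r hr
    simp only [Finset.mem_filter, Finset.mem_univ, true_and] at hr
    rw [← hr, D.count_record X hκ, D.countSum_record X hκ]

/-- The test statistic as a sum over the records: the penalty terms cancel. -/
theorem Dataset.fBIC_eq (hD : 1 ≤ D.size) {U V : Fin n} {Z : Finset (Fin n)} (hV : V ∉ Z)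
    {κ : ℕ → ℕ} (hκ : D.Codes κ Z) :
    D.fBIC U V Z = 2 * ∑ r ∈ Finset.range D.size,
      (Real.log ((tally D.size (fun i => κ i * D.dom V + D.entry i V) (fun i => D.entry i U)
            (κ r * D.dom V + D.entry r V) (D.entry r U) : ℝ)
          / (tally D.size κ (fun i => D.entry i V) (κ r) (D.entry r V) : ℝ))
        - Real.log ((tally D.size κ (fun i => D.entry i U) (κ r) (D.entry r U) : ℝ)
          / (tally D.size κ (fun _ => 0) (κ r) 0 : ℝ))) := by
  -- The penalties differ by the factor `dom V - 1`. Some record has a value of `V`, so this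
  -- truncated subtraction is a genuine one; the factor `dom U - 1` is common to all the terms.
  have hdV : 1 ≤ D.dom V := by
    have := D.entry_lt (r := 0) (by omega) V
    omega
  -- The number of records that agree with `r` on `Z ∪ {V}` is the denominator of the first score.
  -- It is read from a table with the two keys `κ` and `V`, instead of the joint code.
  have h1 : ∀ r ∈ Finset.range D.size,
      tally D.size κ (fun i => D.entry i V) (κ r) (D.entry r V)
        = tally D.size (fun i => κ i * D.dom V + D.entry i V) (fun _ => 0)
          (κ r * D.dom V + D.entry r V) 0 := by
    intro r hr
    unfold tally
    congr 1
    refine Finset.filter_congr fun i hi => ?_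
    rw [mul_add_injective (D.entry_lt (Finset.mem_range.1 hi) V)
      (D.entry_lt (Finset.mem_range.1 hr) V)]
    simp
  rw [Dataset.fBIC, Dataset.score, Dataset.score, Dataset.dof,
    D.logLik_eq U (hκ.insert V (fun r _ => rfl)), D.logLik_eq U hκ, Finset.prod_insert hV,
    Finset.sum_sub_distrib]
  rw [Finset.sum_congr rfl fun r hr => by rw [← h1 r hr]]
  push_cast [Nat.cast_sub hdV]
  ring

end Score

/-! ### Evaluation of the test statistic -/

section Evaluation

infixr:60 "⨟" => Program.seq

/-- The memory holds the input in the arrays 0 to 3 and the real array 0. -/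
structure Loaded {n : ℕ} (D : Dataset n) (G : Digraph (Fin n)) (h : ℕ) (α : ℝ) (s : State) :
    Prop where
  n_eq : s.nat 0 0 0 = n
  size_eq : s.nat 0 1 0 = D.size
  h_eq : s.nat 0 2 0 = h
  adj_iff : ∀ x y : Fin n, s.nat 1 x y = 1 ↔ G.Adj x y
  adj_zero : ∀ x y : Fin n, s.nat 1 x y = 0 ↔ ¬ G.Adj x y
  dom_eq : ∀ i : Fin n, s.nat 2 i 0 = D.dom i
  entry_eq : ∀ r i, s.nat 3 r i = D.entry r i
  alpha_eq : s.real 0 0 0 = α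

open Classical in
theorem loaded_input {n : ℕ} (D : Dataset n) (G : Digraph (Fin n)) (h : ℕ) (α : ℝ) :
    Loaded D G h α (input D G h α) := by
  have hadj : ∀ x y : Fin n, (∃ x' y' : Fin n, x'.val = x.val ∧ y'.val = y.val ∧ G.Adj x' y')
      ↔ G.Adj x y := by
    intro x y
    constructor
    · rintro ⟨x', y', hx, hy, h⟩
      rwa [Fin.ext hx, Fin.ext hy] at h
    · exact fun h => ⟨x, y, rfl, rfl, h⟩
  have hval : ∀ x y : Fin n, (input D G h α).nat 1 x y = if G.Adj x y then 1 else 0 := by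
    intro x y
    change (if _ then _ else _) = _
    simp only [hadj]
  refine ⟨rfl, rfl, rfl, fun x y => ?_, fun x y => ?_, fun i => ?_, fun r i => rfl, rfl⟩
  · simp [hval]
  · simp [hval]
  · simp [input]

theorem Loaded.of_eq {n : ℕ} {D : Dataset n} {G : Digraph (Fin n)} {h : ℕ} {α : ℝ} {s s' : State}
    (hL : Loaded D G h α s) (hn : ∀ a < 4, s'.nat a = s.nat a) (hr : s'.real 0 = s.real 0) :
    Loaded D G h α s' := by
  have h0 := hn 0 (by omega)
  have h1 := hn 1 (by omega)
  have h2 := hn 2 (by omega)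
  have h3 := hn 3 (by omega)
  constructor <;> simp only [h0, h1, h2, h3, hr]
  exacts [hL.1, hL.2, hL.3, hL.4, hL.5, hL.6, hL.7, hL.8]

/-- `p` does not change the input. -/
def Program.keepsInput (p : Program) : Bool :=
  !(p.writesNat 0 || p.writesNat 1 || p.writesNat 2 || p.writesNat 3 || p.writesReal 0)

theorem Loaded.agree {n : ℕ} {D : Dataset n} {G : Digraph (Fin n)} {h : ℕ} {α : ℝ} {s s' : State}
    {p : Program} (hL : Loaded D G h α s) (hA : Agree p s s') (hp : p.keepsInput = true) :
    Loaded D G h α s' := by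
  simp only [Program.keepsInput, Bool.not_eq_true', Bool.or_eq_false_iff] at hp
  obtain ⟨⟨⟨⟨h0, h1⟩, h2⟩, h3⟩, hr⟩ := hp
  refine hL.of_eq (fun a ha => ?_) (hA.2 0 hr)
  interval_cases a
  exacts [hA.1 0 h0, hA.1 1 h1, hA.1 2 h2, hA.1 3 h3]

/-- The number of variables. -/
abbrev eN : NExpr := .get 0 (.const 0) (.const 0)
/-- The number of records. -/
abbrev eSize : NExpr := .get 0 (.const 1) (.const 0)

/-- The names of the arrays that the evaluation uses. -/
notation "vRec" => 10
notation "vU" => 11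
notation "vV" => 12
notation "tZ" => 25
notation "tVZ" => 26
notation "tUZ" => 27
notation "tUVZ" => 28
notation "rStat" => 1

abbrev eEntry (v : ℕ) : NExpr := .get 3 (var vRec) (var v)
abbrev eDom (v : ℕ) : NExpr := .get 2 (var v) (.const 0)

/-- Adds to the entries of the array `a` the numbers of records with given keys. -/
def histogram (a : ℕ) (e f : NExpr) : Program :=
  forLoop vRec eSize (.setNat a e f (.add (.get a e f) (.const 1)))

/-- Sets the entries of the array `a` to zero at all keys of records. -/
def clear (a : ℕ) (e f : NExpr) : Program :=
  forLoop vRec eSize (.setNat a e f (.const 0))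

theorem tally_succ (N : ℕ) (k₁ k₂ : ℕ → ℕ) (x y : ℕ) :
    tally (N + 1) k₁ k₂ x y = tally N k₁ k₂ x y + if x = k₁ N ∧ y = k₂ N then 1 else 0 := by
  simp only [tally, Finset.card_filter, Finset.sum_range_succ, eq_comm]

theorem tally_pos {N : ℕ} {k₁ k₂ : ℕ → ℕ} {x y : ℕ} (h : tally N k₁ k₂ x y ≠ 0) :
    ∃ i < N, k₁ i = x ∧ k₂ i = y := by
  obtain ⟨i, hi⟩ := Finset.card_ne_zero.1 h
  simp only [Finset.mem_filter, Finset.mem_range] at hi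
  exact ⟨i, hi⟩

/-- In all the states that differ from `s` in the scalar `vRec` and the arrays from 25 on, the
expression `e` depends on the record as `k` does. -/
def KeyExpr (N : ℕ) (s : State) (e : NExpr) (k : ℕ → ℕ) : Prop :=
  ∀ i < N, ∀ s', (∀ b < 25, b ≠ vRec → s'.nat b = s.nat b) → s'.nat vRec 0 0 = i → e.eval s' = k i

theorem KeyExpr.congr {N : ℕ} {s s₁ : State} {e : NExpr} {k : ℕ → ℕ} (h : KeyExpr N s e k)
    (hs : ∀ b < 25, b ≠ vRec → s₁.nat b = s.nat b) : KeyExpr N s₁ e k :=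
  fun i hi s' hs' => h i hi s' fun b hb hb' => (hs' b hb hb').trans (hs b hb hb')

theorem runs_histogram {N a : ℕ} {e f : NExpr} {s : State} {k₁ k₂ : ℕ → ℕ}
    (ha : 25 ≤ a) (hN : s.nat 0 1 0 = N) (he : KeyExpr N s e k₁) (hf : KeyExpr N s f k₂)
    (hz : ∀ x y, s.nat a x y = 0) :
    Runs (histogram a e f) s (N * (2 * e.cost + 2 * f.cost + 20) + 12)
      (fun s' => s'.nat a = tally N k₁ k₂ ∧ (∀ b, b ≠ a → b ≠ vRec → s'.nat b = s.nat b) ∧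
        s'.real = s.real) := by
  refine Runs.for_const (T := 2 * e.cost + 2 * f.cost + 4)
    (fun i s' => s'.nat a = tally i k₁ k₂ ∧ (∀ b, b ≠ a → b ≠ vRec → s'.nat b = s.nat b) ∧
        s'.real = s.real)
    ?_ (by simp [NExpr.cost]) ?_ ?_ ?_ ?_ (by simp [add_assoc])
  · simp [Program.writesNat]; omega
  · intro s' hA
    have h0 : s'.nat 0 = s.nat 0 := hA.1 0 (by
      simp [forLoop_writesNat, Program.writesNat]; omega)
    simp [NExpr.eval, h0, hN]
  · rintro i s' x ⟨h1, h2, h3⟩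
    refine ⟨?_, fun b hb hb' => ?_, h3⟩
    · rw [State.setNat_nat_of_ne _ _ _ _ (by omega), h1]
    · rw [State.setNat_nat_of_ne _ _ _ _ hb', h2 b hb hb']
  · refine ⟨?_, fun _ _ _ => rfl, rfl⟩
    funext x y
    simp [hz, tally]
  · rintro i hi s' - hv ⟨h1, h2, h3⟩
    have hb : ∀ b < 25, b ≠ vRec → s'.nat b = s.nat b := fun b hb hb' => h2 b (by omega) hb'
    have he' := he i hi s' hb hv
    have hf' := hf i hi s' hb hv
    refine Runs.of_wp ?_ ?_
    · simp only [Program.maxCost, NExpr.cost]; omega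
    · refine ⟨?_, fun b hb hb' => ?_, h3⟩
      · funext x y
        simp only [State.setNat_nat_self, NExpr.eval, he', hf', h1, tally_succ]
        split_ifs with hxy
        · rw [hxy.1, hxy.2]
        · rfl
      · rw [State.setNat_nat_of_ne _ _ _ _ hb, h2 b hb hb']

/-- Only the cells at keys of records are nonzero, so a second pass over the records empties the
table, however large the range of the keys is. -/
theorem runs_clear {N a : ℕ} {e f : NExpr} {s : State} {k₁ k₂ : ℕ → ℕ}
    (ha : 25 ≤ a) (hN : s.nat 0 1 0 = N) (he : KeyExpr N s e k₁) (hf : KeyExpr N s f k₂)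
    (hz : s.nat a = tally N k₁ k₂) :
    Runs (clear a e f) s (N * (2 * e.cost + 2 * f.cost + 20) + 12)
      (fun s' => (∀ x y, s'.nat a x y = 0) ∧ (∀ b, b ≠ a → b ≠ vRec → s'.nat b = s.nat b) ∧
        s'.real = s.real) := by
  refine (Runs.for_const (N := N) (T := 2 * e.cost + 2 * f.cost + 4)
    -- A cell that is still nonzero belongs to a record that has not been visited.
    (fun i s' => (∀ x y, s'.nat a x y = 0 ∨ ∃ j < N, i ≤ j ∧ k₁ j = x ∧ k₂ j = y) ∧
      (∀ b, b ≠ a → b ≠ vRec → s'.nat b = s.nat b) ∧ s'.real = s.real)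
    ?_ (by simp [NExpr.cost]) ?_ ?_ ?_ ?_ (T' := _) (by simp [add_assoc])).mono le_rfl ?_
  · simp [Program.writesNat]; omega
  · intro s' hA
    have h0 : s'.nat 0 = s.nat 0 := hA.1 0 (by
      simp [forLoop_writesNat, Program.writesNat]; omega)
    simp [NExpr.eval, h0, hN]
  · rintro i s' x ⟨h1, h2, h3⟩
    refine ⟨?_, fun b hb hb' => ?_, h3⟩
    · rw [State.setNat_nat_of_ne _ _ _ _ (by omega)]; exact h1
    · rw [State.setNat_nat_of_ne _ _ _ _ hb', h2 b hb hb']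
  · refine ⟨fun x y => ?_, fun _ _ _ => rfl, rfl⟩
    by_cases h : s.nat a x y = 0
    · exact .inl h
    · rw [hz] at h
      obtain ⟨j, hj, hk⟩ := tally_pos h
      exact .inr ⟨j, hj, by omega, hk⟩
  · rintro i hi s' - hv ⟨h1, h2, h3⟩
    have hb : ∀ b < 25, b ≠ vRec → s'.nat b = s.nat b := fun b hb hb' => h2 b (by omega) hb'
    have he' := he i hi s' hb hv
    have hf' := hf i hi s' hb hv
    refine Runs.of_wp ?_ ?_
    · simp only [Program.maxCost, NExpr.cost]; omega
    · refine ⟨fun x y => ?_, fun b hb hb' => ?_, h3⟩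
      · simp only [State.setNat_nat_self, NExpr.eval, he', hf']
        split_ifs with hxy
        · exact .inl rfl
        · refine (h1 x y).imp id ?_
          rintro ⟨j, hj, hij, hk₁, hk₂⟩
          refine ⟨j, hj, ?_, hk₁, hk₂⟩
          rcases Nat.lt_or_ge i j with h | h
          · exact h
          · have : j = i := by omega
            subst this
            exact absurd ⟨hk₁.symm, hk₂.symm⟩ hxy
      · rw [State.setNat_nat_of_ne _ _ _ _ hb, h2 b hb hb']
  · rintro s' - ⟨h1, h2, h3⟩
    refine ⟨fun x y => (h1 x y).resolve_right ?_, h2, h3⟩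
    rintro ⟨j, hj, hj', -⟩
    omega

/-- The key of a record for the conditioning set together with the variable `V`. -/
abbrev joinKey (e : NExpr) : NExpr := .add (.mul e (eDom vV)) (eEntry vV)

/-- The contribution of a record to the test statistic. -/
def statTerm (e : NExpr) : RExpr :=
  .sub
    (.log (.div (.ofNat (.get tUVZ (joinKey e) (eEntry vU))) (.ofNat (.get tVZ e (eEntry vV)))))
    (.log (.div (.ofNat (.get tUZ e (eEntry vU))) (.ofNat (.get tZ e (.const 0)))))

/-- Computes the test statistic for the variables `vU` and `vV` given a set of variables whose values
are encoded by `e`. -/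
def evalStat (e : NExpr) : Program :=
  histogram tZ e (.const 0) ⨟
  histogram tVZ e (eEntry vV) ⨟
  histogram tUZ e (eEntry vU) ⨟
  histogram tUVZ (joinKey e) (eEntry vU) ⨟
  .setReal rStat (.const 0) (.const 0) (.ofNat (.const 0)) ⨟
  forLoop vRec eSize (.setReal rStat (.const 0) (.const 0)
    (.add (.get rStat (.const 0) (.const 0)) (statTerm e))) ⨟
  clear tZ e (.const 0) ⨟
  clear tVZ e (eEntry vV) ⨟
  clear tUZ e (eEntry vU) ⨟
  clear tUVZ (joinKey e) (eEntry vU) ⨟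
  .setReal rStat (.const 0) (.const 0)
    (.mul (.ofNat (.const 2)) (.get rStat (.const 0) (.const 0)))

/-- The tables of the evaluation are empty. -/
def Clean (s : State) : Prop :=
  (∀ x y, s.nat tZ x y = 0) ∧ (∀ x y, s.nat tVZ x y = 0) ∧ (∀ x y, s.nat tUZ x y = 0) ∧
    ∀ x y, s.nat tUVZ x y = 0

theorem runs_evalStat {n : ℕ} {D : Dataset n} {G : Digraph (Fin n)} {h : ℕ} {α : ℝ} {s : State}
    (hL : Loaded D G h α s) (hD : 1 ≤ D.size) (hC : Clean s) {e : NExpr} (hec : e.cost ≤ 20)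
    {κ : ℕ → ℕ} (he : KeyExpr D.size s e κ) {U V : Fin n} (hU : s.nat vU 0 0 = U)
    (hV : s.nat vV 0 0 = V) {Z : Finset (Fin n)} (hκ : D.Codes κ Z) (hVZ : V ∉ Z) :
    Runs (evalStat e) s (2000 * D.size) (fun s' => s'.real rStat 0 0 = D.fBIC U V Z ∧ Clean s') := by
  have hdom : s.nat 2 V 0 = D.dom V := hL.dom_eq V
  have k0 : KeyExpr D.size s (.const 0) fun _ => 0 := fun _ _ _ _ _ => rfl
  have kV : KeyExpr D.size s (eEntry vV) fun i => D.entry i V := by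
    intro i hi s' hs hr
    simp [NExpr.eval, hr, hs 3, hs vV, hV, hL.entry_eq]
  have kU : KeyExpr D.size s (eEntry vU) fun i => D.entry i U := by
    intro i hi s' hs hr
    simp [NExpr.eval, hr, hs 3, hs vU, hU, hL.entry_eq]
  have kJ : KeyExpr D.size s (joinKey e) fun i => κ i * D.dom V + D.entry i V := by
    intro i hi s' hs hr
    have h1 := he i hi s' hs hr
    simp [NExpr.eval, h1, hr, hs 2, hs 3, hs vV, hV, hdom, hL.entry_eq]
  obtain ⟨c1, c2, c3, c4⟩ := hC
  have hN := hL.size_eq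
  -- From here on `T₂` is the budget left for the rest of the program. The numerical constants are
  -- generous, and `1 ≤ D.size` absorbs the additive ones.
  refine (runs_histogram (by omega) hN he k0 c1).seq (T₂ := 1900 * D.size) ?_
    (by simp only [NExpr.cost]; nlinarith)
  rintro s1 - ⟨a1, f1, r1⟩
  have g1 : ∀ b < 25, b ≠ vRec → s1.nat b = s.nat b := fun b hb hb' => f1 b (by omega) hb'
  refine (runs_histogram (by omega) (by rw [g1 0 (by omega) (by omega), hN]) (he.congr g1)
    (kV.congr g1) (by rw [f1 tVZ (by omega) (by omega)]; exact c2)).seq (T₂ := 1750 * D.size) ?_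
    (by simp only [NExpr.cost]; nlinarith)
  rintro s2 - ⟨a2, f2, r2⟩
  have g2 : ∀ b < 25, b ≠ vRec → s2.nat b = s.nat b :=
    fun b hb hb' => (f2 b (by omega) hb').trans (g1 b hb hb')
  refine (runs_histogram (by omega) (by rw [g2 0 (by omega) (by omega), hN]) (he.congr g2)
    (kU.congr g2) (by
      rw [f2 tUZ (by omega) (by omega), f1 tUZ (by omega) (by omega)]; exact c3)).seq
    (T₂ := 1600 * D.size) ?_ (by simp only [NExpr.cost]; nlinarith)
  rintro s3 - ⟨a3, f3, r3⟩
  have g3 : ∀ b < 25, b ≠ vRec → s3.nat b = s.nat b :=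
    fun b hb hb' => (f3 b (by omega) hb').trans (g2 b hb hb')
  refine (runs_histogram (by omega) (by rw [g3 0 (by omega) (by omega), hN]) (kJ.congr g3)
    (kU.congr g3) (by
      rw [f3 tUVZ (by omega) (by omega), f2 tUVZ (by omega) (by omega),
        f1 tUVZ (by omega) (by omega)]; exact c4)).seq
    (T₂ := 1400 * D.size) ?_ (by simp only [NExpr.cost]; nlinarith)
  rintro s4 - ⟨a4, f4, r4⟩
  have g4 : ∀ b < 25, b ≠ vRec → s4.nat b = s.nat b :=
    fun b hb hb' => (f4 b (by omega) hb').trans (g3 b hb hb')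
  have t1 : s4.nat tZ = tally D.size κ fun _ => 0 := by
    rw [f4 tZ (by omega) (by omega), f3 tZ (by omega) (by omega), f2 tZ (by omega) (by omega), a1]
  have t2 : s4.nat tVZ = tally D.size κ fun i => D.entry i V := by
    rw [f4 tVZ (by omega) (by omega), f3 tVZ (by omega) (by omega), a2]
  have t3 : s4.nat tUZ = tally D.size κ fun i => D.entry i U := by
    rw [f4 tUZ (by omega) (by omega), a3]
  have hset : Runs (.setReal rStat (.const 0) (.const 0) (.ofNat (.const 0))) s4 5
      (fun s' => s'.nat = s4.nat ∧ s'.real rStat 0 0 = 0) := by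
    refine Runs.of_wp (by simp [Program.maxCost, NExpr.cost, RExpr.cost]) ?_
    simp [Program.wp, NExpr.eval, RExpr.eval]
  refine hset.seq (T₂ := 1390 * D.size) ?_ (by omega)
  rintro s5 - ⟨f5, z5⟩
  let term : ℕ → ℝ := fun r =>
      (Real.log ((tally D.size (fun i => κ i * D.dom V + D.entry i V) (fun i => D.entry i U)
            (κ r * D.dom V + D.entry r V) (D.entry r U) : ℝ)
          / (tally D.size κ (fun i => D.entry i V) (κ r) (D.entry r V) : ℝ))
        - Real.log ((tally D.size κ (fun i => D.entry i U) (κ r) (D.entry r U) : ℝ)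
          / (tally D.size κ (fun _ => 0) (κ r) 0 : ℝ)))
  have hsum : Runs (forLoop vRec eSize (.setReal rStat (.const 0) (.const 0)
      (.add (.get rStat (.const 0) (.const 0)) (statTerm e)))) s5 (D.size * (200 + 16) + 12)
      (fun s' => (∀ b, b ≠ vRec → s'.nat b = s5.nat b) ∧
        s'.real rStat 0 0 = ∑ r ∈ Finset.range D.size, term r) := by
    refine Runs.for_const (T := 200) (fun i s' => (∀ b, b ≠ vRec → s'.nat b = s5.nat b) ∧
        s'.real rStat 0 0 = ∑ r ∈ Finset.range i, term r)
      rfl (by simp [NExpr.cost]) ?_ ?_ ?_ ?_ le_rfl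
    · intro s' hA
      have h0 : s'.nat 0 = s5.nat 0 := hA.1 0 rfl
      simp [NExpr.eval, h0, f5, g4, hN]
    · rintro i s' x ⟨h1, h2⟩
      refine ⟨fun b hb => ?_, h2⟩
      rw [State.setNat_nat_of_ne _ _ _ _ hb, h1 b hb]
    · exact ⟨fun _ _ => rfl, by simpa using z5⟩
    · rintro i hi s' - hv ⟨h1, h2⟩
      have hb : ∀ b < 25, b ≠ vRec → s'.nat b = s.nat b := by
        intro b hb hb'
        rw [h1 b hb', f5, g4 b hb hb']
      have e1 := he i hi s' hb hv
      have e2 := kV i hi s' hb hv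
      have e3 := kU i hi s' hb hv
      have e4 : s'.nat 2 (s'.nat vV 0 0) 0 = D.dom V := by simp [hb, hV, hdom]
      simp only [NExpr.eval] at e2 e3
      refine Runs.of_wp ?_ ⟨fun b hb => h1 b hb, ?_⟩
      · simp only [Program.maxCost, NExpr.cost, RExpr.cost, statTerm]; omega
      · simp only [NExpr.eval, RExpr.eval, statTerm, State.setReal_real_self, and_self, if_true,
          Finset.sum_range_succ, h2, e1, e2, e3, e4, h1 tZ (by omega), h1 tVZ (by omega),
          h1 tUZ (by omega), h1 tUVZ (by omega), f5, t1, t2, t3, a4, term]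
  refine hsum.seq (T₂ := 1100 * D.size) ?_ (by omega)
  rintro s6 - ⟨f6, z6⟩
  have g6 : ∀ b < 25, b ≠ vRec → s6.nat b = s.nat b := by
    intro b hb hb'
    rw [f6 b hb', f5, g4 b hb hb']
  refine (runs_clear (by omega) (by rw [g6 0 (by omega) (by omega), hN]) (he.congr g6)
    (k0.congr g6) (by rw [f6 tZ (by omega), f5, t1])).seq (T₂ := 1000 * D.size) ?_
    (by simp only [NExpr.cost]; nlinarith)
  rintro s7 - ⟨a7, f7, r7⟩
  have g7 : ∀ b < 25, b ≠ vRec → s7.nat b = s.nat b :=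
    fun b hb hb' => (f7 b (by omega) hb').trans (g6 b hb hb')
  refine (runs_clear (by omega) (by rw [g7 0 (by omega) (by omega), hN]) (he.congr g7)
    (kV.congr g7) (by rw [f7 tVZ (by omega) (by omega), f6 tVZ (by omega), f5, t2])).seq
    (T₂ := 850 * D.size) ?_ (by simp only [NExpr.cost]; nlinarith)
  rintro s8 - ⟨a8, f8, r8⟩
  have g8 : ∀ b < 25, b ≠ vRec → s8.nat b = s.nat b :=
    fun b hb hb' => (f8 b (by omega) hb').trans (g7 b hb hb')
  refine (runs_clear (by omega) (by rw [g8 0 (by omega) (by omega), hN]) (he.congr g8)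
    (kU.congr g8) (by rw [f8 tUZ (by omega) (by omega), f7 tUZ (by omega) (by omega),
      f6 tUZ (by omega), f5, t3])).seq
    (T₂ := 700 * D.size) ?_ (by simp only [NExpr.cost]; nlinarith)
  rintro s9 - ⟨a9, f9, r9⟩
  have g9 : ∀ b < 25, b ≠ vRec → s9.nat b = s.nat b :=
    fun b hb hb' => (f9 b (by omega) hb').trans (g8 b hb hb')
  refine (runs_clear (by omega) (by rw [g9 0 (by omega) (by omega), hN]) (kJ.congr g9)
    (kU.congr g9) (by rw [f9 tUVZ (by omega) (by omega), f8 tUVZ (by omega) (by omega),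
      f7 tUVZ (by omega) (by omega), f6 tUVZ (by omega), f5, a4])).seq
    (T₂ := 10 * D.size) ?_ (by simp only [NExpr.cost]; nlinarith)
  rintro s10 - ⟨a10, f10, r10⟩
  refine Runs.of_wp (by simp only [Program.maxCost, NExpr.cost, RExpr.cost]; omega) ⟨?_, ?_⟩
  · simp only [NExpr.eval, RExpr.eval, State.setReal_real_self, and_self, if_true, r10, r9, r8, r7,
      z6, D.fBIC_eq hD hVZ hκ, term]
    norm_num
  · refine ⟨?_, ?_, ?_, a10⟩
    · simpa [f10, f9, f8] using a7
    · simpa [f10, f9] using a8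
    · simpa [f10] using a9

end Evaluation

/-! ### The search for a conditioning set -/

section Search

notation "vX" => 13
notation "vMode" => 14
notation "vProd" => 15
notation "vSlots" => 16
notation "vRound" => 17
notation "vY" => 18
notation "vBest" => 19
notation "vFound" => 20
notation "vGo" => 21
notation "vFirst" => 22
notation "aBlocked" => 23
notation "aKey" => 24
notation "rBest" => 2

abbrev eH : NExpr := .get 0 (.const 2) (.const 0)
/-- The key of a record for the current set. -/
abbrev eKey : NExpr := .get aKey (var vRec) (.const 0)
/-- The key of a record for the current set together with the variable `vY`. -/
abbrev eKeyY : NExpr := .add (.mul eKey (eDom vY)) (eEntry vY)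

/-- The test of independence: the statistic in the real scalar `a` is below the critical value, if
`e` is the number of joint values of the conditioning set. -/
def judgeTest (a : ℕ) (e : NExpr) : Test :=
  .realLt (.get a (.const 0) (.const 0))
    (.crit (.mul (.mul (.sub (eDom vU) (.const 1)) (.sub (eDom vV) (.const 1))) e)
      (.get 0 (.const 0) (.const 0)))

/-- Determines the best variable outside the blocked ones. -/
def bestLoop : Program :=
  assign vBest eN ⨟
  forLoop vY eN
    (.ite (.natEq (.get aBlocked (var vY) (.const 0)) (.const 0))
      (evalStat eKeyY ⨟
        .ite (.and (.not (.natEq (var vBest) eN))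
            (.not (.realLt (.get rStat (.const 0) (.const 0)) (.get rBest (.const 0) (.const 0)))))
          .skip
          (assign vBest (var vY) ⨟
            .setReal rBest (.const 0) (.const 0) (.get rStat (.const 0) (.const 0))))
      .skip)

/-- Adds the best variable to the current set. -/
def growStep : Program :=
  bestLoop ⨟
  .ite (.natEq (var vBest) eN) (assign vGo (.const 0))
    (assign vY (var vBest) ⨟
      forLoop vRec eSize (.setNat aKey (var vRec) (.const 0) eKeyY) ⨟
      assign vProd (.mul (var vProd) (eDom vY)) ⨟
      .setNat aBlocked (var vY) (.const 0) (.const 1) ⨟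
      .ite (judgeTest rBest (var vProd)) (assign vFound (.const 1)) .skip)

/-- Initializes the search: the variables `vX`, `vU`, `vV` are blocked, and the current set is
empty if `vMode` is `0`, and consists of `vX` if `vMode` is `1`. -/
def initSearch : Program :=
  forLoop vFirst eN (.setNat aBlocked (var vFirst) (.const 0) (.const 0)) ⨟
  forLoop vRec eSize (.setNat aKey (var vRec) (.const 0) (.mul (var vMode) (eEntry vX))) ⨟
  .setNat aBlocked (var vX) (.const 0) (.const 1) ⨟
  .setNat aBlocked (var vU) (.const 0) (.const 1) ⨟
  .setNat aBlocked (var vV) (.const 0) (.const 1) ⨟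
  assign vProd (.add (.sub (.const 1) (var vMode)) (.mul (var vMode) (eDom vX))) ⨟
  assign vSlots (.sub eH (var vMode)) ⨟
  assign vFound (.const 0) ⨟
  assign vGo (.const 1)

/-- The search for a conditioning set for the variables `vU` and `vV`. -/
def search : Program :=
  initSearch ⨟
  evalStat eKey ⨟
  .ite (judgeTest rStat (var vProd)) (assign vFound (.const 1)) .skip ⨟
  forLoop vRound (var vSlots)
    (.ite (.and (.natEq (var vFound) (.const 0)) (.natEq (var vGo) (.const 1))) growStep .skip)

variable {n : ℕ} {D : Dataset n} {G : Digraph (Fin n)} {h : ℕ} {α : ℝ}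

/-- The memory holds the codes and the number of joint values of the set `Z`. -/
def Coded (D : Dataset n) (Z : Finset (Fin n)) (s : State) : Prop :=
  D.Codes (fun r => s.nat aKey r 0) Z ∧ s.nat vProd 0 0 = ∏ i ∈ Z, D.dom i

/-- The blocked variables are those of `B`. -/
def Blocked (B : Finset (Fin n)) (s : State) : Prop :=
  ∀ i : Fin n, s.nat aBlocked i 0 = 0 ↔ i ∉ B

/-- The memory holds the optional variable `o` and its value under `f`. -/
def IsBest (f : Fin n → ℝ) (o : Option (Fin n)) (s : State) : Prop :=
  (o = none → s.nat vBest 0 0 = n) ∧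
    ∀ b, o = some b → s.nat vBest 0 0 = b ∧ s.real rBest 0 0 = f b

/-- `List.argmin` moves to a later entry only on a strict improvement, so one more variable means
one comparison, and ties go to the earlier variable. -/
theorem argmin_filter_take_succ (f : Fin n → ℝ) (B : Finset (Fin n)) {i : ℕ} (hi : i < n) :
    (((List.finRange n).take (i + 1)).filter fun Y => Y ∉ B).argmin f =
      if (⟨i, hi⟩ : Fin n) ∈ B then (((List.finRange n).take i).filter fun Y => Y ∉ B).argmin f
      else match (((List.finRange n).take i).filter fun Y => Y ∉ B).argmin f with
        | none => some ⟨i, hi⟩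
        | some c => if f ⟨i, hi⟩ < f c then some ⟨i, hi⟩ else some c := by
  rw [List.take_succ_eq_append_getElem (by simpa using hi), List.filter_append]
  split_ifs with hB
  · simp [hB]
  · simp only [List.getElem_finRange, Fin.cast_mk, hB, not_false_eq_true, decide_true,
      List.filter_cons_of_pos, List.filter_nil, List.argmin_concat]
    cases (((List.finRange n).take i).filter fun Y => Y ∉ B).argmin f <;> rfl

theorem KeyExpr.eKey (N : ℕ) (s : State) : KeyExpr N s eKey fun r => s.nat aKey r 0 := by
  intro i hi s' hs hr
  simp [NExpr.eval, hr, hs]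

theorem KeyExpr.eKeyY {s : State} (hL : Loaded D G h α s) {Y : Fin n} (hY : s.nat vY 0 0 = Y)
    (N : ℕ) : KeyExpr N s eKeyY fun r => s.nat aKey r 0 * D.dom Y + D.entry r Y := by
  intro i hi s' hs hr
  simp [NExpr.eval, hr, hs, hY, hL.dom_eq, hL.entry_eq]

theorem holds_judgeTest {s : State} (hL : Loaded D G h α s) {U V : Fin n} (hU : s.nat vU 0 0 = U)
    (hV : s.nat vV 0 0 = V) {Z : Finset (Fin n)} {a : ℕ} {e : NExpr}
    (ha : s.real a 0 0 = D.fBIC U V Z) (he : e.eval s = ∏ i ∈ Z, D.dom i) :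
    (judgeTest a e).Holds s ↔ JudgedIndep D α U V Z := by
  simp [judgeTest, Test.Holds, RExpr.eval, NExpr.eval, ha, he, hU, hV, hL.dom_eq, hL.alpha_eq,
    JudgedIndep, Dataset.dof]

theorem runs_bestLoop {s : State} (hL : Loaded D G h α s) (hD : 1 ≤ D.size) (hC : Clean s)
    {U V : Fin n} (hU : s.nat vU 0 0 = U) (hV : s.nat vV 0 0 = V) {Z F : Finset (Fin n)}
    (hZ : D.Codes (fun r => s.nat aKey r 0) Z) (hVZ : V ∉ Z) (hVF : V ∈ F)
    (hB : Blocked (Z ∪ F) s) :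
    Runs bestLoop s (2150 * (n * D.size)) (fun s' => Clean s' ∧
      IsBest (fun Y => D.fBIC U V (insert Y Z)) (bestVar D U V F Z) s') := by
  have hn : 1 ≤ n := by have := U.2; omega
  have hnD : 1 ≤ n * D.size := Nat.mul_pos hn hD
  have hset : Runs (assign vBest eN) s 6 (fun s' => s'.nat vBest 0 0 = n) := by
    refine Runs.of_wp (by simp [Program.maxCost, NExpr.cost]) ?_
    simp [Program.wp, NExpr.eval, hL.n_eq]
  refine hset.seq (T₂ := n * (2000 * D.size + 70 + 16) + 12) ?_ (by nlinarith)
  intro s1 A1 b1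
  have hL1 : Loaded D G h α s1 := hL.agree A1 rfl
  refine (Runs.for_const (N := n) (T := 2000 * D.size + 70) (fun i s' => Clean s' ∧
    IsBest (fun Y => D.fBIC U V (insert Y Z))
      ((((List.finRange n).take i).filter fun Y => Y ∉ Z ∪ F).argmin
        fun Y => D.fBIC U V (insert Y Z)) s')
    rfl (by simp [NExpr.cost]) ?_ ?_ ?_ ?_ le_rfl).mono le_rfl ?_
  · intro s' hA
    exact (hL1.agree hA rfl).n_eq
  · rintro i s' x ⟨h1, h2⟩
    exact ⟨by simpa [Clean] using h1, by simpa [IsBest] using h2⟩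
  · refine ⟨?_, ?_, ?_⟩
    · simpa [Clean, A1.1 tZ rfl, A1.1 tVZ rfl, A1.1 tUZ rfl, A1.1 tUVZ rfl] using hC
    · intro _; exact b1
    · simp
  · rintro i hi s' hA hv ⟨h1, h2⟩
    have hLs : Loaded D G h α s' := hL1.agree hA rfl
    have eK : s'.nat aKey = s.nat aKey := by rw [hA.1 aKey rfl, A1.1 aKey rfl]
    have eB : s'.nat aBlocked = s.nat aBlocked := by rw [hA.1 aBlocked rfl, A1.1 aBlocked rfl]
    have eU : s'.nat vU 0 0 = U := by rw [hA.1 vU rfl, A1.1 vU rfl, hU]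
    have eV : s'.nat vV 0 0 = V := by rw [hA.1 vV rfl, A1.1 vV rfl, hV]
    have hblk : s'.nat aBlocked i 0 = 0 ↔ (⟨i, hi⟩ : Fin n) ∉ Z ∪ F := by
      rw [eB]; exact hB ⟨i, hi⟩
    refine Runs.ite (T := 2000 * D.size + 60) ?_ ?_ (by simp only [Test.cost, NExpr.cost]; omega)
    · intro ht
      have hmem : (⟨i, hi⟩ : Fin n) ∉ Z ∪ F := hblk.1 (by
        simpa [Test.Holds, NExpr.eval, hv] using ht)
      have hVY : V ∉ insert (⟨i, hi⟩ : Fin n) Z := by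
        intro hmem'
        rcases Finset.mem_insert.1 hmem' with hVi | hVZ'
        · exact hmem (Finset.mem_union_right _ (hVi ▸ hVF))
        · exact hVZ hVZ'
      refine (runs_evalStat hLs hD h1 (by simp [NExpr.cost])
        (KeyExpr.eKeyY hLs (Y := ⟨i, hi⟩) hv D.size) eU eV
        (Dataset.Codes.insert (by rw [eK]; exact hZ) ⟨i, hi⟩ fun _ _ => rfl) hVY).seq
        (T₂ := 60) ?_ le_rfl
      rintro s2 A2 ⟨z2, C2⟩
      have v2 : s2.nat vY 0 0 = i := by rw [A2.1 vY rfl, hv]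
      have n2 : s2.nat 0 0 0 = n := by rw [A2.1 0 rfl]; exact hLs.n_eq
      have b2 : s2.nat vBest 0 0 = s'.nat vBest 0 0 := by rw [A2.1 vBest rfl]
      have r2 : s2.real rBest 0 0 = s'.real rBest 0 0 := by rw [A2.2 rBest rfl]
      refine Runs.of_wp (by simp [Program.maxCost, Test.cost, NExpr.cost, RExpr.cost]) ?_
      rw [argmin_filter_take_succ _ _ hi, if_neg hmem]
      simp only [Program.wp, Test.Holds, NExpr.eval, RExpr.eval, n2, b2, r2, z2, v2]
      cases hm : (((List.finRange n).take i).filter fun Y => Y ∉ Z ∪ F).argmin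
        fun Y => D.fBIC U V (insert Y Z) with
      | none =>
        have hb := h2.1 hm
        simp only [hb, not_true_eq_false, false_and, false_implies, true_and, not_false_eq_true,
          forall_const]
        refine ⟨by simpa [Clean] using C2, by simp, ?_⟩
        rintro b hb'
        cases hb'
        simp [z2]
      | some c =>
        obtain ⟨hb, hr⟩ := h2.2 c hm
        have hne : ¬ (s'.nat vBest 0 0 = n) := by rw [hb]; have := c.2; omega
        simp only [hne, not_false_eq_true, true_and, hr]
        refine ⟨fun hlt => ⟨C2, by simp [hlt], ?_⟩, fun hlt => ?_⟩
        · rintro b hb'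
          rw [if_neg hlt] at hb'
          cases hb'
          exact ⟨by rw [b2, hb], by rw [r2, hr]⟩
        · have hlt' := not_not.1 hlt
          refine ⟨by simpa [Clean] using C2, by simp [hlt'], ?_⟩
          rintro b hb'
          rw [if_pos hlt'] at hb'
          cases hb'
          simp [z2]
    · intro ht
      have hmem : (⟨i, hi⟩ : Fin n) ∈ Z ∪ F := by
        by_contra hmem
        exact ht (by simpa [Test.Holds, NExpr.eval, hv] using hblk.2 hmem)
      refine Runs.of_wp (by simp [Program.maxCost]) ⟨h1, ?_⟩
      rw [argmin_filter_take_succ _ _ hi, if_pos hmem]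
      exact h2
  · rintro s' - ⟨h1, h2⟩
    refine ⟨h1, ?_⟩
    rwa [List.take_of_length_le (by simp)] at h2

/-- The state of the search before its last `k` rounds: `R` is the final result. -/
def SearchInv (D : Dataset n) (α : ℝ) (U V : Fin n) (F : Finset (Fin n))
    (R : Option (Finset (Fin n))) (k : ℕ) (s : State) : Prop :=
  Clean s ∧ ∃ Z, V ∉ Z ∧ Coded D Z s ∧
    ((s.nat vFound 0 0 = 1 ∧ R = some Z) ∨
      (s.nat vFound 0 0 = 0 ∧ s.nat vGo 0 0 = 0 ∧ R = none) ∨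
      (s.nat vFound 0 0 = 0 ∧ s.nat vGo 0 0 = 1 ∧ Blocked (Z ∪ F) s ∧
        R = growLoop D α U V F k Z))

theorem bestVar_not_mem {U V X : Fin n} {F Z : Finset (Fin n)} (h : bestVar D U V F Z = some X) :
    X ∉ Z ∪ F := by
  have := List.argmin_mem (h : X ∈ bestVar D U V F Z)
  simpa using (List.mem_filter.1 this).2

theorem runs_addKey {s : State} (hL : Loaded D G h α s) {Y : Fin n} (hY : s.nat vY 0 0 = Y) :
    Runs (forLoop vRec eSize (.setNat aKey (var vRec) (.const 0) eKeyY)) s (D.size * 50 + 12)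
      (fun s' => ∀ r < D.size, s'.nat aKey r 0 = s.nat aKey r 0 * D.dom Y + D.entry r Y) := by
  refine (Runs.for_const (N := D.size) (T := 30) (fun i s' => ∀ r, s'.nat aKey r 0 =
      if r < i then s.nat aKey r 0 * D.dom Y + D.entry r Y else s.nat aKey r 0)
    rfl (by simp [NExpr.cost]) ?_ ?_ (by simp) ?_ le_rfl).mono (by omega) ?_
  · intro s' hA
    exact (hL.agree hA rfl).size_eq
  · intro i s' x hI
    simpa using hI
  · intro i hi s' hA hv hI
    have hLs : Loaded D G h α s' := hL.agree hA rfl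
    have eY : s'.nat vY 0 0 = Y := by rw [hA.1 vY rfl, hY]
    refine Runs.of_wp (by simp [Program.maxCost, NExpr.cost]) ?_
    intro r
    simp only [NExpr.eval, State.setNat_nat_self, hv, eY, hLs.dom_eq, hLs.entry_eq, hI, and_true]
    by_cases hr : r = i
    · simp [hr]
    · rw [if_neg hr]
      have : r < i + 1 ↔ r < i := by omega
      simp [this]
  · intro s' _ hI r hr
    rw [hI r, if_pos hr]

/-- The final result `R` is fixed in advance. A round unfolds one step of `growLoop`, and its three
outcomes are the three cases of `SearchInv`. -/
theorem runs_growStep {s : State} (hL : Loaded D G h α s) (hD : 1 ≤ D.size)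
    {U V : Fin n} (hU : s.nat vU 0 0 = U) (hV : s.nat vV 0 0 = V) {F : Finset (Fin n)}
    (hVF : V ∈ F) {R : Option (Finset (Fin n))} {k : ℕ} (hC : Clean s) {Z : Finset (Fin n)}
    (hVZ : V ∉ Z) (hZ : Coded D Z s) (hf : s.nat vFound 0 0 = 0) (hg : s.nat vGo 0 0 = 1)
    (hB : Blocked (Z ∪ F) s) (hR : R = growLoop D α U V F (k + 1) Z) :
    Runs growStep s (2400 * (n * D.size)) (SearchInv D α U V F R k) := by
  have hn : 1 ≤ n := by have := U.2; omega
  have hnD : D.size ≤ n * D.size := Nat.le_mul_of_pos_left _ hn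
  refine (runs_bestLoop hL hD hC hU hV hZ.1 hVZ hVF hB).seq (T₂ := 250 * (n * D.size)) ?_
    (by omega)
  rintro s1 A1 ⟨C1, b1⟩
  have hL1 : Loaded D G h α s1 := hL.agree A1 rfl
  have eU : s1.nat vU 0 0 = U := by rw [A1.1 vU rfl, hU]
  have eV : s1.nat vV 0 0 = V := by rw [A1.1 vV rfl, hV]
  have ef : s1.nat vFound 0 0 = 0 := by rw [A1.1 vFound rfl, hf]
  have eg : s1.nat vGo 0 0 = 1 := by rw [A1.1 vGo rfl, hg]
  have eK : s1.nat aKey = s.nat aKey := A1.1 aKey rfl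
  have eP : s1.nat vProd 0 0 = ∏ i ∈ Z, D.dom i := by rw [A1.1 vProd rfl, hZ.2]
  have eB : s1.nat aBlocked = s.nat aBlocked := A1.1 aBlocked rfl
  refine Runs.ite (T := 200 * (n * D.size)) ?_ ?_ (by simp only [Test.cost, NExpr.cost]; omega)
  · intro ht
    have hb : s1.nat vBest 0 0 = n := by simpa [Test.Holds, NExpr.eval, hL1.n_eq] using ht
    have hnone : bestVar D U V F Z = none := by
      cases hb' : bestVar D U V F Z with
      | none => rfl
      | some c =>
        have := (b1.2 c hb').1
        have := c.2
        omega
    refine Runs.of_wp (by simp only [Program.maxCost, NExpr.cost]; omega) ?_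
    refine ⟨by simpa [Program.wp, Clean] using C1, Z, hVZ, ?_, .inr (.inl ?_)⟩
    · simpa [Coded, eK, eP] using hZ.1
    · simp [hR, growLoop, hnone, NExpr.eval, ef]
  · intro ht
    have hb : s1.nat vBest 0 0 ≠ n := by simpa [Test.Holds, NExpr.eval, hL1.n_eq] using ht
    obtain ⟨X, hX⟩ : ∃ X, bestVar D U V F Z = some X := by
      cases hb' : bestVar D U V F Z with
      | none => exact absurd (b1.1 hb') hb
      | some c => exact ⟨c, rfl⟩
    obtain ⟨hbX, hrX⟩ := b1.2 X hX
    have hXm := bestVar_not_mem hX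
    have hXZ : X ∉ Z := fun hx => hXm (Finset.mem_union_left _ hx)
    have hVX : V ∉ insert X Z := by
      intro hmem
      rcases Finset.mem_insert.1 hmem with rfl | hmem
      · exact hXm (Finset.mem_union_right _ hVF)
      · exact hVZ hmem
    have hset : Runs (assign vY (var vBest)) s1 6 (fun s' => s'.nat vY 0 0 = X) := by
      refine Runs.of_wp (by simp [Program.maxCost, NExpr.cost]) ?_
      simp [Program.wp, NExpr.eval, hbX]
    refine hset.seq (T₂ := 190 * (n * D.size)) ?_ (by omega)
    intro s2 A2 y2
    refine (runs_addKey (hL1.agree A2 rfl) y2).seq (T₂ := 100 * (n * D.size)) ?_ (by omega)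
    intro s3 A3 k3
    have hL3 : Loaded D G h α s3 := (hL1.agree A2 rfl).agree A3 rfl
    have e3 : ∀ a, a ≠ vY → a ≠ vRec → a ≠ aKey → s3.nat a = s1.nat a := by
      intro a h1 h2 h3
      rw [A3.1 a (by simp [forLoop_writesNat, Program.writesNat, h2, h3]),
        A2.1 a (by simp [Program.writesNat, h1])]
    have y3 : s3.nat vY 0 0 = X := by rw [A3.1 vY rfl, y2]
    have r3 : s3.real = s1.real := by
      funext a
      rw [A3.2 a rfl, A2.2 a rfl]
    have K3 : D.Codes (fun r => s3.nat aKey r 0) (insert X Z) := by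
      refine Dataset.Codes.insert hZ.1 X fun r hr => ?_
      rw [k3 r hr, A2.1 aKey rfl, eK]
    have hset2 : Runs (assign vProd (.mul (var vProd) (eDom vY)) ⨟
        .setNat aBlocked (var vY) (.const 0) (.const 1)) s3 20
        (fun s' => Clean s' ∧ Coded D (insert X Z) s' ∧ Blocked (insert X Z ∪ F) s') := by
      refine Runs.of_wp (by simp [Program.maxCost, NExpr.cost]) ?_
      simp only [Program.wp, NExpr.eval]
      refine ⟨by simpa [Clean, e3] using C1, ⟨?_, ?_⟩, ?_⟩
      · simpa using K3
      · simp [e3, eP, Finset.prod_insert hXZ, y3, hL3.dom_eq, mul_comm]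
      · intro i
        simp only [ne_eq, Nat.reduceEqDiff, not_false_eq_true,
          State.setNat_nat_of_ne, y3, State.setNat_nat_self, and_true, Fin.val_inj, e3, eB]
        by_cases hi : i = X
        · simp [hi]
        · simpa [hi] using hB i
    refine (hset2.seq (T₂ := 80 * (n * D.size)) ?_ (by omega)).assoc
    rintro s4 A4 ⟨C4, Z4, B4⟩
    have hL4 : Loaded D G h α s4 := hL3.agree A4 rfl
    have f4 : s4.nat vFound 0 0 = 0 := by rw [A4.1 vFound rfl, e3 vFound (by omega) (by omega)
      (by omega), ef]
    have g4 : s4.nat vGo 0 0 = 1 := by rw [A4.1 vGo rfl, e3 vGo (by omega) (by omega)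
      (by omega), eg]
    have U4 : s4.nat vU 0 0 = U := by rw [A4.1 vU rfl, e3 vU (by omega) (by omega)
      (by omega), eU]
    have V4 : s4.nat vV 0 0 = V := by rw [A4.1 vV rfl, e3 vV (by omega) (by omega)
      (by omega), eV]
    -- The scan for the best variable has left the statistic for the enlarged set in `rBest`, so it
    -- is not evaluated again.
    have hj := holds_judgeTest hL4 U4 V4 (Z := insert X Z) (a := rBest) (e := var vProd)
      (by rw [A4.2 rBest rfl, r3, hrX]) Z4.2
    refine Runs.of_wp
      (by simp only [Program.maxCost, judgeTest, Test.cost, RExpr.cost, NExpr.cost]; omega) ?_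
    simp only [wp_ite_iff, hj]
    refine ⟨fun hj' => ?_, fun hj' => ?_⟩
    · refine ⟨by simpa [Clean] using C4, insert X Z, hVX, ?_, .inl ⟨?_, ?_⟩⟩
      · simpa [Coded] using Z4
      · simp [NExpr.eval]
      · simp [hR, growLoop, hX, hj']
    · refine ⟨C4, insert X Z, hVX, Z4, .inr (.inr ⟨f4, g4, B4, ?_⟩)⟩
      simp [hR, growLoop, hX, hj']

theorem runs_initSearch {s : State} (hL : Loaded D G h α s) (hD : 1 ≤ D.size) (hC : Clean s)
    {U V X : Fin n} (hU : s.nat vU 0 0 = U) (hV : s.nat vV 0 0 = V) (hX : s.nat vX 0 0 = X)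
    {C F : Finset (Fin n)} (hM : (s.nat vMode 0 0 = 0 ∧ C = ∅ ∧ F = {X}) ∨
      (s.nat vMode 0 0 = 1 ∧ C = {X} ∧ F = ∅)) :
    Runs initSearch s (250 * (n * D.size)) (fun s' => Clean s' ∧ Coded D C s' ∧
      Blocked (C ∪ (F ∪ {U, V})) s' ∧ s'.nat vSlots 0 0 = h - C.card ∧ s'.nat vFound 0 0 = 0 ∧
      s'.nat vGo 0 0 = 1) := by
  have hn : 1 ≤ n := by have := U.2; omega
  have hnD : D.size ≤ n * D.size := Nat.le_mul_of_pos_left _ hn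
  have hnD' : n ≤ n * D.size := Nat.le_mul_of_pos_right _ hD
  have hblk : Runs (forLoop vFirst eN (.setNat aBlocked (var vFirst) (.const 0) (.const 0))) s
      (n * 30 + 12) (fun s' => ∀ i < n, s'.nat aBlocked i 0 = 0) := by
    refine (Runs.for_const (N := n) (T := 14) (fun i s' => ∀ j < i, s'.nat aBlocked j 0 = 0)
      rfl (by simp [NExpr.cost]) ?_ ?_ (by simp) ?_ le_rfl)
    · exact fun s' hA => (hL.agree hA rfl).n_eq
    · intro i s' x hI
      simpa using hI
    · intro i hi s' hA hv hI
      refine Runs.of_wp (by simp [Program.maxCost, NExpr.cost]) ?_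
      intro j hj
      simp only [NExpr.eval, State.setNat_nat_self, hv, and_true]
      by_cases hji : j = i
      · simp [hji]
      · rw [if_neg hji]
        exact hI j (by omega)
  refine hblk.seq (T₂ := 200 * (n * D.size)) ?_ (by omega)
  intro s1 A1 b1
  have hL1 : Loaded D G h α s1 := hL.agree A1 rfl
  have hkey : Runs (forLoop vRec eSize (.setNat aKey (var vRec) (.const 0)
      (.mul (var vMode) (eEntry vX)))) s1 (D.size * 50 + 12)
      (fun s' => ∀ r < D.size, s'.nat aKey r 0 = s.nat vMode 0 0 * D.entry r X) := by
    refine (Runs.for_const (N := D.size) (T := 30)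
      (fun i s' => ∀ r < i, s'.nat aKey r 0 = s.nat vMode 0 0 * D.entry r X)
      rfl (by simp [NExpr.cost]) ?_ ?_ (by simp) ?_ le_rfl).mono (by omega) fun _ _ hI => hI
    · exact fun s' hA => (hL1.agree hA rfl).size_eq
    · intro i s' x hI
      simpa using hI
    · intro i hi s' hA hv hI
      have hLs : Loaded D G h α s' := hL1.agree hA rfl
      have eM : s'.nat vMode = s.nat vMode := by rw [hA.1 vMode rfl, A1.1 vMode rfl]
      have eX : s'.nat vX 0 0 = X := by rw [hA.1 vX rfl, A1.1 vX rfl, hX]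
      refine Runs.of_wp (by simp [Program.maxCost, NExpr.cost]) ?_
      intro r hr
      simp only [NExpr.eval, State.setNat_nat_self, hv, eX, hLs.entry_eq, and_true, eM]
      by_cases hri : r = i
      · simp [hri]
      · rw [if_neg hri]
        exact hI r (by omega)
  refine hkey.seq (T₂ := 120 * (n * D.size)) ?_ (by omega)
  intro s2 A2 k2
  have hL2 : Loaded D G h α s2 := hL1.agree A2 rfl
  have e2 : ∀ a, a ≠ vFirst → a ≠ aBlocked → a ≠ vRec → a ≠ aKey → s2.nat a = s.nat a := by
    intro a h1 h2 h3 h4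
    rw [A2.1 a (by simp [forLoop_writesNat, Program.writesNat, h3, h4]),
      A1.1 a (by simp [forLoop_writesNat, Program.writesNat, h1, h2])]
  have b2 : ∀ i < n, s2.nat aBlocked i 0 = 0 := by
    rw [A2.1 aBlocked rfl]; exact b1
  refine Runs.of_wp (by simp only [Program.maxCost, NExpr.cost]; omega) ?_
  simp only [Program.wp, NExpr.eval]
  refine ⟨by simpa [Clean, e2] using hC, ⟨?_, ?_⟩, ?_, ?_, ?_, ?_⟩
  · simp only [ne_eq, Nat.reduceEqDiff, not_false_eq_true,
      State.setNat_nat_of_ne]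
    -- The initial key is the mode times the value of `X`: the constant 0 encodes the empty set, and
    -- the value itself encodes `{X}`.
    rcases hM with ⟨hm, rfl, -⟩ | ⟨hm, rfl, -⟩
    · exact Dataset.Codes.empty (c := 0) fun r hr => by rw [k2 r hr, hm, zero_mul]
    · rw [← insert_empty_eq]
      refine Dataset.Codes.insert (κ := fun _ => 0) (Dataset.Codes.empty fun _ _ => rfl) X
        fun r hr => ?_
      rw [k2 r hr, hm]
      simp
  · rcases hM with ⟨hm, rfl, -⟩ | ⟨hm, rfl, -⟩ <;> simp [e2, hm, hX, hL2.dom_eq]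
  · intro i
    have hi := b2 i i.2
    -- In both modes `X` is blocked, either as forbidden or as already chosen.
    have hmem : i ∈ C ∪ (F ∪ {U, V}) ↔ i = X ∨ i = U ∨ i = V := by
      rcases hM with ⟨-, rfl, rfl⟩ | ⟨-, rfl, rfl⟩ <;> simp [or_left_comm]
    rw [hmem]
    simp only [ne_eq, Nat.reduceEqDiff, not_false_eq_true,
      State.setNat_nat_of_ne, State.setNat_nat_self, and_true, e2, hU, hV, hX, Fin.val_inj, hi]
    by_cases h1 : i = X <;> by_cases h2 : i = U <;> by_cases h3 : i = V <;> simp [h1, h2, h3]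
  · have hcard : C.card = s.nat vMode 0 0 := by
      rcases hM with ⟨hm, rfl, -⟩ | ⟨hm, rfl, -⟩ <;> simp [hm]
    simp [e2, hcard, hL2.h_eq]
  · simp
  · simp

theorem runs_search {s : State} (hL : Loaded D G h α s) (hD : 1 ≤ D.size) (hh : 1 ≤ h)
    (hC : Clean s) {U V X : Fin n} (hU : s.nat vU 0 0 = U) (hV : s.nat vV 0 0 = V)
    (hX : s.nat vX 0 0 = X) (hVX : V ≠ X) {C F : Finset (Fin n)}
    (hM : (s.nat vMode 0 0 = 0 ∧ C = ∅ ∧ F = {X}) ∨ (s.nat vMode 0 0 = 1 ∧ C = {X} ∧ F = ∅)) :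
    Runs search s (6000 * (n * h * D.size)) (fun s' => Clean s' ∧
      ((s'.nat vFound 0 0 = 1 ∧ ∃ Z, findSet D h α U V C F = some Z ∧ V ∉ Z ∧ Coded D Z s') ∨
        (s'.nat vFound 0 0 = 0 ∧ findSet D h α U V C F = none))) := by
  have hn : 1 ≤ n := by have := U.2; omega
  have hnD : D.size ≤ n * D.size := Nat.le_mul_of_pos_left _ hn
  have hnh : n * D.size ≤ n * h * D.size := by nlinarith [Nat.mul_le_mul_left (n * D.size) hh]
  have hh' : h ≤ n * h * D.size := by nlinarith [Nat.mul_le_mul_right h (Nat.mul_le_mul hn hD)]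
  have hcard : C.card ≤ 1 := by
    rcases hM with ⟨-, rfl, -⟩ | ⟨-, rfl, -⟩ <;> simp
  have hVC : V ∉ C := by
    rcases hM with ⟨-, rfl, -⟩ | ⟨-, rfl, -⟩ <;> simp [hVX]
  refine (runs_initSearch hL hD hC hU hV hX hM).seq (T₂ := 5700 * (n * h * D.size)) ?_ (by omega)
  rintro s1 A1 ⟨C1, Z1, B1, sl1, f1, g1⟩
  have hL1 : Loaded D G h α s1 := hL.agree A1 rfl
  have U1 : s1.nat vU 0 0 = U := by rw [A1.1 vU rfl, hU]
  have V1 : s1.nat vV 0 0 = V := by rw [A1.1 vV rfl, hV]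
  refine (runs_evalStat hL1 hD C1 (by simp [NExpr.cost]) (KeyExpr.eKey _ _) U1 V1 Z1.1 hVC).seq
    (T₂ := 3700 * (n * h * D.size)) ?_ (by omega)
  rintro s2 A2 ⟨z2, C2⟩
  have hL2 : Loaded D G h α s2 := hL1.agree A2 rfl
  have U2 : s2.nat vU 0 0 = U := by rw [A2.1 vU rfl, U1]
  have V2 : s2.nat vV 0 0 = V := by rw [A2.1 vV rfl, V1]
  have Z2 : Coded D C s2 := by simpa [Coded, A2.1 aKey rfl, A2.1 vProd rfl] using Z1
  have hj := holds_judgeTest hL2 U2 V2 (Z := C) (a := rStat) (e := var vProd) z2 Z2.2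
  have hjudge : Runs (.ite (judgeTest rStat (var vProd)) (assign vFound (.const 1)) .skip) s2 50
      (SearchInv D α U V (F ∪ {U, V}) (findSet D h α U V C F) (h - C.card)) := by
    refine Runs.of_wp
      (by simp [Program.maxCost, judgeTest, Test.cost, RExpr.cost, NExpr.cost]) ?_
    simp only [wp_ite_iff, hj]
    -- As `C.card ≤ 1 ≤ h`, the initial test on the size of the compulsory set never fires, and the
    -- program omits it.
    have hnlt : ¬ h < C.card := by omega
    refine ⟨fun hj' => ?_, fun hj' => ?_⟩
    · refine ⟨by simpa [Clean] using C2, C, hVC, ?_, .inl ⟨?_, ?_⟩⟩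
      · simpa [Coded] using Z2
      · simp [NExpr.eval]
      · simp [findSet, hnlt, hj']
    · refine ⟨C2, C, hVC, Z2, .inr (.inr ⟨?_, ?_, ?_, ?_⟩)⟩
      · rw [A2.1 vFound rfl, f1]
      · rw [A2.1 vGo rfl, g1]
      · simpa [Blocked, A2.1 aBlocked rfl] using B1
      · simp [findSet, hnlt, hj']
  refine hjudge.seq (T₂ := 3600 * (n * h * D.size)) ?_ (by omega)
  intro s3 A3 I3
  have hL3 : Loaded D G h α s3 := hL2.agree A3 rfl
  have U3 : s3.nat vU 0 0 = U := by rw [A3.1 vU rfl, U2]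
  have V3 : s3.nat vV 0 0 = V := by rw [A3.1 vV rfl, V2]
  have sl3 : s3.nat vSlots 0 0 = h - C.card := by
    rw [A3.1 vSlots rfl, A2.1 vSlots rfl, sl1]
  -- The loop always makes `h - C.card` rounds; after a success or a failure the remaining ones are
  -- idle. Position `i` corresponds to `growLoop` with `h - C.card - i` slots.
  refine (Runs.for_const (N := h - C.card) (T := 2400 * (n * D.size) + 20)
    (fun i s' => SearchInv D α U V (F ∪ {U, V}) (findSet D h α U V C F) (h - C.card - i) s')
    rfl (by simp [NExpr.cost]) ?_ ?_ I3 ?_ le_rfl).mono ?_ ?_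
  · intro s' hA
    simp [NExpr.eval, hA.1 vSlots rfl, sl3]
  · intro i s' x hI
    simpa [SearchInv, Clean, Coded, Blocked] using hI
  · rintro i hi s' hA hv ⟨Ci, Z, hVZ, hZ, hI⟩
    have hLs : Loaded D G h α s' := hL3.agree hA rfl
    refine Runs.ite (T := 2400 * (n * D.size) + 1) ?_ ?_
      (by simp only [Test.cost, NExpr.cost]; omega)
    · intro ht
      obtain ⟨hf, hg⟩ : s'.nat vFound 0 0 = 0 ∧ s'.nat vGo 0 0 = 1 := ht
      rcases hI with ⟨hf', -⟩ | ⟨-, hg', -⟩ | ⟨-, -, hB, hR⟩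
      · omega
      · omega
      · refine (runs_growStep hLs hD (U := U) (V := V) (F := F ∪ {U, V})
          (R := findSet D h α U V C F) (k := h - C.card - (i + 1))
          (by rw [hA.1 vU rfl, U3]) (by rw [hA.1 vV rfl, V3])
          (by simp) Ci hVZ hZ hf hg hB ?_).mono (by omega) fun _ _ h => h
        rw [hR]
        congr 1
        omega
    · intro ht
      refine Runs.of_wp (by simp only [Program.maxCost]; omega) ⟨Ci, Z, hVZ, hZ, ?_⟩
      rcases hI with hI | hI | ⟨hf', hg', -⟩
      · exact .inl hI
      · exact .inr (.inl hI)
      · exact absurd ⟨hf', hg'⟩ ht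
  · have h1 : (h - C.card) * (2400 * (n * D.size) + 20 + 16)
        ≤ h * (2400 * (n * D.size) + 20 + 16) := Nat.mul_le_mul_right _ (Nat.sub_le _ _)
    have h2 : h * (2400 * (n * D.size) + 20 + 16) = 2400 * (n * h * D.size) + 36 * h := by ring
    omega
  · rintro s' - ⟨Ci, Z, hVZ, hZ, hI⟩
    refine ⟨Ci, ?_⟩
    rcases hI with ⟨hf, hR⟩ | ⟨hf, -, hR⟩ | ⟨hf, -, -, hR⟩
    · exact .inl ⟨hf, Z, hR, hVZ, hZ⟩
    · exact .inr ⟨hf, hR⟩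
    · refine .inr ⟨hf, ?_⟩
      rw [hR, Nat.sub_self, growLoop]

end Search

/-! ### Collecting the latent triangles -/

section Collection

notation "vA" => 30
notation "vB" => 31
notation "vC" => 32
notation "vCand" => 33
notation "vE" => 34
notation "vOk" => 35
notation "aNumPar" => 36
notation "aGraph" => 37
notation "aConf" => 38

/-- The search with the parameters `U = u`, `V = v`, `X = x`. -/
def call (u v x m : ℕ) : Program :=
  assign vU (var u) ⨟ assign vV (var v) ⨟ assign vX (var x) ⨟ assign vMode (.const m) ⨟ search

/-- Decides whether the triangle looks latent. -/
def candidateTest : Program :=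
  assign vCand (.const 0) ⨟
  call vB vC vA 0 ⨟
  .ite (.natEq (var vFound) (.const 1))
    (assign vY (var vA) ⨟ evalStat eKeyY ⨟
      .ite (judgeTest rStat (.mul (var vProd) (eDom vY))) .skip
        (call vA vB vC 0 ⨟
          .ite (.natEq (var vFound) (.const 0))
            (call vA vC vB 0 ⨟
              .ite (.natEq (var vFound) (.const 0)) (assign vCand (.const 1)) .skip)
            .skip))
    .skip

/-- The test for an arc. -/
def arcTest (u v : ℕ) : Test := .natEq (.get 1 (var u) (var v)) (.const 1)

/-- `vE` is a parent of `vB` other than `vA` or a child of `vB` other than `vC`. -/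
def neighbourTest : Test :=
  .not (.and (.not (.and (arcTest vE vB) (.not (.natEq (var vE) (var vA)))))
    (.not (.and (arcTest vB vE) (.not (.natEq (var vE) (var vC))))))

/-- The additional test for triangles of type 3. -/
def witnessTest : Program :=
  assign vOk (.const 0) ⨟
  forLoop vE eN
    (.ite neighbourTest
      (call vE vC vA 1 ⨟ .ite (.natEq (var vFound) (.const 1)) (assign vOk (.const 1)) .skip)
      .skip)

variable {n : ℕ} {D : Dataset n} {G : Digraph (Fin n)} {h : ℕ} {α : ℝ}

/-- All the added variables come from `bestVar`, which stays outside `F`. This gives `A ∉ Z` in the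
latency test, so that the number of joint values of `Z ∪ {A}` is that of `Z` times `dom A`. -/
theorem growLoop_avoid {U V x : Fin n} {F : Finset (Fin n)} (hx : x ∈ F) {k : ℕ} :
    ∀ {Z Z' : Finset (Fin n)}, x ∉ Z → growLoop D α U V F k Z = some Z' → x ∉ Z' := by
  induction k with
  | zero => intro Z Z' _ h; simp [growLoop] at h
  | succ k ih =>
    intro Z Z' hZ h
    rw [growLoop] at h
    cases hb : bestVar D U V F Z with
    | none => simp [hb] at h
    | some X =>
      have hX : x ∉ insert X Z := by
        intro hm
        rcases Finset.mem_insert.1 hm with rfl | hm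
        · exact bestVar_not_mem hb (Finset.mem_union_right _ hx)
        · exact hZ hm
      simp only [hb] at h
      split_ifs at h
      · cases h; exact hX
      · exact ih hX h

theorem findSet_avoid {U V x : Fin n} {C F Z : Finset (Fin n)} (hx : x ∈ F) (hC : x ∉ C)
    (h : findSet D h α U V C F = some Z) : x ∉ Z := by
  unfold findSet at h
  split_ifs at h
  · cases h; exact hC
  · exact growLoop_avoid (Finset.mem_union_left _ hx) hC h

theorem Clean.agree {p : Program} {s s' : State} (hC : Clean s) (hA : Agree p s s')
    (hp : (p.writesNat tZ || p.writesNat tVZ || p.writesNat tUZ || p.writesNat tUVZ) = false) :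
    Clean s' := by
  simp only [Bool.or_eq_false_iff] at hp
  obtain ⟨⟨⟨h1, h2⟩, h3⟩, h4⟩ := hp
  simpa only [Clean, hA.1 _ h1, hA.1 _ h2, hA.1 _ h3, hA.1 _ h4] using hC

/-- The parameters are copied one after the other into the cells 11 to 14. The bounds on `v` and `x`
ensure that these are not overwritten before they are read; `u` is read before anything is written.
-/
theorem runs_call {s : State} (hL : Loaded D G h α s) (hD : 1 ≤ D.size) (hh : 1 ≤ h)
    (hC : Clean s) {u v x m : ℕ} (hv : 15 ≤ v) (hx : 15 ≤ x) {U V X : Fin n}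
    (hU : s.nat u 0 0 = U) (hV : s.nat v 0 0 = V) (hX : s.nat x 0 0 = X) (hVX : V ≠ X)
    {C F : Finset (Fin n)} (hM : (m = 0 ∧ C = ∅ ∧ F = {X}) ∨ (m = 1 ∧ C = {X} ∧ F = ∅)) :
    Runs (call u v x m) s (6030 * (n * h * D.size)) (fun s' => Clean s' ∧
      (s'.nat vU 0 0 = U ∧ s'.nat vV 0 0 = V) ∧
      ((s'.nat vFound 0 0 = 1 ∧ ∃ Z, findSet D h α U V C F = some Z ∧ V ∉ Z ∧ Coded D Z s') ∨
        (s'.nat vFound 0 0 = 0 ∧ findSet D h α U V C F = none))) := by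
  have hn : 1 ≤ n := by have := U.2; omega
  have hW : 1 ≤ n * h * D.size := Nat.mul_pos (Nat.mul_pos hn hh) hD
  have hset : Runs (((assign vU (var u) ⨟ assign vV (var v)) ⨟ assign vX (var x)) ⨟
      assign vMode (.const m)) s 30 (fun s' => s'.nat vU 0 0 = U ∧ s'.nat vV 0 0 = V ∧
        s'.nat vX 0 0 = X ∧ s'.nat vMode 0 0 = m) := by
    refine Runs.of_wp (by simp [Program.maxCost, NExpr.cost]) ?_
    have h2 : v ≠ vU := by omega
    have h4 : x ≠ vU := by omega
    have h5 : x ≠ vV := by omega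
    simp [Program.wp, NExpr.eval, hU, hV, hX, h2, h4, h5]
  refine (hset.seq (T₂ := 6000 * (n * h * D.size)) ?_ (by omega)).assoc.assoc.assoc
  rintro s1 A1 ⟨U1, V1, X1, M1⟩
  refine (runs_search (hL.agree A1 rfl) hD hh (hC.agree A1 rfl) U1 V1 X1 hVX
    (by rwa [M1])).mono le_rfl fun s2 A2 h2 => ⟨h2.1, ⟨?_, ?_⟩, h2.2⟩
  · rw [A2.1 vU rfl, U1]
  · rw [A2.1 vV rfl, V1]

/-- The triangle passes the tests of independence. -/
def LooksLatent (D : Dataset n) (h : ℕ) (α : ℝ) (A B C : Fin n) : Prop :=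
  (∃ Z, findSet D h α B C ∅ {A} = some Z ∧ ¬ JudgedIndep D α B C (insert A Z)) ∧
  findSet D h α A B ∅ {C} = none ∧ findSet D h α A C ∅ {B} = none

theorem runs_candidateTest {s : State} (hL : Loaded D G h α s) (hD : 1 ≤ D.size) (hh : 1 ≤ h)
    (hC : Clean s) {A B C : Fin n} (hA : s.nat vA 0 0 = A) (hB : s.nat vB 0 0 = B)
    (hC' : s.nat vC 0 0 = C) (hAC : A ≠ C) (hBC : B ≠ C) :
    Runs candidateTest s (21000 * (n * h * D.size)) (fun s' => Clean s' ∧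
      (s'.nat vCand 0 0 = 1 ↔ LooksLatent D h α A B C)) := by
  have hn : 1 ≤ n := by have := A.2; omega
  have hW : D.size ≤ n * h * D.size := Nat.le_mul_of_pos_left _ (Nat.mul_pos hn hh)
  have hset : Runs (assign vCand (.const 0)) s 4 (fun s' => s'.nat vCand 0 0 = 0) := by
    refine Runs.of_wp (by simp [Program.maxCost, NExpr.cost]) ?_
    simp [Program.wp, NExpr.eval]
  refine hset.seq (T₂ := 20900 * (n * h * D.size)) ?_ (by omega)
  intro s1 A1 c1
  have hL1 : Loaded D G h α s1 := hL.agree A1 rfl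
  have a1 : s1.nat vA 0 0 = A := by rw [A1.1 vA rfl, hA]
  have b1 : s1.nat vB 0 0 = B := by rw [A1.1 vB rfl, hB]
  have d1 : s1.nat vC 0 0 = C := by rw [A1.1 vC rfl, hC']
  refine (runs_call hL1 hD hh (hC.agree A1 rfl) (by omega) (by omega) b1 d1 a1
    hAC.symm (.inl ⟨rfl, rfl, rfl⟩)).seq (T₂ := 14500 * (n * h * D.size)) ?_ (by omega)
  rintro s2 A2 ⟨C2, ⟨u2, v2⟩, R2⟩
  have hL2 : Loaded D G h α s2 := hL1.agree A2 rfl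
  have a2 : s2.nat vA 0 0 = A := by rw [A2.1 vA rfl, a1]
  have b2 : s2.nat vB 0 0 = B := by rw [A2.1 vB rfl, b1]
  have d2 : s2.nat vC 0 0 = C := by rw [A2.1 vC rfl, d1]
  have c2 : s2.nat vCand 0 0 = 0 := by rw [A2.1 vCand rfl, c1]
  refine Runs.ite (T := 14400 * (n * h * D.size)) ?_ ?_
    (by simp only [Test.cost, NExpr.cost]; omega)
  swap
  · intro ht
    have hf : ¬ s2.nat vFound 0 0 = 1 := ht
    refine Runs.of_wp (by simp only [Program.maxCost]; omega) ⟨C2, ?_⟩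
    obtain ⟨-, R2⟩ := R2.resolve_left fun h => hf h.1
    simp [c2, LooksLatent, R2]
  intro ht
  have hf : s2.nat vFound 0 0 = 1 := ht
  obtain ⟨-, Z, hZ, hCZ, cod2⟩ := R2.resolve_right fun h => by omega
  have hAZ : A ∉ Z := findSet_avoid (by simp) (by simp) hZ
  have hset : Runs (assign vY (var vA)) s2 6 (fun s' => s'.nat vY 0 0 = A) := by
    refine Runs.of_wp (by simp [Program.maxCost, NExpr.cost]) ?_
    simp [Program.wp, NExpr.eval, a2]
  refine hset.seq (T₂ := 14300 * (n * h * D.size)) ?_ (by omega)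
  intro s3 A3 y3
  have hL3 : Loaded D G h α s3 := hL2.agree A3 rfl
  have e3 : ∀ a, a ≠ vY → s3.nat a = s2.nat a := fun a ha =>
    A3.1 a (by simp [Program.writesNat, ha])
  -- The search has left the codes of `Z` in memory, so the dependence given `Z ∪ {A}` costs one
  -- evaluation with the extended key.
  refine (runs_evalStat hL3 hD (C2.agree A3 rfl) (by simp [NExpr.cost])
    (KeyExpr.eKeyY hL3 y3 D.size) (U := B) (V := C) (by simp [e3, u2]) (by simp [e3, v2])
    (Z := insert A Z) (Dataset.Codes.insert (by simpa [e3] using cod2.1) A fun _ _ => rfl)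
    (by simp [hAC.symm, hCZ])).seq (T₂ := 12250 * (n * h * D.size)) ?_ (by omega)
  rintro s4 A4 ⟨z4, C4⟩
  have hL4 : Loaded D G h α s4 := hL3.agree A4 rfl
  have e4 : ∀ a, a < 25 → a ≠ vY → a ≠ vRec → s4.nat a = s2.nat a := by
    intro a h1 h2 h3
    rw [A4.1 a ?_, e3 a h2]
    simp [evalStat, histogram, clear, forLoop_writesNat, Program.writesNat, h3]
    omega
  have hj := holds_judgeTest hL4 (U := B) (V := C) (Z := insert A Z) (a := rStat)
    (e := .mul (var vProd) (eDom vY)) (by rw [e4 vU (by omega) (by omega) (by omega), u2])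
    (by rw [e4 vV (by omega) (by omega) (by omega), v2]) z4 (by
      simp [NExpr.eval, e4, cod2.2, A4.1 vY rfl, y3, hL4.dom_eq, Finset.prod_insert hAZ, mul_comm])
  refine Runs.ite (T := 12200 * (n * h * D.size)) ?_ ?_
    (by simp only [judgeTest, Test.cost, NExpr.cost, RExpr.cost]; omega)
  · intro ht
    have hj' := hj.1 ht
    refine Runs.of_wp (by simp only [Program.maxCost]; omega) ⟨C4, ?_⟩
    rw [A4.1 vCand rfl, e3 vCand (by omega), c2]
    simp [LooksLatent, hZ, hj']
  intro ht
  have hj' : ¬ JudgedIndep D α B C (insert A Z) := fun h => ht (hj.2 h)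
  have a4 : s4.nat vA 0 0 = A := by rw [A4.1 vA rfl, e3 vA (by omega), a2]
  have b4 : s4.nat vB 0 0 = B := by rw [A4.1 vB rfl, e3 vB (by omega), b2]
  have d4 : s4.nat vC 0 0 = C := by rw [A4.1 vC rfl, e3 vC (by omega), d2]
  have c4 : s4.nat vCand 0 0 = 0 := by rw [A4.1 vCand rfl, e3 vCand (by omega), c2]
  refine (runs_call hL4 hD hh C4 (by omega) (by omega) a4 b4 d4
    hBC (.inl ⟨rfl, rfl, rfl⟩)).seq (T₂ := 6100 * (n * h * D.size)) ?_ (by omega)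
  rintro s5 A5 ⟨C5, -, R5⟩
  have hL5 : Loaded D G h α s5 := hL4.agree A5 rfl
  have a5 : s5.nat vA 0 0 = A := by rw [A5.1 vA rfl, a4]
  have b5 : s5.nat vB 0 0 = B := by rw [A5.1 vB rfl, b4]
  have d5 : s5.nat vC 0 0 = C := by rw [A5.1 vC rfl, d4]
  have c5 : s5.nat vCand 0 0 = 0 := by rw [A5.1 vCand rfl, c4]
  refine Runs.ite (T := 6080 * (n * h * D.size)) ?_ ?_
    (by simp only [Test.cost, NExpr.cost]; omega)
  swap
  · intro ht
    have hf : ¬ s5.nat vFound 0 0 = 0 := ht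
    refine Runs.of_wp (by simp only [Program.maxCost]; omega) ⟨C5, ?_⟩
    obtain ⟨-, Z', R5, -⟩ := R5.resolve_right fun h => hf h.1
    simp [c5, LooksLatent, R5]
  intro ht
  have hf5 : s5.nat vFound 0 0 = 0 := ht
  obtain ⟨-, R5⟩ := R5.resolve_left fun h => by omega
  refine (runs_call hL5 hD hh C5 (by omega) (by omega) a5 d5 b5
    hBC.symm (.inl ⟨rfl, rfl, rfl⟩)).seq (T₂ := 20 * (n * h * D.size)) ?_ (by omega)
  rintro s6 A6 ⟨C6, -, R6⟩
  have c6 : s6.nat vCand 0 0 = 0 := by rw [A6.1 vCand rfl, c5]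
  refine Runs.of_wp (by simp only [Program.maxCost, Test.cost, NExpr.cost]; omega) ?_
  simp only [wp_ite_iff, Test.Holds, NExpr.eval]
  refine ⟨fun hf => ?_, fun hf => ?_⟩
  · obtain ⟨-, R6⟩ := R6.resolve_left fun h => by omega
    refine ⟨by simpa [Clean] using C6, ?_⟩
    simp [LooksLatent, hZ, hj', R5, R6, NExpr.eval]
  · obtain ⟨-, Z', R6, -⟩ := R6.resolve_right fun h => hf h.1
    refine ⟨C6, ?_⟩
    simp [c6, LooksLatent, R6]

theorem runs_witnessTest_body {s : State} (hL : Loaded D G h α s) (hD : 1 ≤ D.size) (hh : 1 ≤ h)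
    (hC : Clean s) {A C E : Fin n} (hA : s.nat vA 0 0 = A)
    (hC' : s.nat vC 0 0 = C) (hE : s.nat vE 0 0 = E) (hAC : A ≠ C) :
    Runs (call vE vC vA 1 ⨟ .ite (.natEq (var vFound) (.const 1)) (assign vOk (.const 1)) .skip) s
      (6050 * (n * h * D.size)) (fun s' => Clean s' ∧
        (s'.nat vOk 0 0 = 1 ↔ s.nat vOk 0 0 = 1 ∨ ∃ Z, findSet D h α E C {A} ∅ = some Z)) := by
  have hn : 1 ≤ n := by have := A.2; omega
  have hW : D.size ≤ n * h * D.size := Nat.le_mul_of_pos_left _ (Nat.mul_pos hn hh)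
  refine (runs_call hL hD hh hC (by omega) (by omega) hE hC' hA
    hAC.symm (.inr ⟨rfl, rfl, rfl⟩)).seq (T₂ := 20 * (n * h * D.size)) ?_ (by omega)
  rintro s1 A1 ⟨C1, -, R1⟩
  refine Runs.of_wp (by simp only [Program.maxCost, Test.cost, NExpr.cost]; omega) ?_
  simp only [wp_ite_iff, Test.Holds, NExpr.eval]
  refine ⟨fun hf => ?_, fun hf => ?_⟩
  · obtain ⟨-, Z, R1, -⟩ := R1.resolve_right fun h => by omega
    refine ⟨by simpa [Clean] using C1, ?_⟩
    simp [R1, NExpr.eval]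
  · obtain ⟨-, R1⟩ := R1.resolve_left fun h => by omega
    refine ⟨C1, ?_⟩
    simp [R1, A1.1 vOk rfl]

/-- The source of the factors `k`: a loop over all `n` nodes pays the price `X` only for the at most
`k` nodes that satisfy `P`. -/
theorem sum_ite_le {P : Fin n → Prop} [∀ i : ℕ, Decidable (∃ hi : i < n, P ⟨i, hi⟩)] {k : ℕ}
    (hP : {x | P x}.ncard ≤ k) (c X : ℕ) :
    ∑ i ∈ Finset.range n, (c + if ∃ hi : i < n, P ⟨i, hi⟩ then X else 0) ≤ n * c + k * X := by
  rw [Finset.sum_add_distrib, Finset.sum_const, Finset.card_range, smul_eq_mul,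
    ← Fin.sum_univ_eq_sum_range (fun i => if ∃ hi : i < n, P ⟨i, hi⟩ then X else 0) n,
    ← Finset.sum_filter, Finset.sum_const, smul_eq_mul]
  refine Nat.add_le_add_left (Nat.mul_le_mul_right _ ?_) _
  rw [← Set.ncard_coe_finset]
  simpa using hP

theorem ncard_parents_le (G : Digraph (Fin n)) (v : Fin n) : (parents G v).ncard ≤ maxDegree G :=
  (le_max_left _ _).trans (Finset.le_sup (f := fun v => max (parents G v).ncard (children G v).ncard)
    (Finset.mem_univ v))

theorem ncard_children_le (G : Digraph (Fin n)) (v : Fin n) :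
    (children G v).ncard ≤ maxDegree G :=
  (le_max_right _ _).trans
    (Finset.le_sup (f := fun v => max (parents G v).ncard (children G v).ncard)
      (Finset.mem_univ v))

theorem holds_arcTest {s : State} (hL : Loaded D G h α s) {u v : ℕ} {x y : Fin n}
    (hu : s.nat u 0 0 = x) (hv : s.nat v 0 0 = y) : (arcTest u v).Holds s ↔ G.Adj x y := by
  simp [arcTest, Test.Holds, NExpr.eval, hu, hv, hL.adj_iff]

theorem holds_neighbourTest {s : State} (hL : Loaded D G h α s) {A B C E : Fin n}
    (hA : s.nat vA 0 0 = A) (hB : s.nat vB 0 0 = B) (hC : s.nat vC 0 0 = C)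
    (hE : s.nat vE 0 0 = E) :
    neighbourTest.Holds s ↔ E ∈ (parents G B \ {A}) ∪ (children G B \ {C}) := by
  simp only [neighbourTest, Test.Holds, holds_arcTest hL hE hB, holds_arcTest hL hB hE, NExpr.eval,
    hA, hC, hE, Fin.val_inj, parents, children, Set.mem_union, Set.mem_sdiff, Set.mem_ofPred_eq,
    Set.mem_singleton_iff]
  tauto

open Classical in
theorem runs_witnessTest {s : State} (hL : Loaded D G h α s) (hD : 1 ≤ D.size) (hh : 1 ≤ h)
    (hC : Clean s) {A B C : Fin n} (hA : s.nat vA 0 0 = A) (hB : s.nat vB 0 0 = B)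
    (hC' : s.nat vC 0 0 = C) (hAC : A ≠ C) (hk : 1 ≤ maxDegree G) :
    Runs witnessTest s (12300 * (maxDegree G * (n * h * D.size))) (fun s' => Clean s' ∧
      (s'.nat vOk 0 0 = 1 ↔ ∃ E ∈ (parents G B \ {A}) ∪ (children G B \ {C}),
        ∃ Z, findSet D h α E C {A} ∅ = some Z)) := by
  have hn : 1 ≤ n := by have := A.2; omega
  have hW : n ≤ n * h * D.size := by
    rw [mul_assoc]
    exact Nat.le_mul_of_pos_right _ (Nat.mul_pos hh hD)
  have hkW : n * h * D.size ≤ maxDegree G * (n * h * D.size) := Nat.le_mul_of_pos_left _ hk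
  have hset : Runs (assign vOk (.const 0)) s 4 (fun s' => s'.nat vOk 0 0 = 0) := by
    refine Runs.of_wp (by simp [Program.maxCost, NExpr.cost]) ?_
    simp [Program.wp, NExpr.eval]
  refine hset.seq (T₂ := 12200 * (maxDegree G * (n * h * D.size))) ?_ (by omega)
  intro s1 A1 o1
  have hL1 : Loaded D G h α s1 := hL.agree A1 rfl
  refine (Runs.for (N := n) (T := fun i => 50 + if ∃ hi : i < n, (⟨i, hi⟩ : Fin n) ∈
      (parents G B \ {A}) ∪ (children G B \ {C}) then 6050 * (n * h * D.size) else 0)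
    (fun i s' => Clean s' ∧ (s'.nat vOk 0 0 = 1 ↔
      ∃ E ∈ (parents G B \ {A}) ∪ (children G B \ {C}), E.val < i ∧
        ∃ Z, findSet D h α E C {A} ∅ = some Z)) rfl (by simp [NExpr.cost])
    ?_ ?_ ⟨hC.agree A1 rfl, by simp [o1]⟩ ?_).mono ?_ ?_
  · exact fun s' hA => (hL1.agree hA rfl).n_eq
  · rintro i s' x ⟨h1, h2⟩
    exact ⟨by simpa [Clean] using h1, by simpa using h2⟩
  · rintro i hi s' hAs hv ⟨Ci, hI⟩
    have hLs : Loaded D G h α s' := hL1.agree hAs rfl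
    have as : s'.nat vA 0 0 = A := by rw [hAs.1 vA rfl, A1.1 vA rfl, hA]
    have bs : s'.nat vB 0 0 = B := by rw [hAs.1 vB rfl, A1.1 vB rfl, hB]
    have cs : s'.nat vC 0 0 = C := by rw [hAs.1 vC rfl, A1.1 vC rfl, hC']
    have ht := holds_neighbourTest hLs as bs cs (E := ⟨i, hi⟩) hv
    have hcost : neighbourTest.cost ≤ 48 := by decide
    have hstep : (∃ E ∈ (parents G B \ {A}) ∪ (children G B \ {C}), E.val < i + 1 ∧
        ∃ Z, findSet D h α E C {A} ∅ = some Z) ↔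
      (∃ E ∈ (parents G B \ {A}) ∪ (children G B \ {C}), E.val < i ∧
        ∃ Z, findSet D h α E C {A} ∅ = some Z) ∨
      ((⟨i, hi⟩ : Fin n) ∈ (parents G B \ {A}) ∪ (children G B \ {C}) ∧
        ∃ Z, findSet D h α ⟨i, hi⟩ C {A} ∅ = some Z) := by
      constructor
      · rintro ⟨E, hE, hlt, hZ⟩
        rcases Nat.lt_succ_iff_lt_or_eq.1 hlt with hlt | heq
        · exact .inl ⟨E, hE, hlt, hZ⟩
        · have : E = ⟨i, hi⟩ := Fin.ext heq
          subst this
          exact .inr ⟨hE, hZ⟩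
      · rintro (⟨E, hE, hlt, hZ⟩ | ⟨hE, hZ⟩)
        · exact ⟨E, hE, by omega, hZ⟩
        · exact ⟨_, hE, by simp, hZ⟩
    by_cases hnb : (⟨i, hi⟩ : Fin n) ∈ (parents G B \ {A}) ∪ (children G B \ {C})
    · rw [if_pos ⟨hi, hnb⟩]
      refine Runs.ite (T := 6050 * (n * h * D.size)) (fun _ => ?_)
        (fun h' => absurd (ht.2 hnb) h') (by omega)
      refine (runs_witnessTest_body hLs hD hh Ci as cs (E := ⟨i, hi⟩) hv hAC).mono le_rfl ?_
      rintro s2 - ⟨C2, R2⟩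
      refine ⟨C2, ?_⟩
      rw [R2, hI, hstep]
      simp only [hnb, true_and]
    · rw [if_neg (by rintro ⟨_, h'⟩; exact hnb h')]
      refine Runs.ite (T := 1) (fun h' => absurd (ht.1 h') hnb)
        (fun _ => Runs.of_wp le_rfl ⟨Ci, ?_⟩) (by omega)
      rw [hI, hstep]
      simp only [hnb, false_and, or_false]
  · have hcard : {E | E ∈ (parents G B \ {A}) ∪ (children G B \ {C})}.ncard ≤ 2 * maxDegree G := by
      refine (Set.ncard_union_le _ _).trans ?_
      have h1 := (Set.ncard_le_ncard (Set.sdiff_subset : parents G B \ {A} ⊆ _)).trans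
        (ncard_parents_le G B)
      have h2 := (Set.ncard_le_ncard (Set.sdiff_subset : children G B \ {C} ⊆ _)).trans
        (ncard_children_le G B)
      omega
    have := sum_ite_le hcard 66 (6050 * (n * h * D.size))
    simp only [add_right_comm _ _ 16] at this ⊢
    simp only [Nat.reduceAdd]
    have h3 : 2 * maxDegree G * (6050 * (n * h * D.size))
      = 12100 * (maxDegree G * (n * h * D.size)) := by ring
    omega
  · rintro s' - ⟨C', hI⟩
    refine ⟨C', hI.trans ?_⟩
    simp

end Collection

/-! ### Deciding whether one triangle is latent, and recording it -/

section Triangles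

/-- Appends the triangle to the list, removes its arcs from the graph, and counts the confounder
for both its children. -/
def append : Program :=
  .setNat 5 (var 4) (.const 0) (var vA) ⨟
  .setNat 5 (var 4) (.const 1) (var vB) ⨟
  .setNat 5 (var 4) (.const 2) (var vC) ⨟
  assign 4 (.add (var 4) (.const 1)) ⨟
  .setNat aGraph (var vA) (var vB) (.const 0) ⨟
  .setNat aGraph (var vB) (var vC) (.const 0) ⨟
  .setNat aGraph (var vC) (var vB) (.const 0) ⨟
  .setNat aConf (var vA) (.const 0) (.add (.get aConf (var vA) (.const 0)) (.const 1)) ⨟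
  .setNat aConf (var vB) (.const 0) (.add (.get aConf (var vB) (.const 0)) (.const 1))

/-- Treats the triangle `vA`, `vB`, `vC`, where `vA` is a parent of `vB`. -/
def checkTriangle : Program :=
  .ite (.and (arcTest vC vA) (arcTest vC vB))
    (candidateTest ⨟
      .ite (.and (.natEq (var vCand) (.const 1))
          (.natLt (.const 2) (.get aNumPar (var vB) (.const 0)))) append .skip)
    (.ite (.and (arcTest vB vC) (arcTest vA vC))
      (candidateTest ⨟
        .ite (.natEq (var vCand) (.const 1))
          (witnessTest ⨟ .ite (.natEq (var vOk) (.const 1)) append .skip)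
          .skip)
      .skip)

/-- Collects all the latent triangles. -/
def collect : Program :=
  forLoop vB eN (forLoop vA eN (.ite (arcTest vA vB) (forLoop vC eN checkTriangle) .skip))

/-- Copies the graph and counts the parents. -/
def copyGraph : Program :=
  forLoop vB eN (forLoop vA eN
    (.setNat aGraph (var vA) (var vB) (.get 1 (var vA) (var vB)) ⨟
      .setNat aNumPar (var vB) (.const 0)
        (.add (.get aNumPar (var vB) (.const 0)) (.get 1 (var vA) (var vB)))))

variable {n : ℕ} {D : Dataset n} {G : Digraph (Fin n)} {h : ℕ} {α : ℝ}

/-- The arc `x → y` is removed because of the triangle `T`. -/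
def Removes (T : Triangle n) (x y : Fin n) : Prop :=
  (x = T.A ∧ y = T.B) ∨ (x = T.B ∧ y = T.C) ∨ (x = T.C ∧ y = T.B)

/-- The arcs of `G` that are not removed because of a triangle of `S`. -/
def RemainingArc (G : Digraph (Fin n)) (S : Set (Triangle n)) (x y : Fin n) : Prop :=
  G.Adj x y ∧ ∀ T ∈ S, ¬ Removes T x y

open Classical in
/-- The memory holds the list `L` of triangles, together with the remaining arcs and the numbers of
confounders above each of the nodes. -/
structure Holds (G : Digraph (Fin n)) (L : List (Triangle n)) (s : State) : Prop where
  length_eq : s.nat 4 0 0 = L.length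
  row : ∀ i (hi : i < L.length), s.nat 5 i 0 = L[i].A ∧ s.nat 5 i 1 = L[i].B ∧ s.nat 5 i 2 = L[i].C
  arc : ∀ x y : Fin n, s.nat aGraph x y = if RemainingArc G {T | T ∈ L} x y then 1 else 0
  -- The number `n` is a dummy node without parents; it will represent the confounders as bases.
  last : ∀ x : Fin n, s.nat aGraph x n = 0
  conf : ∀ x : Fin n, s.nat aConf x 0 = L.countP fun T => T.A = x ∨ T.B = x
  confLast : s.nat aConf n 0 = 0

/-- The memory holds a list of the triangles in `S`. -/
def Collected (G : Digraph (Fin n)) (S : Set (Triangle n)) (s : State) : Prop :=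
  ∃ L : List (Triangle n), L.Nodup ∧ (∀ T, T ∈ L ↔ T ∈ S) ∧ Holds G L s

theorem Holds.of_eq {L : List (Triangle n)} {s s' : State} (hs : Holds G L s)
    (h4 : s'.nat 4 = s.nat 4) (h5 : s'.nat 5 = s.nat 5) (hG : s'.nat aGraph = s.nat aGraph)
    (hc : s'.nat aConf = s.nat aConf) : Holds G L s' := by
  constructor <;> simp only [h4, h5, hG, hc]
  exacts [hs.1, hs.2, hs.3, hs.4, hs.5, hs.6]

theorem Collected.of_eq {S : Set (Triangle n)} {s s' : State} (hs : Collected G S s)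
    (h4 : s'.nat 4 = s.nat 4) (h5 : s'.nat 5 = s.nat 5) (hG : s'.nat aGraph = s.nat aGraph)
    (hc : s'.nat aConf = s.nat aConf) : Collected G S s' := by
  obtain ⟨L, hL, hS, hH⟩ := hs
  exact ⟨L, hL, hS, hH.of_eq h4 h5 hG hc⟩

-- `T ∉ S` keeps the list free of repetitions, and `T.A ≠ T.B` makes the two increments of
-- confounder counts fall on different cells.
open Classical in
theorem runs_append {S : Set (Triangle n)} {s : State} (hs : Collected G S s) {T : Triangle n}
    (hA : s.nat vA 0 0 = T.A) (hB : s.nat vB 0 0 = T.B) (hC : s.nat vC 0 0 = T.C) (hT : T ∉ S)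
    (hAB : T.A ≠ T.B) : Runs append s 120 (Collected G (insert T S)) := by
  obtain ⟨L, hL, hS, hH⟩ := hs
  refine Runs.of_wp (by simp [append, Program.maxCost, NExpr.cost]) ?_
  have hne : ∀ z : Fin n, ¬ (n = z.val) := fun z hz => by have := z.2; omega
  refine ⟨L ++ [T], ?_, ?_, ?_, ?_, ?_, ?_, ?_, ?_⟩
  · rw [List.nodup_append]
    refine ⟨hL, by simp, ?_⟩
    intro T' hT' T'' hT'' heq
    rw [List.mem_singleton] at hT''
    subst hT'' heq
    exact hT ((hS _).1 hT')
  · intro T'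
    simp [hS, or_comm]
  · simp [NExpr.eval, hH.length_eq]
  · intro i hi
    simp only [NExpr.eval, ne_eq, Nat.reduceEqDiff, not_false_eq_true,
      State.setNat_nat_of_ne, State.setNat_nat_self, hH.length_eq, hA, hB, hC]
    by_cases hiL : i = L.length
    · subst hiL
      simp
    · have hi' : i < L.length := by simp at hi; omega
      have := hH.row i hi'
      simp [hiL, List.getElem_append_left hi', this]
  · intro x y
    have hrem : RemainingArc G {T' | T' ∈ L ++ [T]} x y ↔
        RemainingArc G {T' | T' ∈ L} x y ∧ ¬ Removes T x y := by
      simp only [RemainingArc, Set.mem_ofPred_eq, List.mem_append, List.mem_singleton, or_imp,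
        forall_and, forall_eq, and_assoc]
    simp only [NExpr.eval, ne_eq, Nat.reduceEqDiff, not_false_eq_true,
      State.setNat_nat_of_ne, State.setNat_nat_self, hA, hB, hC, Fin.val_inj, hH.arc, hrem]
    by_cases h1 : x = T.A ∧ y = T.B
    · simp [h1, Removes]
    by_cases h2 : x = T.B ∧ y = T.C
    · simp [h2, Removes]
    by_cases h3 : x = T.C ∧ y = T.B
    · simp [h3, Removes]
    simp [h1, h2, h3, Removes]
  · intro x
    simp [NExpr.eval, hA, hB, hC, hH.last, hne]
  · intro x
    simp only [NExpr.eval, ne_eq, Nat.reduceEqDiff, not_false_eq_true,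
      State.setNat_nat_of_ne, State.setNat_nat_self, hA, hB, hC, Fin.val_inj, hH.conf, and_true,
      List.countP_append, List.countP_singleton]
    by_cases h1 : x = T.A
    · subst h1
      simp [hAB]
    · by_cases h2 : x = T.B
      · subst h2
        simp [hAB.symm]
      · simp [h1, h2, Ne.symm h1, Ne.symm h2, eq_comm]
  · simp [NExpr.eval, hA, hB, hH.confLast, hne]

theorem IsDAG.ne {V : Type*} {G : Digraph V} (hG : IsDAG G) {x y : V} (h : G.Adj x y) : x ≠ y := by
  rintro rfl
  exact hG x (.single h)

/-- Type 1 contains `C → A` and Type 3 contains `A → C`, so in a DAG a triangle has only one of the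
types and only one of the two additional conditions matters. -/
theorem mem_latent_typeOne (hG : IsDAG G) {T : Triangle n} (h1 : IsTypeOne G T) :
    T ∈ latent D G h α ↔ LooksLatent D h α T.A T.B T.C ∧ 3 ≤ (parents G T.B).ncard := by
  have h3 : ¬ IsTypeThree G T := fun h3 => hG _ (.tail (.single h1.1) h3.2.2)
  simp only [latent, latentOne, latentThree, Candidate, LooksLatent, Set.mem_union,
    Set.mem_ofPred_eq, h1, h3, true_and, false_and, and_false, or_false]

theorem mem_latent_typeThree (hG : IsDAG G) {T : Triangle n} (h3 : IsTypeThree G T) :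
    T ∈ latent D G h α ↔ LooksLatent D h α T.A T.B T.C ∧
      ∃ E ∈ (parents G T.B \ {T.A}) ∪ (children G T.B \ {T.C}),
        ∃ Z, findSet D h α E T.C {T.A} ∅ = some Z := by
  have h1 : ¬ IsTypeOne G T := fun h1 => hG _ (.tail (.single h1.1) h3.2.2)
  simp only [latent, latentOne, latentThree, Candidate, LooksLatent, Set.mem_union,
    Set.mem_ofPred_eq, h1, h3, or_true, true_and, false_and, and_false, false_or]

theorem mem_latent_type {T : Triangle n} (hT : T ∈ latent D G h α) :
    IsTypeOne G T ∨ IsTypeThree G T := by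
  rcases hT with hT | hT
  · exact .inl hT.2.1
  · exact .inr hT.2.1

/-- The invariant of the collection: the triangles of `S` have been listed. -/
structure CollectInv (D : Dataset n) (G : Digraph (Fin n)) (h : ℕ) (α : ℝ) (S : Set (Triangle n))
    (s : State) : Prop where
  loaded : Loaded D G h α s
  clean : Clean s
  numPar : ∀ x : Fin n, s.nat aNumPar x 0 = (parents G x).ncard
  coll : Collected G S s

/-- `p` changes neither the input nor the data of the collection. -/
def Program.keepsCollection (p : Program) : Bool :=
  p.keepsInput && !(p.writesNat 4 || p.writesNat 5 || p.writesNat aNumPar || p.writesNat aGraph ||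
    p.writesNat aConf)

theorem CollectInv.agree {S : Set (Triangle n)} {s s' : State} {p : Program}
    (hs : CollectInv D G h α S s) (hA : Agree p s s') (hp : p.keepsCollection = true)
    (hC : Clean s') : CollectInv D G h α S s' := by
  simp only [Program.keepsCollection, Bool.and_eq_true, Bool.not_eq_true',
    Bool.or_eq_false_iff] at hp
  obtain ⟨h0, ⟨⟨⟨h4, h5⟩, h6⟩, h7⟩, h8⟩ := hp
  exact ⟨hs.loaded.agree hA h0, hC, by rw [hA.1 _ h6]; exact hs.numPar,
    hs.coll.of_eq (hA.1 _ h4) (hA.1 _ h5) (hA.1 _ h7) (hA.1 _ h8)⟩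

theorem CollectInv.setNat {S : Set (Triangle n)} {s : State} (hs : CollectInv D G h α S s)
    {v : ℕ} (hv : 39 ≤ v ∨ 29 ≤ v ∧ v ≤ 35) (x : ℕ) :
    CollectInv D G h α S (s.setNat v 0 0 x) := by
  have h1 : ∀ a, a < 29 ∨ a = 36 ∨ a = 37 ∨ a = 38 → (s.setNat v 0 0 x).nat a = s.nat a :=
    fun a ha => State.setNat_nat_of_ne _ _ _ _ (by omega)
  refine ⟨hs.loaded.of_eq (fun a ha => h1 a (by omega)) rfl, ?_, ?_, ?_⟩
  · simpa [Clean, h1] using hs.clean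
  · simpa [h1] using hs.numPar
  · exact hs.coll.of_eq (h1 _ (by omega)) (h1 _ (by omega)) (h1 _ (by omega)) (h1 _ (by omega))

theorem CollectInv.runs_append {S : Set (Triangle n)} {s : State} (hs : CollectInv D G h α S s)
    {T : Triangle n} (hA : s.nat vA 0 0 = T.A) (hB : s.nat vB 0 0 = T.B) (hC : s.nat vC 0 0 = T.C)
    (hT : T ∉ S) (hAB : T.A ≠ T.B) : Runs append s 120 (CollectInv D G h α (insert T S)) := by
  refine (ConfounderSearch.runs_append hs.coll hA hB hC hT hAB).mono le_rfl ?_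
  intro s' A' h'
  exact ⟨hs.loaded.agree A' rfl, hs.clean.agree A' rfl, by rw [A'.1 aNumPar rfl]; exact hs.numPar, h'⟩

-- If `C` is not adjacent to `B`, the arc tests fail at constant cost. The searches are thus charged
-- to at most `2k` values of `C` for each `B`.
open Classical in
theorem runs_checkTriangle (hG : IsDAG G) (hk : 1 ≤ maxDegree G) (hD : 1 ≤ D.size) (hh : 1 ≤ h)
    {S : Set (Triangle n)} {s : State} (hs : CollectInv D G h α S s) {T : Triangle n}
    (hA : s.nat vA 0 0 = T.A) (hB : s.nat vB 0 0 = T.B) (hC : s.nat vC 0 0 = T.C)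
    (hT : T ∉ S) (hAB : G.Adj T.A T.B) :
    Runs checkTriangle s (70 + if T.C ∈ parents G T.B ∪ children G T.B then
        34000 * (maxDegree G * (n * h * D.size)) else 0)
      (CollectInv D G h α {T' | T' ∈ S ∨ (T' = T ∧ T' ∈ latent D G h α)}) := by
  have hn : 1 ≤ n := by have := T.A.2; omega
  have hW : 1 ≤ n * h * D.size := Nat.mul_pos (Nat.mul_pos hn hh) hD
  have hkW : n * h * D.size ≤ maxDegree G * (n * h * D.size) := Nat.le_mul_of_pos_left _ hk
  have hin : T ∈ latent D G h α →
      {T' | T' ∈ S ∨ (T' = T ∧ T' ∈ latent D G h α)} = insert T S := by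
    intro hTl
    ext T'
    simp only [Set.mem_ofPred_eq, Set.mem_insert_iff]
    constructor
    · rintro (h | h)
      exacts [.inr h, .inl h.1]
    · rintro (rfl | h)
      exacts [.inr ⟨rfl, hTl⟩, .inl h]
  have hout : T ∉ latent D G h α →
      {T' | T' ∈ S ∨ (T' = T ∧ T' ∈ latent D G h α)} = S := by
    intro hTl
    ext T'
    simp only [Set.mem_ofPred_eq]
    refine ⟨?_, .inl⟩
    rintro (h | ⟨rfl, h⟩)
    exacts [h, absurd h hTl]
  have ht1 : (Test.and (arcTest vC vA) (arcTest vC vB)).Holds s ↔ IsTypeOne G T := by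
    simp only [Test.Holds, holds_arcTest hs.loaded hC hA, holds_arcTest hs.loaded hC hB, IsTypeOne,
      hAB, true_and]
  have ht3 : (Test.and (arcTest vB vC) (arcTest vA vC)).Holds s ↔ IsTypeThree G T := by
    simp only [Test.Holds, holds_arcTest hs.loaded hB hC, holds_arcTest hs.loaded hA hC,
      IsTypeThree, hAB, true_and]
  have hcand := fun hAC hBC =>
    runs_candidateTest hs.loaded hD hh hs.clean hA hB hC hAC hBC
  by_cases h1 : IsTypeOne G T
  · rw [if_pos (.inl h1.2.2)]
    refine Runs.ite (T := 34000 * (maxDegree G * (n * h * D.size))) (fun _ => ?_)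
      (fun h' => absurd (ht1.2 h1) h')
      (by simp only [Test.cost, arcTest, NExpr.cost]; omega)
    refine (hcand (hG.ne h1.1).symm (hG.ne h1.2.2).symm).seq
      (T₂ := 200 * (maxDegree G * (n * h * D.size))) ?_ (by omega)
    rintro s1 A1 ⟨C1, R1⟩
    have I1 := hs.agree A1 rfl C1
    have b1 : s1.nat vB 0 0 = T.B := by rw [A1.1 vB rfl, hB]
    have htest : (Test.and (.natEq (var vCand) (.const 1))
        (.natLt (.const 2) (.get aNumPar (var vB) (.const 0)))).Holds s1 ↔
        T ∈ latent D G h α := by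
      rw [mem_latent_typeOne hG h1, ← R1]
      simp only [Test.Holds, NExpr.eval, b1, I1.numPar]
      rfl
    refine Runs.ite (T := 120) (fun h' => ?_) (fun h' => ?_)
      (by simp only [Test.cost, NExpr.cost]; omega)
    · rw [hin (htest.1 h')]
      exact I1.runs_append (by rw [A1.1 vA rfl, hA]) b1 (by rw [A1.1 vC rfl, hC]) hT (hG.ne hAB)
    · rw [hout fun h'' => h' (htest.2 h'')]
      exact Runs.of_wp (by simp [Program.maxCost]) I1
  by_cases h3 : IsTypeThree G T
  · rw [if_pos (.inr h3.2.1)]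
    refine Runs.ite (T := 34000 * (maxDegree G * (n * h * D.size)) + 30)
      (fun h' => absurd (ht1.1 h') h1) (fun _ => ?_)
      (by simp only [Test.cost, arcTest, NExpr.cost]; omega)
    refine Runs.ite (T := 34000 * (maxDegree G * (n * h * D.size))) (fun _ => ?_)
      (fun h' => absurd (ht3.2 h3) h')
      (by simp only [Test.cost, arcTest, NExpr.cost]; omega)
    refine (hcand (hG.ne h3.2.2) (hG.ne h3.2.1)).seq
      (T₂ := 13000 * (maxDegree G * (n * h * D.size))) ?_ (by omega)
    rintro s1 A1 ⟨C1, R1⟩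
    have I1 := hs.agree A1 rfl C1
    have a1 : s1.nat vA 0 0 = T.A := by rw [A1.1 vA rfl, hA]
    have b1 : s1.nat vB 0 0 = T.B := by rw [A1.1 vB rfl, hB]
    have c1 : s1.nat vC 0 0 = T.C := by rw [A1.1 vC rfl, hC]
    refine Runs.ite (T := 12900 * (maxDegree G * (n * h * D.size))) (fun h' => ?_) (fun h' => ?_)
      (by simp only [Test.cost, NExpr.cost]; omega)
    · have hll : LooksLatent D h α T.A T.B T.C := R1.1 h'
      refine (runs_witnessTest I1.loaded hD hh C1 a1 b1 c1 (hG.ne h3.2.2) hk).seq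
        (T₂ := 200 * (maxDegree G * (n * h * D.size))) ?_ (by omega)
      rintro s2 A2 ⟨C2, R2⟩
      have I2 := I1.agree A2 rfl C2
      have htest : (Test.natEq (var vOk) (.const 1)).Holds s2 ↔ T ∈ latent D G h α := by
        rw [mem_latent_typeThree hG h3, ← R2]
        simp [Test.Holds, NExpr.eval, hll]
      refine Runs.ite (T := 120) (fun h' => ?_) (fun h' => ?_)
        (by simp only [Test.cost, NExpr.cost]; omega)
      · rw [hin (htest.1 h')]
        exact I2.runs_append (by rw [A2.1 vA rfl, a1]) (by rw [A2.1 vB rfl, b1])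
          (by rw [A2.1 vC rfl, c1]) hT (hG.ne hAB)
      · rw [hout fun h'' => h' (htest.2 h'')]
        exact Runs.of_wp (by simp [Program.maxCost]) I2
    · rw [hout fun h'' => h' (R1.2 ((mem_latent_typeThree hG h3).1 h'').1)]
      exact Runs.of_wp (by simp only [Program.maxCost]; omega) I1
  · rw [hout fun h'' => (mem_latent_type h'').elim h1 h3]
    refine Runs.ite (T := 40)
      (fun h' => absurd (ht1.1 h') h1) (fun _ => ?_)
      (by simp only [Test.cost, arcTest, NExpr.cost]; omega)
    exact Runs.ite (T := 1) (fun h' => absurd (ht3.1 h') h3)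
      (fun _ => Runs.of_wp le_rfl hs)
      (by simp [Test.cost, arcTest, NExpr.cost])

end Triangles

/-! ### The loops over all triangles, and their total cost -/

section CollectLoops

variable {n : ℕ} {D : Dataset n} {G : Digraph (Fin n)} {h : ℕ} {α : ℝ}

theorem pos_of_maxDegree (hk : 1 ≤ maxDegree G) : 1 ≤ n := by
  rcases Nat.eq_zero_or_pos n with rfl | hn
  · simp [maxDegree] at hk
  · exact hn

/-- The latent triangles that precede the position `(b, a, c)` of the collection. -/
def latentBefore (D : Dataset n) (G : Digraph (Fin n)) (h : ℕ) (α : ℝ) (b a c : ℕ) :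
    Set (Triangle n) :=
  {T | T ∈ latent D G h α ∧
    (T.B.val < b ∨ (T.B.val = b ∧ (T.A.val < a ∨ (T.A.val = a ∧ T.C.val < c))))}

theorem ncard_adjacent_le (G : Digraph (Fin n)) (v : Fin n) :
    {x | x ∈ parents G v ∪ children G v}.ncard ≤ 2 * maxDegree G := by
  refine (Set.ncard_union_le _ _).trans ?_
  have h1 := ncard_parents_le G v
  have h2 := ncard_children_le G v
  omega

open Classical in
theorem runs_collect_third (hG : IsDAG G) (hk : 1 ≤ maxDegree G) (hD : 1 ≤ D.size) (hh : 1 ≤ h)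
    {A B : Fin n} {s : State} (hs : CollectInv D G h α (latentBefore D G h α B A 0) s)
    (hA : s.nat vA 0 0 = A) (hB : s.nat vB 0 0 = B) (hAB : G.Adj A B) :
    Runs (forLoop vC eN checkTriangle) s
      (n * 86 + 68000 * (maxDegree G ^ 2 * (n * h * D.size)) + 12)
      (CollectInv D G h α (latentBefore D G h α B (A + 1) 0)) := by
  refine (Runs.for (N := n) (T := fun i => 70 + if ∃ hi : i < n, (⟨i, hi⟩ : Fin n) ∈
      parents G B ∪ children G B then 34000 * (maxDegree G * (n * h * D.size)) else 0)
    (fun i => CollectInv D G h α (latentBefore D G h α B A i)) rfl (by simp [NExpr.cost])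
    ?_ (fun i s' x hI => hI.setNat (by omega) x) hs ?_).mono ?_ ?_
  · exact fun s' hA => (hs.loaded.agree hA rfl).n_eq
  · intro i hi s' As hv hI
    have hset : {T' | T' ∈ latentBefore D G h α B A i ∨
        (T' = (⟨A, B, ⟨i, hi⟩⟩ : Triangle n) ∧ T' ∈ latent D G h α)} =
        latentBefore D G h α B A (i + 1) := by
      ext T
      simp only [latentBefore, Set.mem_ofPred_eq]
      constructor
      · rintro (⟨hT, h⟩ | ⟨rfl, hT⟩)
        · exact ⟨hT, by omega⟩
        · exact ⟨hT, by simp⟩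
      · rintro ⟨hT, h⟩
        by_cases hl : T.B.val < B ∨ T.B.val = B ∧ (T.A.val < A ∨ T.A.val = A ∧ T.C.val < i)
        · exact .inl ⟨hT, hl⟩
        · refine .inr ⟨?_, hT⟩
          have h1 : T.A = A := Fin.ext (by omega)
          have h2 : T.B = B := Fin.ext (by omega)
          have h3 : T.C = ⟨i, hi⟩ := Fin.ext (by simp; omega)
          cases T
          simp_all
    have := runs_checkTriangle hG hk hD hh hI (T := ⟨A, B, ⟨i, hi⟩⟩)
      (by rw [As.1 vA rfl, hA]) (by rw [As.1 vB rfl, hB]) hv (by simp [latentBefore]) hAB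
    rw [hset] at this
    simpa [hi] using this
  · have := sum_ite_le (ncard_adjacent_le G B) 86 (34000 * (maxDegree G * (n * h * D.size)))
    simp only [add_right_comm _ _ 16] at this ⊢
    simp only [Nat.reduceAdd]
    have h3 : 2 * maxDegree G * (34000 * (maxDegree G * (n * h * D.size)))
      = 68000 * (maxDegree G ^ 2 * (n * h * D.size)) := by ring
    omega
  · intro s' _ hI
    -- Since `T.C < n`, the end of the inner loop, position `(B, A, n)`, is the position `(B, A + 1,
    -- 0)`.
    convert hI using 1
    ext T
    have := T.C.2
    simp only [latentBefore, Set.mem_ofPred_eq]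
    refine and_congr_right fun _ => ?_
    omega

open Classical in
theorem runs_collect_second (hG : IsDAG G) (hk : 1 ≤ maxDegree G) (hD : 1 ≤ D.size) (hh : 1 ≤ h)
    {B : Fin n} {s : State} (hs : CollectInv D G h α (latentBefore D G h α B 0 0) s)
    (hB : s.nat vB 0 0 = B) :
    Runs (forLoop vA eN (.ite (arcTest vA vB) (forLoop vC eN checkTriangle) .skip)) s
      (n * 46 + maxDegree G * (n * 86 + 68000 * (maxDegree G ^ 2 * (n * h * D.size)) + 12) + 12)
      (CollectInv D G h α (latentBefore D G h α (B + 1) 0 0)) := by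
  refine (Runs.for (N := n) (T := fun i => 30 + if ∃ hi : i < n, (⟨i, hi⟩ : Fin n) ∈
      parents G B then n * 86 + 68000 * (maxDegree G ^ 2 * (n * h * D.size)) + 12 else 0)
    (fun i => CollectInv D G h α (latentBefore D G h α B i 0)) rfl (by simp [NExpr.cost])
    ?_ (fun i s' x hI => hI.setNat (by omega) x) hs ?_).mono ?_ ?_
  · exact fun s' hA => (hs.loaded.agree hA rfl).n_eq
  · intro i hi s' As hv hI
    have bs : s'.nat vB 0 0 = B := by rw [As.1 vB rfl, hB]
    have ht := holds_arcTest hI.loaded (x := ⟨i, hi⟩) hv bs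
    by_cases hAB : G.Adj ⟨i, hi⟩ B
    · rw [if_pos ⟨hi, hAB⟩]
      refine Runs.ite (fun _ => runs_collect_third hG hk hD hh (A := ⟨i, hi⟩) hI hv bs hAB)
        (fun h' => absurd (ht.2 hAB) h') (by simp only [Test.cost, arcTest, NExpr.cost]; omega)
    · rw [if_neg (by rintro ⟨_, h'⟩; exact hAB h')]
      refine Runs.ite (T := 1) (fun h' => absurd (ht.1 h') hAB)
        (fun _ => Runs.of_wp le_rfl ?_) (by simp [Test.cost, arcTest, NExpr.cost])
      change CollectInv D G h α _ s'
      convert hI using 1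
      ext T
      simp only [latentBefore, Set.mem_ofPred_eq]
      refine and_congr_right fun hT => ?_
      -- A latent triangle contains the arc `A → B`, so nothing is missed at a position without this
      -- arc.
      have hadj : G.Adj T.A T.B := (mem_latent_type hT).elim (fun h => h.2.1) (fun h => h.1)
      have hne : ¬ (T.A.val = i ∧ T.B.val = B) := by
        rintro ⟨h1, h2⟩
        have h1' : T.A = ⟨i, hi⟩ := Fin.ext h1
        rw [h1', Fin.ext h2] at hadj
        exact hAB hadj
      omega
  · have := sum_ite_le (P := fun x => x ∈ parents G B) (ncard_parents_le G B) 46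
      (n * 86 + 68000 * (maxDegree G ^ 2 * (n * h * D.size)) + 12)
    simp only [add_right_comm _ _ 16] at this ⊢
    simp only [Nat.reduceAdd]
    omega
  · intro s' _ hI
    convert hI using 1
    ext T
    have := T.A.2
    simp only [latentBefore, Set.mem_ofPred_eq]
    refine and_congr_right fun _ => ?_
    omega

theorem runs_collect (hG : IsDAG G) (hk : 1 ≤ maxDegree G) (hD : 1 ≤ D.size) (hh : 1 ≤ h)
    {s : State} (hs : CollectInv D G h α ∅ s) :
    Runs collect s (69000 * (n * maxDegree G ^ 3 * (n * h * D.size)))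
      (CollectInv D G h α (latent D G h α)) := by
  have hn := pos_of_maxDegree hk
  refine (Runs.for_const (N := n)
    (T := n * 46 + maxDegree G * (n * 86 + 68000 * (maxDegree G ^ 2 * (n * h * D.size)) + 12) + 12)
    (fun i => CollectInv D G h α (latentBefore D G h α i 0 0)) rfl (by simp [NExpr.cost])
    ?_ (fun i s' x hI => hI.setNat (by omega) x) ?_ ?_ le_rfl).mono ?_ ?_
  · exact fun s' hA => (hs.loaded.agree hA rfl).n_eq
  · convert hs using 1
    ext T
    simp [latentBefore]
  · intro i hi s' As hv hI
    exact runs_collect_second hG hk hD hh (B := ⟨i, hi⟩) hI hv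
  -- With `W = n h |D|`, the tests and searches give `n · k · 2k · O(k W)`. Scanning the nodes costs
  -- `O(n² k)`, which is dominated because `n ≤ W`.
  · generalize maxDegree G = k at *
    generalize hW : n * h * D.size = W
    have hnW : n ≤ W := by
      rw [← hW, mul_assoc]
      exact Nat.le_mul_of_pos_right _ (Nat.mul_pos hh hD)
    have e1 : n * n ≤ n * k ^ 3 * W :=
      Nat.mul_le_mul (Nat.le_mul_of_pos_right _ (Nat.pow_pos hk)) hnW
    have e2 : n * k * n ≤ n * k ^ 3 * W :=
      Nat.mul_le_mul (Nat.mul_le_mul_left _ (Nat.le_self_pow (by omega) _)) hnW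
    have e3 : n * k ≤ n * k * n := Nat.le_mul_of_pos_right _ hn
    have e4 : n ≤ n * n := Nat.le_mul_of_pos_right _ hn
    have e5 : n * (n * 46 + k * (n * 86 + 68000 * (k ^ 2 * W) + 12) + 12 + 16) + 12
        = 46 * (n * n) + 86 * (n * k * n) + 68000 * (n * k ^ 3 * W) + 12 * (n * k) + 28 * n + 12 := by
      ring
    omega
  · intro s' _ hI
    convert hI using 1
    ext T
    simp [latentBefore]

theorem ncard_parents_eq_sum {s : State} (hL : Loaded D G h α s) (y : Fin n) :
    (parents G y).ncard = ∑ x ∈ Finset.range n, s.nat 1 x y := by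
  classical
  rw [← Fin.sum_univ_eq_sum_range (fun x => s.nat 1 x y) n]
  have h1 : ∀ x : Fin n, s.nat 1 x y = if G.Adj x y then 1 else 0 := by
    intro x
    split_ifs with hxy
    · exact (hL.adj_iff x y).2 hxy
    · exact (hL.adj_zero x y).2 hxy
  simp only [h1]
  rw [← Finset.card_filter, ← Set.ncard_coe_finset]
  simp [parents]

theorem runs_copyGraph_column {s : State} (hL : Loaded D G h α s) {y : Fin n}
    (hy : s.nat vB 0 0 = y) (hz : s.nat aNumPar y 0 = 0) :
    Runs (forLoop vA eN
      (.setNat aGraph (var vA) (var vB) (.get 1 (var vA) (var vB)) ⨟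
        .setNat aNumPar (var vB) (.const 0)
          (.add (.get aNumPar (var vB) (.const 0)) (.get 1 (var vA) (var vB))))) s (n * 66 + 12)
      (fun s' => (∀ x < n, s'.nat aGraph x y = s.nat 1 x y) ∧
        (∀ x z : ℕ, z ≠ y → s'.nat aGraph x z = s.nat aGraph x z) ∧
        s'.nat aNumPar y 0 = ∑ x ∈ Finset.range n, s.nat 1 x y ∧
        ∀ z : ℕ, z ≠ y → s'.nat aNumPar z 0 = s.nat aNumPar z 0) := by
  refine Runs.for_const (N := n) (T := 50)
    (fun i s' => (∀ x < i, s'.nat aGraph x y = s.nat 1 x y) ∧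
        (∀ x z : ℕ, z ≠ y → s'.nat aGraph x z = s.nat aGraph x z) ∧
        s'.nat aNumPar y 0 = ∑ x ∈ Finset.range i, s.nat 1 x y ∧
        ∀ z : ℕ, z ≠ y → s'.nat aNumPar z 0 = s.nat aNumPar z 0) rfl (by simp [NExpr.cost]) ?_ ?_ ?_ ?_
      le_rfl
  · exact fun s' hA => (hL.agree hA rfl).n_eq
  · intro i s' x hI
    simpa using hI
  · simp [hz]
  · rintro i hi s' As hv ⟨h1, h2, h3, h4⟩
    have ys : s'.nat vB 0 0 = y := by rw [As.1 vB rfl, hy]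
    have as : s'.nat 1 = s.nat 1 := As.1 1 rfl
    refine Runs.of_wp (by simp [Program.maxCost, NExpr.cost]) ?_
    simp only [Program.wp, NExpr.eval]
    refine ⟨fun x hx => ?_, fun x z hz => ?_, ?_, fun z hz => ?_⟩
    · simp only [ne_eq, Nat.reduceEqDiff, not_false_eq_true, State.setNat_nat_of_ne,
        State.setNat_nat_self, hv, ys, as, and_true]
      by_cases hxi : x = i
      · simp [hxi]
      · rw [if_neg hxi]
        exact h1 x (by omega)
    · simp [ys, hz, h2]
    · simp [ys, hv, as, h3, Finset.sum_range_succ]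
    · simp [ys, hz, h4]

theorem runs_copyGraph (hk : 1 ≤ maxDegree G) (hh : 1 ≤ h) (hD : 1 ≤ D.size) :
    Runs copyGraph (input D G h α) (110 * (n * maxDegree G ^ 3 * (n * h * D.size)))
      (CollectInv D G h α ∅) := by
  classical
  have hn := pos_of_maxDegree hk
  have hL := loaded_input D G h α
  refine (Runs.for_const (N := n) (T := n * 66 + 12)
    (fun i s' => (∀ x y : Fin n, y.val < i → s'.nat aGraph x y = (input D G h α).nat 1 x y) ∧
      (∀ x y, i ≤ y → s'.nat aGraph x y = 0) ∧
      (∀ y : Fin n, y.val < i → s'.nat aNumPar y 0 = (parents G y).ncard) ∧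
      (∀ y, i ≤ y → s'.nat aNumPar y 0 = 0)) rfl (by simp [NExpr.cost])
    ?_ ?_ ?_ ?_ le_rfl).mono ?_ ?_
  · exact fun s' hA => (hL.agree hA rfl).n_eq
  · intro i s' x hI
    simpa using hI
  · refine ⟨fun x y hy => by omega, fun _ _ _ => rfl, fun y hy => by omega, fun _ _ => rfl⟩
  · rintro i hi s' As hv ⟨h1, h2, h3, h4⟩
    have hLs : Loaded D G h α s' := hL.agree As rfl
    refine (runs_copyGraph_column hLs (y := ⟨i, hi⟩) hv (h4 i le_rfl)).mono le_rfl ?_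
    rintro s2 A2 ⟨g1, g2, g3, g4⟩
    refine ⟨fun x y hy => ?_, fun x y hy => ?_, fun y hy => ?_, fun y hy => ?_⟩
    · by_cases hyi : y.val = i
      · have : y = ⟨i, hi⟩ := Fin.ext hyi
        subst this
        rw [g1 x x.2, As.1 1 rfl]
      · rw [g2 x y hyi, h1 x y (by omega)]
    · rw [g2 x y (by simp; omega), h2 x y (by omega)]
    · by_cases hyi : y.val = i
      · have : y = ⟨i, hi⟩ := Fin.ext hyi
        subst this
        rw [g3, ncard_parents_eq_sum hLs]
      · rw [g4 y hyi, h3 y (by omega)]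
    · rw [g4 y (by simp; omega), h4 y (by omega)]
  · generalize maxDegree G = k at *
    generalize hW : n * h * D.size = W
    have hnW : n ≤ W := by
      rw [← hW, mul_assoc]
      exact Nat.le_mul_of_pos_right _ (Nat.mul_pos hh hD)
    have e1 : n * n ≤ n * k ^ 3 * W :=
      Nat.mul_le_mul (Nat.le_mul_of_pos_right _ (Nat.pow_pos hk)) hnW
    have e4 : n ≤ n * n := Nat.le_mul_of_pos_right _ hn
    have e5 : n * (n * 66 + 12 + 16) + 12 = 66 * (n * n) + 28 * n + 12 := by ring
    omega
  · rintro s' As ⟨h1, h2, h3, -⟩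
    have hLs : Loaded D G h α s' := hL.agree As rfl
    refine ⟨hLs, ?_, fun x => h3 x x.2, [], by simp, by simp, ?_, by simp, fun x y => ?_,
      fun x => h2 x n le_rfl, fun x => ?_, ?_⟩
    · have : Clean (input D G h α) := ⟨fun _ _ => rfl, fun _ _ => rfl, fun _ _ => rfl,
        fun _ _ => rfl⟩
      exact this.agree As rfl
    · rw [As.1 4 rfl]; rfl
    · rw [h1 x y y.2]
      simp only [RemainingArc, List.not_mem_nil, Set.mem_ofPred_eq, false_implies, implies_true,
        and_true]
      split_ifs with hxy
      · exact (hL.adj_iff x y).2 hxy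
      · exact (hL.adj_zero x y).2 hxy
    · rw [As.1 aConf rfl]; rfl
    · rw [As.1 aConf rfl]; rfl

end CollectLoops

/-! ### Compelled arcs -/

/-! ### Perfect elimination orders of chordal graphs -/

section PerfectOrders

variable {V : Type*} (R : V → V → Prop)

/-- The neighbours of each entry among the later entries form a clique. -/
def Perfect : List V → Prop
  | [] => True
  | v :: l => (∀ a ∈ l, ∀ b ∈ l, a ≠ b → R a v → R b v → R a b) ∧ Perfect l

variable {R}

theorem Perfect.of_clique {l : List V} (h : ∀ a ∈ l, ∀ b ∈ l, a ≠ b → R a b) : Perfect R l := by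
  induction l with
  | nil => trivial
  | cons v l ih =>
    exact ⟨fun a ha b hb hab _ _ => h a (by simp [ha]) b (by simp [hb]) hab,
      ih fun a ha b hb => h a (by simp [ha]) b (by simp [hb])⟩

/-- As `v` is not adjacent to `l`, no entry of `l` gains a later neighbour when `v` joins the tail;
a tail that is a clique is perfect in any order. -/
theorem Perfect.extend {v : V} {l q q' : List V} (h : Perfect R (l ++ q))
    (hl : ∀ u ∈ l, ¬ R v u) (hq : ∀ a ∈ q', a = v ∨ a ∈ q)
    (hc : ∀ a ∈ q', ∀ b ∈ q', a ≠ b → R a b) : Perfect R (l ++ q') := by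
  induction l with
  | nil => exact Perfect.of_clique hc
  | cons u l ih =>
    have hmem : ∀ a ∈ l ++ q', R a u → a ∈ l ++ q := by
      intro a ha hau
      rcases List.mem_append.1 ha with ha | ha
      · exact List.mem_append_left _ ha
      · rcases hq a ha with rfl | ha
        · exact absurd hau (hl u (by simp))
        · exact List.mem_append_right _ ha
    refine ⟨fun a ha b hb hab hau hbu => ?_, ih h.2 fun u hu => hl u (by simp [hu])⟩
    exact h.1 a (hmem a ha hau) b (hmem b hb hbu) hab hau hbu

/-- A perfect order can be changed into one that ends with a given clique. -/
theorem Perfect.exists_append_clique (hR : ∀ ⦃a b⦄, R a b → R b a) {L : List V} (hL : Perfect R L)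
    (hd : L.Nodup) (c : List V) (hcd : c.Nodup) (hcL : c ⊆ L)
    (hc : ∀ a ∈ c, ∀ b ∈ c, a ≠ b → R a b) :
    ∃ l, (l ++ c).Perm L ∧ Perfect R (l ++ c) := by
  classical
  induction L generalizing c with
  | nil =>
    have : c = [] := List.subset_nil.1 hcL
    subst this
    exact ⟨[], by simp, trivial⟩
  | cons v L ih =>
    obtain ⟨hvL, hdL⟩ := List.nodup_cons.1 hd
    by_cases hv : v ∈ c
    · obtain ⟨c₁, c₂, rfl⟩ := List.append_of_mem hv
      have hcd' : (v :: (c₁ ++ c₂)).Nodup :=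
        (List.perm_middle.nodup_iff).1 hcd
      obtain ⟨hvc, hdc⟩ := List.nodup_cons.1 hcd'
      have hmc : ∀ a, a ∈ c₁ ++ c₂ → a ∈ c₁ ++ v :: c₂ := by
        intro a ha
        simp only [List.mem_append, List.mem_cons] at ha ⊢
        tauto
      have hcR : ∀ a ∈ c₁ ++ c₂, a ∈ L ∧ R a v := by
        intro a ha
        have hav : a ≠ v := by rintro rfl; exact hvc ha
        exact ⟨(List.mem_cons.1 (hcL (hmc a ha))).resolve_left hav,
          hc a (hmc a ha) v (by simp) hav⟩
      -- The clique without `v` is enlarged to the set of all the neighbours of `v` in `L`, a clique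
      -- by perfection. An order of `L` that ends with this set leaves no neighbour of `v` before
      -- the tail, and `v` can be inserted into the tail.
      set rest := L.filter fun a => R a v ∧ a ∉ c₁ ++ c₂ with hrest
      have hmr : ∀ a, a ∈ rest ↔ a ∈ L ∧ R a v ∧ a ∉ c₁ ++ c₂ := by
        intro a
        rw [hrest, List.mem_filter, decide_eq_true_eq]
      have hq : ∀ a ∈ rest ++ (c₁ ++ c₂), a ∈ L ∧ R a v := by
        intro a ha
        rcases List.mem_append.1 ha with ha | ha
        · exact ⟨((hmr a).1 ha).1, ((hmr a).1 ha).2.1⟩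
        · exact hcR a ha
      obtain ⟨l, hp, hl⟩ := ih hL.2 hdL (rest ++ (c₁ ++ c₂))
        (List.Nodup.append (hdL.filter _) hdc fun a ha ha' => ((hmr a).1 ha).2.2 ha')
        (fun a ha => (hq a ha).1)
        (fun a ha b hb hab => hL.1 a (hq a ha).1 b (hq b hb).1 hab (hq a ha).2 (hq b hb).2)
      have hp' : (l ++ (rest ++ (c₁ ++ v :: c₂))).Perm (v :: L) := by
        refine List.Perm.trans ?_ (hp.cons v)
        have h1 : (rest ++ (c₁ ++ v :: c₂)).Perm (v :: (rest ++ (c₁ ++ c₂))) := by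
          rw [← List.append_assoc, ← List.append_assoc]
          exact List.perm_middle
        exact (h1.append_left l).trans List.perm_middle
      refine ⟨l ++ rest, by rw [List.append_assoc]; exact hp', ?_⟩
      rw [List.append_assoc]
      refine hl.extend (v := v) ?_ ?_ ?_
      · intro u hu huv
        have hdn := hp.nodup_iff.2 hdL
        have huL : u ∈ L := hp.subset (List.mem_append_left _ hu)
        have hnot := List.disjoint_of_nodup_append hdn hu
        by_cases huc : u ∈ c₁ ++ c₂
        · exact hnot (List.mem_append_right _ huc)
        · exact hnot (List.mem_append_left _ ((hmr u).2 ⟨huL, hR huv, huc⟩))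
      · intro a ha
        simp only [List.mem_append, List.mem_cons] at ha ⊢
        tauto
      · have hmem : ∀ a ∈ rest ++ (c₁ ++ v :: c₂), a ≠ v → a ∈ L ∧ R a v := by
          intro a ha hav
          refine hq a ?_
          simp only [List.mem_append, List.mem_cons] at ha ⊢
          tauto
        intro a ha b hb hab
        by_cases hav : a = v
        · subst hav
          exact hR (hmem b hb hab.symm).2
        · by_cases hbv : b = v
          · subst hbv
            exact (hmem a ha hav).2
          · exact hL.1 a (hmem a ha hav).1 b (hmem b hb hbv).1 hab (hmem a ha hav).2
              (hmem b hb hbv).2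
    -- If `v` is not in the clique it remains the head, since its condition does not depend on the
    -- order of the later entries.
    · obtain ⟨l, hp, hl⟩ := ih hL.2 hdL c hcd
        (fun a ha => (List.mem_cons.1 (hcL ha)).resolve_left (by rintro rfl; exact hv ha)) hc
      refine ⟨v :: l, hp.cons v, ?_, hl⟩
      exact fun a ha b hb => hL.1 a (hp.subset ha) b (hp.subset hb)

theorem Perfect.idxOf [DecidableEq V] {L : List V} (hL : Perfect R L) {v a b : V}
    (ha : a ∈ L) (hb : b ∈ L) (hva : L.idxOf v < L.idxOf a)
    (hvb : L.idxOf v < L.idxOf b) (hab : a ≠ b) (hav : R a v) (hbv : R b v) : R a b := by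
  induction L with
  | nil => simp at ha
  | cons u L ih =>
    have haL : a ≠ u := by rintro rfl; simp at hva
    have hbL : b ≠ u := by rintro rfl; simp at hvb
    have ha' := (List.mem_cons.1 ha).resolve_left haL
    have hb' := (List.mem_cons.1 hb).resolve_left hbL
    by_cases hv : v = u
    · subst hv
      exact hL.1 a ha' b hb' hab hav hbv
    · rw [List.idxOf_cons_ne _ (Ne.symm hv), List.idxOf_cons_ne _ (Ne.symm haL)] at hva
      rw [List.idxOf_cons_ne _ (Ne.symm hv), List.idxOf_cons_ne _ (Ne.symm hbL)] at hvb
      exact ih hL.2 ha' hb' (by omega) (by omega)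

end PerfectOrders

/-! ### Which arcs of a DAG can be reversed within its equivalence class -/

section Compelled

variable {V : Type*} {G : Digraph V}

theorem IsDAG.not_symm (hG : IsDAG G) {x y : V} (h : G.Adj x y) : ¬ G.Adj y x :=
  fun h' => hG x (.tail (.single h) h')

theorem IsDAG.not_self (hG : IsDAG G) (x : V) : ¬ G.Adj x x := fun h => hG x (.single h)

theorem SkelAdj.symm {x y : V} (h : SkelAdj G x y) : SkelAdj G y x := Or.symm h

theorem IsDAG.wellFounded [Finite V] (hG : IsDAG G) : WellFounded (Relation.TransGen G.Adj) :=
  have : Std.Irrefl (Relation.TransGen G.Adj) := ⟨hG⟩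
  Finite.wellFounded_of_trans_of_irrefl _

theorem IsDAG.exists_maximal [Finite V] (hG : IsDAG G) {S : Set V} (hS : S.Nonempty) :
    ∃ x ∈ S, ∀ z ∈ S, ¬ G.Adj x z := by
  have : Std.Irrefl (Function.swap (Relation.TransGen G.Adj)) := ⟨hG⟩
  have : IsTrans V (Function.swap (Relation.TransGen G.Adj)) :=
    ⟨fun _ _ _ h h' => h'.trans h⟩
  obtain ⟨x, hx, hm⟩ := (Finite.wellFounded_of_trans_of_irrefl
    (Function.swap (Relation.TransGen G.Adj))).has_min S hS
  exact ⟨x, hx, fun z hz h => hm z hz (.single h)⟩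

/-- A reverse topological order: nodes without remaining children are removed one by one, so that
neighbours among the later entries are parents. -/
theorem IsDAG.exists_order [Finite V] (hG : IsDAG G) (S : Finset V) :
    ∃ L : List V, L.Nodup ∧ (∀ x, x ∈ L ↔ x ∈ S) ∧ L.Pairwise fun v a => ¬ G.Adj v a := by
  classical
  induction hN : S.card generalizing S with
  | zero =>
    rw [Finset.card_eq_zero] at hN
    exact ⟨[], by simp, by simp [hN], by simp⟩
  | succ N ih =>
    have hne : S.Nonempty := by
      rw [← Finset.card_pos]; omega
    obtain ⟨v, hv, hm⟩ := hG.exists_maximal (S := (S : Set V)) hne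
    obtain ⟨L, h1, h2, h3⟩ := ih (S.erase v) (by rw [Finset.card_erase_of_mem hv]; omega)
    refine ⟨v :: L, ?_, ?_, ?_⟩
    · rw [List.nodup_cons]
      exact ⟨by simp [h2], h1⟩
    · intro x
      simp only [List.mem_cons, h2, Finset.mem_erase]
      constructor
      · rintro (rfl | h)
        exacts [hv, h.2]
      · intro hx
        by_cases hxv : x = v
        exacts [.inl hxv, .inr ⟨hxv, hx⟩]
    · rw [List.pairwise_cons]
      exact ⟨fun a ha => hm a (Finset.mem_of_mem_erase ((h2 a).1 ha)), h3⟩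

/-- An arc inside a set of nodes which have the same parents outside, and whose parents inside are
cliques, can be reversed. -/
theorem IsDAG.exists_reversal [Finite V] (hG : IsDAG G) {C : Set V}
    (hout : ∀ z ∈ C, ∀ z' ∈ C, ∀ k ∉ C, G.Adj k z → G.Adj k z')
    (hin : ∀ z ∈ C, ∀ p ∈ C, ∀ q ∈ C, p ≠ q → G.Adj p z → G.Adj q z → SkelAdj G p q)
    {p y : V} (hp : p ∈ C) (hy : y ∈ C) (hpy : G.Adj p y) :
    ∃ H : Digraph V, IsDAG H ∧ SameClass G H ∧ H.Adj y p := by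
  classical
  obtain ⟨L, hLd, hLC, hLp⟩ := hG.exists_order C.toFinite.toFinset
  simp only [Set.Finite.mem_toFinset] at hLC
  -- The later neighbours of `v` are its parents in `C`, which form a clique by `hin`.
  have hperf : Perfect (SkelAdj G) L := by
    have hsub : ∀ x ∈ L, x ∈ C := fun x hx => (hLC x).1 hx
    clear hLC hLd
    induction L with
    | nil => trivial
    | cons v l ih =>
      rw [List.pairwise_cons] at hLp
      refine ⟨fun a ha b hb hab hav hbv => ?_, ih hLp.2 fun x hx => hsub x (by simp [hx])⟩
      exact hin v (hsub v (by simp)) a (hsub a (by simp [ha])) b (hsub b (by simp [hb])) hab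
        (hav.resolve_right (hLp.1 a ha)) (hbv.resolve_right (hLp.1 b hb))
  have hne : p ≠ y := hG.ne hpy
  obtain ⟨l, hperm, hM⟩ := hperf.exists_append_clique (fun _ _ h => SkelAdj.symm h) hLd [p, y]
    (by simp [hne]) (by simp [hLC, hp, hy])
    (by
      intro a ha b hb hab
      simp only [List.mem_cons, List.not_mem_nil, or_false] at ha hb
      rcases ha with rfl | rfl <;> rcases hb with rfl | rfl
      exacts [absurd rfl hab, .inl hpy, .inr hpy, absurd rfl hab])
  set M := l ++ [p, y] with hMdef
  have hMd : M.Nodup := hperm.nodup_iff.2 hLd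
  have hMC : ∀ x, x ∈ M ↔ x ∈ C := fun x => hperm.mem_iff.trans (hLC x)
  -- Inside `C` every edge is directed from the later to the earlier entry of `M`, and all the other
  -- arcs are kept. As `M` ends with `p, y`, this gives `y → p`.
  let H : Digraph V := ⟨fun u v => (u ∈ C ∧ v ∈ C ∧ SkelAdj G u v ∧ M.idxOf v < M.idxOf u) ∨
    (¬ (u ∈ C ∧ v ∈ C) ∧ G.Adj u v)⟩
  have hH : ∀ u v, H.Adj u v ↔ (u ∈ C ∧ v ∈ C ∧ SkelAdj G u v ∧ M.idxOf v < M.idxOf u) ∨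
    (¬ (u ∈ C ∧ v ∈ C) ∧ G.Adj u v) := fun u v => Iff.rfl
  have hHout : ∀ {u v}, ¬ (u ∈ C ∧ v ∈ C) → (H.Adj u v ↔ G.Adj u v) := by
    intro u v huv
    rw [hH]
    tauto
  have hHin : ∀ {u v}, u ∈ C → v ∈ C →
      (H.Adj u v ↔ SkelAdj G u v ∧ M.idxOf v < M.idxOf u) := by
    intro u v hu hv
    rw [hH]
    tauto
  have hskel : ∀ x z, SkelAdj G x z ↔ SkelAdj H x z := by
    intro x z
    by_cases hxz : x ∈ C ∧ z ∈ C
    · have h1 := hHin hxz.1 hxz.2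
      have h2 := hHin hxz.2 hxz.1
      simp only [SkelAdj] at h1 h2 ⊢
      rw [h1, h2]
      constructor
      · intro h
        have hxz' : x ≠ z := by
          rintro rfl
          exact hG.not_self _ (h.elim id id)
        have : M.idxOf x ≠ M.idxOf z := fun h =>
          hxz' ((List.idxOf_inj ((hMC x).2 hxz.1)).1 h)
        rcases Nat.lt_or_gt_of_ne this with hlt | hlt
        · exact .inr ⟨h.symm, hlt⟩
        · exact .inl ⟨h, hlt⟩
      · rintro (h | h)
        exacts [h.1, h.1.symm]
    · have h1 := hHout hxz
      have h2 := hHout (u := z) (v := x) fun h => hxz ⟨h.2, h.1⟩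
      simp only [SkelAdj, h1, h2]
  refine ⟨H, ?_, ⟨hskel, ?_⟩, ?_⟩
  -- An arc of `G` entering `C` may be redirected to any node of `C`. Hence a walk in `H` that ends
  -- outside `C` becomes a walk in `G`, whatever it does inside `C`, and no cycle of `H` passes
  -- outside `C`.
  · have hwalk : ∀ {u v}, Relation.TransGen H.Adj u v → v ∉ C →
        (u ∉ C → Relation.TransGen G.Adj u v) ∧
        (u ∈ C → ∃ u' ∈ C, Relation.TransGen G.Adj u' v) := by
      intro u v huv hv
      induction huv using Relation.TransGen.head_induction_on with
      | single h =>
        have h' := (hHout fun h => hv h.2).1 h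
        exact ⟨fun _ => .single h', fun hu => ⟨_, hu, .single h'⟩⟩
      | @head a c hac hcv ih =>
        refine ⟨fun ha => ?_, fun ha => ?_⟩
        · have h' := (hHout fun h => ha h.1).1 hac
          by_cases hc : c ∈ C
          · obtain ⟨u', hu', hw⟩ := ih.2 hc
            exact .head (hout c hc u' hu' a ha h') hw
          · exact .head h' (ih.1 hc)
        · by_cases hc : c ∈ C
          · exact ih.2 hc
          · exact ⟨a, ha, .head ((hHout fun h => hc h.2).1 hac) (ih.1 hc)⟩
    have hcyc : ∀ v ∉ C, ¬ Relation.TransGen H.Adj v v := fun v hv h =>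
      hG v ((hwalk h hv).1 hv)
    -- A walk that never leaves `C` lowers the index in `M`, so it cannot close up either.
    have hins : ∀ {u v}, Relation.TransGen H.Adj u v → u ∈ C → v ∈ C →
        M.idxOf v < M.idxOf u ∨ ∃ w ∉ C, Relation.TransGen H.Adj u w ∧
          Relation.TransGen H.Adj w v := by
      intro u v huv hu hv
      induction huv using Relation.TransGen.head_induction_on with
      | single h => exact .inl ((hHin hu hv).1 h).2
      | @head a c hac hcv ih =>
        by_cases hc : c ∈ C
        · rcases ih hc with h | ⟨w, hw, h1, h2⟩
          · exact .inl (h.trans ((hHin hu hc).1 hac).2)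
          · exact .inr ⟨w, hw, .head hac h1, h2⟩
        · exact .inr ⟨c, hc, .single hac, hcv⟩
    intro v h
    by_cases hv : v ∈ C
    · rcases hins h hv hv with h' | ⟨w, hw, h1, h2⟩
      · exact lt_irrefl _ h'
      · exact hcyc w hw (h2.trans h1)
    · exact hcyc v hv h
  · have houtadj : ∀ {z x k}, z ∈ C → x ∈ C → k ∉ C → G.Adj k z → SkelAdj G k x :=
      fun hz hx hk h => .inl (hout _ hz _ hx _ hk h)
    intro x z w
    constructor
    · rintro ⟨hxw, hxz, hwz, hn⟩
      refine ⟨hxw, ?_, ?_, fun h => hn ((hskel _ _).2 h)⟩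
      · rw [hHout]
        · exact hxz
        · rintro ⟨hx, hz⟩
          by_cases hw : w ∈ C
          · exact hn (hin z hz x hx w hw hxw hxz hwz)
          · exact hn (houtadj hz hx hw hwz).symm
      · rw [hHout]
        · exact hwz
        · rintro ⟨hw, hz⟩
          by_cases hx : x ∈ C
          · exact hn (hin z hz x hx w hw hxw hxz hwz)
          · exact hn (houtadj hz hw hx hxz)
    · rintro ⟨hxw, hxz, hwz, hn⟩
      have hn' : ¬ SkelAdj G x w := fun h => hn ((hskel _ _).1 h)
      -- For `z ∈ C`, two parents of `z` in `H` that both lie in `C` are adjacent because `M` is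
      -- perfect, and a parent outside points to all of `C`. So a v-structure of `H` uses only arcs
      -- that were kept.
      have hboth : ¬ (x ∈ C ∧ z ∈ C) ∧ ¬ (w ∈ C ∧ z ∈ C) := by
        by_cases hz : z ∈ C
        · by_cases hx : x ∈ C
          · by_cases hw : w ∈ C
            · have h1 := (hHin hx hz).1 hxz
              have h2 := (hHin hw hz).1 hwz
              exact absurd (hM.idxOf ((hMC x).2 hx) ((hMC w).2 hw) h1.2 h2.2 hxw h1.1 h2.1) hn'
            · have h2 := (hHout fun h => hw h.1).1 hwz
              exact absurd (houtadj hz hx hw h2).symm hn'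
          · by_cases hw : w ∈ C
            · have h1 := (hHout fun h => hx h.1).1 hxz
              exact absurd (houtadj hz hw hx h1) hn'
            · exact ⟨fun h => hx h.1, fun h => hw h.1⟩
        · exact ⟨fun h => hz h.2, fun h => hz h.2⟩
      exact ⟨hxw, (hHout hboth.1).1 hxz, (hHout hboth.2).1 hwz, hn'⟩
  · rw [hHin hy hp]
    refine ⟨.inr hpy, ?_⟩
    have hpl : p ∉ l := by
      intro h
      exact List.disjoint_of_nodup_append hMd h (by simp)
    have hyl : y ∉ l := by
      intro h
      exact List.disjoint_of_nodup_append hMd h (by simp)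
    rw [hMdef, List.idxOf_append_of_notMem hpl, List.idxOf_append_of_notMem hyl,
      List.idxOf_cons_self, List.idxOf_cons_ne _ hne]
    omega

/-- `x` is a parent of `y` to which all other parents of `y` point, and `y` is a child of all
nodes in `K x`. -/
def Inherits (G : Digraph V) (K : V → Set V) (x y : V) : Prop :=
  G.Adj x y ∧ (∀ z, G.Adj z y → z ≠ x → G.Adj z x) ∧ ∀ z ∈ K x, G.Adj z y

/-- The recursion for the sets `K y` of the parents of `y` that are parents in all equivalent
DAGs. -/
def CompelledSpec (G : Digraph V) (K : V → Set V) : Prop :=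
  ∀ y, (∃ x, Inherits G K x y ∧ K y = K x) ∨ ((∀ x, ¬ Inherits G K x y) ∧ K y = parents G y)

/-- `b` is the node where the recursion for `y` ends. -/
inductive Base (G : Digraph V) (K : V → Set V) : V → V → Prop
  | refl (b : V) : (∀ x, ¬ Inherits G K x b) → K b = parents G b → Base G K b b
  | step {b x y : V} : Inherits G K x y → K y = K x → Base G K b x → Base G K b y

variable {K : V → Set V}

theorem CompelledSpec.exists_base [Finite V] (hG : IsDAG G) (hK : CompelledSpec G K) (y : V) :
    ∃ b, Base G K b y := by
  induction y using hG.wellFounded.induction with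
  | _ y ih =>
    rcases hK y with ⟨x, hx, hxy⟩ | ⟨h, hy⟩
    · obtain ⟨b, hb⟩ := ih x (.single hx.1)
      exact ⟨b, .step hx hxy hb⟩
    · exact ⟨y, .refl y h hy⟩

theorem Base.not_inherits {b y : V} (h : Base G K b y) : ∀ x, ¬ Inherits G K x b := by
  induction h with
  | refl h _ => exact h
  | step _ _ _ ih => exact ih

theorem Base.eq_parents {b y : V} (h : Base G K b y) : K y = parents G b := by
  induction h with
  | refl _ h => exact h
  | step _ hxy _ ih => rw [hxy, ih]

theorem Base.adj {b y z : V} (h : Base G K b y) (hz : G.Adj z b) : G.Adj z y := by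
  cases h with
  | refl => exact hz
  | step hx _ hb => exact hx.2.2 z (by rw [hb.eq_parents]; exact hz)

theorem Base.reach {b y : V} (h : Base G K b y) : Relation.ReflTransGen G.Adj b y := by
  induction h with
  | refl => exact .refl
  | step hx _ _ ih => exact .tail ih hx.1

/-- Along the recursion every parent of `y` is either the next node `x` or a parent of `x`. So the
class of `b` contains all the parents of its members other than the parents of `b`. -/
theorem Base.of_adj {b y z : V} (h : Base G K b y) (hz : G.Adj z y) (hzb : ¬ G.Adj z b) :
    Base G K b z := by
  induction h with
  | refl => exact absurd hz hzb
  | @step x y hx _ hb ih =>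
    by_cases hzx : z = x
    · rw [hzx]; exact hb
    · exact ih (hx.2.1 z hz hzx)

/-- Induction along the recursion for `z`: if one of the two parents is `x`, the other points to it;
otherwise both are parents of `x`. The descent cannot reach `b`, because `p` is a descendant of `b`
or `b` itself and hence not a parent of `b`. -/
theorem Base.clique (hG : IsDAG G) {b z p q : V} (h : Base G K b z) (hp : Base G K b p)
    (hpq : p ≠ q) (hpz : G.Adj p z) (hqz : G.Adj q z) : SkelAdj G p q := by
  induction h with
  | refl => exact (hG _ (Relation.TransGen.tail' hp.reach hpz)).elim
  | @step x y hx _ hb ih =>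
    by_cases hpx : p = x
    · subst hpx
      exact .inr (hx.2.1 q hqz hpq.symm)
    · by_cases hqx : q = x
      · subst hqx
        exact .inl (hx.2.1 p hpz hpq)
      · exact ih (hx.2.1 p hpz hpx) (hx.2.1 q hqz hqx)

/-- The parents in `K y` are parents of `y` in all equivalent DAGs. -/
theorem CompelledSpec.adj [Finite V] (hG : IsDAG G) (hK : CompelledSpec G K) {H : Digraph V}
    (hH : IsDAG H) (hGH : SameClass G H) (y : V) : ∀ p ∈ K y, H.Adj p y := by
  induction y using hG.wellFounded.induction with
  | _ y ih =>
    intro p hp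
    obtain ⟨b, hb⟩ := hK.exists_base hG y
    rw [hb.eq_parents] at hp
    have hpy := hb.adj hp
    have hcyc : ∀ {x}, G.Adj x b → Relation.TransGen G.Adj x y := fun h => .head' h hb.reach
    -- As `x` points to no other parent of `b`, it is the only one to which all the others can
    -- point.
    obtain ⟨x, hx, hmax⟩ := hG.exists_maximal (S := parents G b) ⟨p, hp⟩
    have hxy := hb.adj hx
    by_contra hnot
    have hyp : H.Adj y p := ((hGH.1 p y).1 (.inl hpy)).resolve_left hnot
    -- Otherwise `p → u → y → p` would be a cycle of `H`.
    have hchain : ∀ {u}, H.Adj u y → SkelAdj G u p → H.Adj u p := by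
      intro u hu hup
      refine ((hGH.1 u p).1 hup).resolve_right fun h => ?_
      exact hH u (.tail (.tail (.single hu) hyp) h)
    -- If all other parents of `b` point to `x`, then `b` fails to inherit only because some `w ∈ K
    -- x` is not a parent of `b`. By induction `w → x` in `H`, and `w` is not adjacent to `y`; a
    -- v-structure `w → x ← y` is impossible, so `x → y` in `H`. This settles `p = x`. Otherwise `x
    -- → p` in `H`, so `p ∉ K x`; hence `p` has the base of `x`, and `w → p` in `H` by induction,
    -- which gives the forbidden v-structure `w → p ← y`.
    by_cases hsink : ∀ z ∈ parents G b, z ≠ x → G.Adj z x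
    · obtain ⟨w, hw, hwb⟩ : ∃ w ∈ K x, ¬ G.Adj w b := by
        by_contra hcon
        push Not at hcon
        exact hb.not_inherits x ⟨hx, hsink, hcon⟩
      obtain ⟨b', hb'⟩ := hK.exists_base hG x
      have hwx : G.Adj w x := by
        rw [hb'.eq_parents] at hw
        exact hb'.adj hw
      have hHwx : H.Adj w x := ih x (hcyc hx) w hw
      -- An arc `w → y` would put `w` into the class of `b`, and `b` would reach `w → x → b`.
      have hwy : ¬ SkelAdj G w y := by
        rintro (h | h)
        · exact hG w (.head hwx (.head' hx (hb.of_adj h hwb).reach))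
        · exact hG w (.head hwx (.trans (hcyc hx) (.single h)))
      have hne : w ≠ y := by
        rintro rfl
        exact hG w (.head hwx (hcyc hx))
      have hHxy : H.Adj x y := by
        refine ((hGH.1 x y).1 (.inl hxy)).resolve_right fun h => ?_
        have hv : IsVStructure H w x y := ⟨hne, hHwx, h, fun h' => hwy ((hGH.1 _ _).2 h')⟩
        exact hG.not_symm hxy ((hGH.2 _ _ _).2 hv).2.2.1
      by_cases hpx : p = x
      · exact hnot (hpx ▸ hHxy)
      · have hpx' := hsink p hp hpx
        have hHxp : H.Adj x p := hchain hHxy (.inr hpx')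
        have hpK : p ∉ K x := fun h => hH.not_symm hHxp (ih x (hcyc hx) p h)
        have hbp : Base G K b' p := hb'.of_adj hpx' fun h => hpK (by rw [hb'.eq_parents]; exact h)
        have hwp : w ∈ K p := by rwa [hbp.eq_parents, ← hb'.eq_parents]
        have hHwp : H.Adj w p := ih p (hcyc hp) w hwp
        have hv : IsVStructure H w p y := ⟨hne, hHwp, hyp, fun h' => hwy ((hGH.1 _ _).2 h')⟩
        exact hG.not_symm hpy ((hGH.2 _ _ _).2 hv).2.2.1
    -- Here `x` and `z` are nonadjacent parents of `y`, so `x → y ← z` also in `H`. Both are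
    -- adjacent to `p`, since a v-structure with `p` at `y` would force `p → y` in `H`. So `x → p ←
    -- z` is a v-structure of `H`, hence of `G`, against the choice of `x`.
    · push Not at hsink
      obtain ⟨z, hz, hzx, hnzx⟩ := hsink
      have hzy := hb.adj hz
      have hnadj : ¬ SkelAdj G x z := by
        rintro (h | h)
        exacts [hmax z hz h, hnzx h]
      have hv : IsVStructure H x y z := (hGH.2 _ _ _).1 ⟨hzx.symm, hxy, hzy, hnadj⟩
      have hadj : ∀ {u}, G.Adj u y → u ≠ p → SkelAdj G u p := by
        intro u hu hup
        by_contra hcon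
        exact hnot ((hGH.2 _ _ _).1 ⟨hup, hu, hpy, hcon⟩).2.2.1
      have hxp : x ≠ p := by rintro rfl; exact hnot hv.2.1
      have hzp : z ≠ p := by rintro rfl; exact hnot hv.2.2.1
      have hvp : IsVStructure H x p z := ⟨hzx.symm, hchain hv.2.1 (hadj hxy hxp),
        hchain hv.2.2.1 (hadj hzy hzp), hv.2.2.2⟩
      exact hmax p hp ((hGH.2 _ _ _).2 hvp).2.1

/-- The arcs of the CPDAG: an arc of `G` can be reversed if and only if it is not compelled. -/
theorem CompelledSpec.cpdag_adj_iff [Finite V] (hG : IsDAG G) (hK : CompelledSpec G K) (x y : V) :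
    (cpdag G).Adj x y ↔ G.Adj x y ∨ (G.Adj y x ∧ y ∉ K x) := by
  constructor
  · rintro ⟨hxy, h⟩
    refine hxy.imp_right fun hyx => ⟨hyx, fun hK' => h fun H hH hGH => hK.adj hG hH hGH x y hK'⟩
  · rintro (hxy | ⟨hyx, hyK⟩)
    · exact ⟨.inl hxy, fun h => hG.not_symm hxy (h G hG ⟨fun _ _ => Iff.rfl, fun _ _ _ => Iff.rfl⟩)⟩
    · obtain ⟨b, hb⟩ := hK.exists_base hG x
      rw [hb.eq_parents] at hyK
      have hby : Base G K b y := hb.of_adj hyx hyK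
      -- All the members of the class have the parents of `b` as parents, and any other parent lies
      -- in the class.
      obtain ⟨H, hH, hGH, hxy⟩ := hG.exists_reversal (C := {z | Base G K b z})
        (fun z hz z' hz' k hk hkz => hz'.adj (by
          by_contra hcon
          exact hk (Base.of_adj hz hkz hcon)))
        (fun z hz p hp q _ hpq => Base.clique hG hz hp hpq) (p := y) (y := x) hby hb hyx
      exact ⟨.inr hyx, fun h => hH.not_symm hxy (h H hH hGH)⟩

end Compelled

/-! ### Computing the compelled arcs -/

section Bases

notation "aSink" => 40
notation "vHas" => 41
notation "aBase" => 42
notation "aDone" => 43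
notation "vCur" => 44
notation "vStep" => 45

/-- Entry of a one-dimensional array. -/
abbrev entryAt (a : ℕ) (e : NExpr) : NExpr := .get a e (.const 0)

/-- Sets `vOk` to `0` unless all parents of `vB` other than `vA` are parents of `vA`. -/
def sinkCheck : Program :=
  forLoop vC eN
    (.ite (.and (.natEq (.get aGraph (var vC) (var vB)) (.const 1))
        (.and (.not (.natEq (var vC) (var vA)))
          (.natEq (.get aGraph (var vC) (var vA)) (.const 0))))
      (assign vOk (.const 0)) .skip)

/-- Treats the possible parent `vA` of `vB`. -/
def sinkStep : Program :=
  .ite (.natEq (.get aGraph (var vA) (var vB)) (.const 1))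
    (assign vHas (.const 1) ⨟ assign vOk (.const 1) ⨟ sinkCheck ⨟
      .ite (.and (.natEq (var vOk) (.const 1)) (.natEq (entryAt aConf (var vB)) (.const 0)))
        (.setNat aSink (var vB) (.const 0) (var vA)) .skip)
    .skip

/-- Determines for each node the parent to which all its other parents point. -/
def findSinks : Program :=
  forLoop vB eN
    (.setNat aSink (var vB) (.const 0) (var vB) ⨟
      .setNat aDone (var vB) (.const 0) (.const 0) ⨟
      assign vHas (.const 0) ⨟
      forLoop vA eN sinkStep ⨟
      .ite (.and (.natEq (entryAt aConf (var vB)) (.const 1)) (.natEq (var vHas) (.const 0)))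
        (.setNat aSink (var vB) (.const 0) eN) .skip)

variable {n : ℕ} {G : Digraph (Fin n)} {L : List (Triangle n)}

/-- The memory holds the number of variables and the collected triangles. -/
structure Env (G : Digraph (Fin n)) (L : List (Triangle n)) (s : State) : Prop where
  n_eq : s.nat 0 0 0 = n
  holds : Holds G L s

/-- `p` does not change the number of variables and the collected triangles. -/
def Program.keepsEnv (p : Program) : Bool :=
  !(p.writesNat 0 || p.writesNat 4 || p.writesNat 5 || p.writesNat aGraph || p.writesNat aConf)

theorem Env.agree {s s' : State} {p : Program} (hs : Env G L s) (hA : Agree p s s')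
    (hp : p.keepsEnv = true) : Env G L s' := by
  simp only [Program.keepsEnv, Bool.not_eq_true', Bool.or_eq_false_iff] at hp
  obtain ⟨⟨⟨⟨h0, h4⟩, h5⟩, h7⟩, h8⟩ := hp
  exact ⟨by rw [hA.1 _ h0]; exact hs.n_eq,
    hs.holds.of_eq (hA.1 _ h4) (hA.1 _ h5) (hA.1 _ h7) (hA.1 _ h8)⟩

/-- The arcs that remain when the triangles in `L` have been treated. -/
abbrev Arc (G : Digraph (Fin n)) (L : List (Triangle n)) (x y : Fin n) : Prop :=
  RemainingArc G {T | T ∈ L} x y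

open Classical in
/-- The number of confounders above `x`. -/
noncomputable abbrev numConf (L : List (Triangle n)) (x : Fin n) : ℕ :=
  L.countP fun T => T.A = x ∨ T.B = x

theorem Env.arc_iff {s : State} (hs : Env G L s) (x y : Fin n) :
    s.nat aGraph x y = 1 ↔ Arc G L x y := by
  rw [hs.holds.arc x y]
  split_ifs with h <;> simp [h]

theorem Env.arc_zero {s : State} (hs : Env G L s) (x y : Fin n) :
    s.nat aGraph x y = 0 ↔ ¬ Arc G L x y := by
  rw [hs.holds.arc x y]
  split_ifs with h <;> simp [h]

/-- `x` is a parent of `y` to which all the other parents point. -/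
def IsSink (G : Digraph (Fin n)) (L : List (Triangle n)) (x y : Fin n) : Prop :=
  Arc G L x y ∧ ∀ z, Arc G L z y → z ≠ x → Arc G L z x

/-- The meaning of the entry `v` of the array of sinks at `y`. -/
def SinkSpec (G : Digraph (Fin n)) (L : List (Triangle n)) (y : Fin n) (v : ℕ) : Prop :=
  (∃ x : Fin n, numConf L y = 0 ∧ IsSink G L x y ∧ v = x) ∨
  (numConf L y = 1 ∧ (∀ x, ¬ Arc G L x y) ∧ v = n) ∨
  (v = y ∧ (numConf L y = 0 → ∀ x, ¬ IsSink G L x y) ∧ (numConf L y = 1 → ∃ x, Arc G L x y))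

theorem forall_lt_succ_fin {P : Fin n → Prop} {i : ℕ} (hi : i < n) :
    (∀ z : Fin n, z.val < i + 1 → P z) ↔ (∀ z : Fin n, z.val < i → P z) ∧ P ⟨i, hi⟩ := by
  constructor
  · exact fun h => ⟨fun z hz => h z (by omega), h _ (by simp)⟩
  · rintro ⟨h, hP⟩ z hz
    rcases Nat.lt_succ_iff_lt_or_eq.1 hz with hz | hz
    · exact h z hz
    · rwa [show z = ⟨i, hi⟩ from Fin.ext hz]

theorem runs_sinkCheck {s : State} (hs : Env G L s) {x y : Fin n} (hx : s.nat vA 0 0 = x)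
    (hy : s.nat vB 0 0 = y) (hok : s.nat vOk 0 0 = 1) :
    Runs sinkCheck s (n * 60 + 12)
      (fun s' => s'.nat vOk 0 0 = 1 ↔ ∀ z, Arc G L z y → z ≠ x → Arc G L z x) := by
  refine (Runs.for_const (N := n) (T := 44) (fun i s' => s'.nat vOk 0 0 = 1 ↔
      ∀ z : Fin n, z.val < i → (Arc G L z y → z ≠ x → Arc G L z x))
    rfl (by simp [NExpr.cost]) ?_ ?_ (by simp [hok]) ?_ le_rfl).mono le_rfl ?_
  · exact fun s' hA => (hs.agree hA rfl).n_eq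
  · intro i s' v hI
    simpa using hI
  · intro i hi s' As hv hI
    have hE := hs.agree As rfl
    have xs : s'.nat vA 0 0 = x := by rw [As.1 vA rfl, hx]
    have ys : s'.nat vB 0 0 = y := by rw [As.1 vB rfl, hy]
    have ht : (Test.and (.natEq (.get aGraph (var vC) (var vB)) (.const 1))
        (.and (.not (.natEq (var vC) (var vA)))
          (.natEq (.get aGraph (var vC) (var vA)) (.const 0)))).Holds s' ↔
        ¬ (Arc G L ⟨i, hi⟩ y → (⟨i, hi⟩ : Fin n) ≠ x → Arc G L ⟨i, hi⟩ x) := by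
      have h1 := hE.arc_iff ⟨i, hi⟩ y
      have h2 := hE.arc_zero ⟨i, hi⟩ x
      simp only [Test.Holds, NExpr.eval, hv, xs, ys, h1, h2, Fin.ext_iff, ne_eq]
      tauto
    refine Runs.of_wp (by simp [Program.maxCost, Test.cost, NExpr.cost]) ?_
    rw [wp_ite_iff, ht]
    refine ⟨fun h => ?_, fun h => ?_⟩
    · simp only [Program.wp, NExpr.eval, State.setNat_nat_self, and_self, if_true, zero_ne_one,
        false_iff, forall_lt_succ_fin hi]
      exact fun h' => h h'.2
    · simp only [Program.wp, hI, forall_lt_succ_fin hi]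
      exact ⟨fun h' => ⟨h', not_not.1 h⟩, fun h' => h'.1⟩
  · intro s' _ hI
    simpa using hI

/-- The invariant of the loop over the possible parents of `y`. -/
def SinkInv (G : Digraph (Fin n)) (L : List (Triangle n)) (y : Fin n) (i : ℕ) (s : State) : Prop :=
  (s.nat vHas 0 0 = 0 ↔ ∀ x : Fin n, x.val < i → ¬ Arc G L x y) ∧
  ((∃ x : Fin n, numConf L y = 0 ∧ IsSink G L x y ∧ s.nat aSink y 0 = x) ∨
    (s.nat aSink y 0 = y ∧ (numConf L y = 0 → ∀ x : Fin n, x.val < i → ¬ IsSink G L x y)))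

open Classical in
theorem runs_sinkStep {s : State} (hs : Env G L s) {y : Fin n} {i : ℕ} (hi : i < n)
    (hx : s.nat vA 0 0 = i) (hy : s.nat vB 0 0 = y) (hI : SinkInv G L y i s) :
    Runs sinkStep s (20 + if Arc G L ⟨i, hi⟩ y then n * 60 + 80 else 0) (fun s' =>
      SinkInv G L y (i + 1) s' ∧ ∀ z : ℕ, z ≠ y → s'.nat aSink z 0 = s.nat aSink z 0) := by
  have ht : (Test.natEq (.get aGraph (var vA) (var vB)) (.const 1)).Holds s ↔
      Arc G L ⟨i, hi⟩ y := by
    have h1 := hs.arc_iff ⟨i, hi⟩ y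
    simpa only [Test.Holds, NExpr.eval, hx, hy] using h1
  by_cases harc : Arc G L ⟨i, hi⟩ y
  · rw [if_pos harc]
    refine Runs.ite (T := n * 60 + 80) (fun _ => ?_) (fun h => absurd (ht.2 harc) h)
      (by simp only [Test.cost, NExpr.cost]; omega)
    have hset : Runs (assign vHas (.const 1) ⨟ assign vOk (.const 1)) s 8
        (fun s' => s'.nat vHas 0 0 = 1 ∧ s'.nat vOk 0 0 = 1) := by
      refine Runs.of_wp (by simp [Program.maxCost, NExpr.cost]) ?_
      simp [Program.wp, NExpr.eval]
    refine (hset.seq (T₂ := n * 60 + 72) ?_ (by omega)).assoc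
    rintro s1 A1 ⟨h1, o1⟩
    have x1 : s1.nat vA 0 0 = i := by rw [A1.1 vA rfl, hx]
    have y1 : s1.nat vB 0 0 = y := by rw [A1.1 vB rfl, hy]
    refine (runs_sinkCheck (hs.agree A1 rfl) (x := ⟨i, hi⟩) x1 y1 o1).seq (T₂ := 60) ?_ (by omega)
    intro s2 A2 o2
    have hE2 : Env G L s2 := (hs.agree A1 rfl).agree A2 rfl
    have x2 : s2.nat vA 0 0 = i := by rw [A2.1 vA rfl, x1]
    have y2 : s2.nat vB 0 0 = y := by rw [A2.1 vB rfl, y1]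
    have k2 : s2.nat aSink = s.nat aSink := by rw [A2.1 aSink rfl, A1.1 aSink rfl]
    have h2 : s2.nat vHas 0 0 = 1 := by rw [A2.1 vHas rfl, h1]
    have ht2 : (Test.and (.natEq (var vOk) (.const 1))
        (.natEq (entryAt aConf (var vB)) (.const 0))).Holds s2 ↔
        IsSink G L ⟨i, hi⟩ y ∧ numConf L y = 0 := by
      simp only [Test.Holds, NExpr.eval, y2, o2, hE2.holds.conf, IsSink, harc, true_and]
    have hhas : ¬ ∀ x : Fin n, x.val < i + 1 → ¬ Arc G L x y := fun h =>
      h ⟨i, hi⟩ (by simp) harc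
    refine Runs.of_wp (by simp [Program.maxCost, Test.cost, NExpr.cost]) ?_
    rw [wp_ite_iff, ht2]
    refine ⟨fun h => ⟨⟨?_, .inl ⟨⟨i, hi⟩, h.2, h.1, ?_⟩⟩, ?_⟩, fun h => ⟨⟨?_, ?_⟩, ?_⟩⟩
    · simp [h2]
      simpa using hhas
    · simp [NExpr.eval, x2, y2]
    · intro z hz
      simp [NExpr.eval, y2, hz, k2]
    · simp only [h2, one_ne_zero, false_iff]
      exact hhas
    · rw [k2]
      refine hI.2.imp id ?_
      rintro ⟨hy', hI'⟩
      refine ⟨hy', fun hc => ?_⟩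
      rw [forall_lt_succ_fin hi]
      exact ⟨hI' hc, fun h' => h ⟨h', hc⟩⟩
    · intro z hz
      rw [k2]
  · rw [if_neg harc]
    refine Runs.ite (T := 1) (fun h => absurd (ht.1 h) harc)
      (fun _ => Runs.of_wp le_rfl ⟨⟨?_, ?_⟩, fun _ _ => rfl⟩)
      (by simp [Test.cost, NExpr.cost])
    · rw [hI.1, forall_lt_succ_fin hi]
      simp only [harc, not_false_eq_true, and_true]
    · refine hI.2.imp id ?_
      rintro ⟨hy', hI'⟩
      refine ⟨hy', fun hc => ?_⟩
      rw [forall_lt_succ_fin hi]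
      exact ⟨hI' hc, fun h' => harc h'.1⟩

theorem ncard_arc_le (G : Digraph (Fin n)) (L : List (Triangle n)) (y : Fin n) :
    {x | Arc G L x y}.ncard ≤ maxDegree G :=
  (Set.ncard_le_ncard fun _ hx => hx.1).trans (ncard_parents_le G y)

open Classical in
theorem runs_findSinks {s : State} (hs : Env G L s) :
    Runs findSinks s (n * (n * 36 + maxDegree G * (n * 60 + 80) + 100) + 12) (fun s' =>
      ∀ y : Fin n, SinkSpec G L y (s'.nat aSink y 0) ∧ s'.nat aDone y 0 = 0) := by
  refine (Runs.for_const (N := n) (T := n * 36 + maxDegree G * (n * 60 + 80) + 84)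
    (fun i s' => ∀ y : Fin n, y.val < i → SinkSpec G L y (s'.nat aSink y 0) ∧ s'.nat aDone y 0 = 0)
    rfl (by simp [NExpr.cost]) ?_ ?_ (by simp) ?_ (by simp [add_assoc])).mono le_rfl
    (fun s' _ hI y => hI y y.2)
  · exact fun s' hA => (hs.agree hA rfl).n_eq
  · intro i s' v hI
    simpa using hI
  · intro i hi s' As hv hI
    have hE := hs.agree As rfl
    have hset : Runs ((.setNat aSink (var vB) (.const 0) (var vB) ⨟
        .setNat aDone (var vB) (.const 0) (.const 0)) ⨟ assign vHas (.const 0)) s' 20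
        (fun t => t.nat vHas 0 0 = 0 ∧ t.nat aSink i 0 = i ∧ t.nat aDone i 0 = 0 ∧
          ∀ z : ℕ, z ≠ i → t.nat aSink z 0 = s'.nat aSink z 0 ∧
            t.nat aDone z 0 = s'.nat aDone z 0) := by
      refine Runs.of_wp (by simp [Program.maxCost, NExpr.cost]) ?_
      simp only [Program.wp, NExpr.eval]
      refine ⟨by simp, by simp [hv], by simp [hv], fun z hz => ?_⟩
      simp [hv, hz]
    refine (hset.seq (T₂ := n * 36 + maxDegree G * (n * 60 + 80) + 64) ?_ (by omega)).assoc.assoc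
    rintro s1 A1 ⟨h1, k1, d1, f1⟩
    have hE1 : Env G L s1 := hE.agree A1 rfl
    have b1 : s1.nat vB 0 0 = i := by rw [A1.1 vB rfl, hv]
    have hloop : Runs (forLoop vA eN sinkStep) s1 (n * 36 + maxDegree G * (n * 60 + 80) + 12)
        (fun t => SinkInv G L ⟨i, hi⟩ n t ∧
          ∀ z : ℕ, z ≠ i → t.nat aSink z 0 = s1.nat aSink z 0) := by
      refine (Runs.for (N := n) (T := fun j => 20 + if ∃ hj : j < n, Arc G L ⟨j, hj⟩ ⟨i, hi⟩ then
          n * 60 + 80 else 0) (fun j t => SinkInv G L ⟨i, hi⟩ j t ∧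
          ∀ z : ℕ, z ≠ i → t.nat aSink z 0 = s1.nat aSink z 0) rfl (by simp [NExpr.cost])
          ?_ ?_ ?_ ?_).mono ?_ fun _ _ h => h
      · exact fun s' hA => (hE1.agree hA rfl).n_eq
      · intro j t v hI
        simpa [SinkInv] using hI
      · exact ⟨⟨by simp [h1], .inr ⟨k1, by simp⟩⟩, fun _ _ => rfl⟩
      · rintro j hj t At hvt ⟨It, ft⟩
        have := runs_sinkStep (hE1.agree At rfl) hj hvt (y := ⟨i, hi⟩)
          (by rw [At.1 vB rfl, b1]) It
        refine this.mono (by simp [hj]) ?_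
        rintro t' - ⟨It', ft'⟩
        exact ⟨It', fun z hz => (ft' z hz).trans (ft z hz)⟩
      -- The inner scan is made only for actual arcs, at most `k` of them for each node, so that the
      -- total is `O(n² k)`.
      · have := sum_ite_le (ncard_arc_le G L ⟨i, hi⟩) 36 (n * 60 + 80)
        simp only [add_right_comm _ _ 16] at this ⊢
        simp only [Nat.reduceAdd]
        omega
    refine hloop.seq (T₂ := 40) ?_ (by omega)
    rintro s2 A2 ⟨I2, f2⟩
    have hE2 : Env G L s2 := hE1.agree A2 rfl
    have b2 : s2.nat vB 0 0 = i := by rw [A2.1 vB rfl, b1]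
    have d2 : s2.nat aDone = s1.nat aDone := A2.1 aDone rfl
    have hconf : s2.nat aConf i 0 = numConf L ⟨i, hi⟩ := hE2.holds.conf ⟨i, hi⟩
    have ht : (Test.and (.natEq (entryAt aConf (var vB)) (.const 1))
        (.natEq (var vHas) (.const 0))).Holds s2 ↔
        numConf L ⟨i, hi⟩ = 1 ∧ ∀ x, ¬ Arc G L x ⟨i, hi⟩ := by
      simp only [Test.Holds, NExpr.eval, b2, hconf, I2.1]
      simp
    refine Runs.of_wp (by simp [Program.maxCost, Test.cost, NExpr.cost]) ?_
    rw [wp_ite_iff, ht]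
    refine ⟨fun h => ?_, fun h => ?_⟩
    · intro y hy
      by_cases hyi : y.val = i
      · have : y = ⟨i, hi⟩ := Fin.ext hyi
        subst this
        refine ⟨.inr (.inl ⟨h.1, h.2, ?_⟩), ?_⟩
        · simp [NExpr.eval, b2, hE2.n_eq]
        · simp [d2, d1]
      · have := hI y (by omega)
        simpa [NExpr.eval, b2, hyi, d2, f2 y hyi, f1 y hyi] using this
    · intro y hy
      by_cases hyi : y.val = i
      · have : y = ⟨i, hi⟩ := Fin.ext hyi
        subst this
        refine ⟨?_, by rw [d2, d1]⟩
        rcases I2.2 with h' | ⟨h1', h2'⟩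
        · exact .inl h'
        · refine .inr (.inr ⟨h1', fun hc x => h2' hc x x.2, fun hc => ?_⟩)
          by_contra hcon
          push Not at hcon
          exact h ⟨hc, hcon⟩
      · have := hI y (by omega)
        simpa [d2, f2 y hyi, f1 y hyi] using this

end Bases

/-! ### The bases of all nodes, one per round -/

section BaseRounds

/-- Finds a node that is not done, and that has no sink or whose sink is done. -/
def pickNode : Program :=
  forLoop vB eN
    (.ite (.and (.natEq (entryAt aDone (var vB)) (.const 0))
        (.not (.and (.not (.natEq (entryAt aSink (var vB)) (var vB)))
          (.not (.natEq (entryAt aDone (entryAt aSink (var vB))) (.const 1))))))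
      (assign vCur (var vB)) .skip)

/-- The base of the sink of the current node. -/
abbrev eSinkBase : NExpr := entryAt aBase (entryAt aSink (var vCur))

/-- Determines whether the current node inherits the base of its sink. -/
def inheritTest : Program :=
  assign vOk (.const 1) ⨟
  .ite (.natEq (entryAt aSink (var vCur)) (var vCur)) (assign vOk (.const 0))
    (.ite (.natEq (entryAt aConf eSinkBase) (.const 0))
      (forLoop vA eN
        (.ite (.and (.natEq (.get aGraph (var vA) eSinkBase) (.const 1))
            (.natEq (.get aGraph (var vA) (var vCur)) (.const 0)))
          (assign vOk (.const 0)) .skip))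
      (assign vOk (.const 0)))

/-- Treats one more node. -/
def baseRound : Program :=
  pickNode ⨟ inheritTest ⨟
  .ite (.natEq (var vOk) (.const 1)) (.setNat aBase (var vCur) (.const 0) eSinkBase)
    (.setNat aBase (var vCur) (.const 0) (var vCur)) ⨟
  .setNat aDone (var vCur) (.const 0) (.const 1)

/-- Determines the bases of all nodes. -/
def computeBases : Program :=
  .setNat aDone eN (.const 0) (.const 1) ⨟
  .setNat aBase eN (.const 0) eN ⨟
  forLoop vStep eN baseRound

variable {n : ℕ} {G : Digraph (Fin n)} {L : List (Triangle n)}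

/-- The arcs to the node with number `b`; there are none if `b` is not a node. -/
def ArcTo (G : Digraph (Fin n)) (L : List (Triangle n)) (z : Fin n) (b : ℕ) : Prop :=
  ∃ hb : b < n, Arc G L z ⟨b, hb⟩

/-- The number of confounders above the node with number `b`. -/
noncomputable def confAt (L : List (Triangle n)) (b : ℕ) : ℕ :=
  if hb : b < n then numConf L ⟨b, hb⟩ else 0

theorem Env.arcTo_iff {s : State} (hs : Env G L s) (x : Fin n) {b : ℕ} (hb : b ≤ n) :
    s.nat aGraph x b = 1 ↔ ArcTo G L x b := by
  rcases Nat.lt_or_eq_of_le hb with hb | rfl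
  · rw [hs.arc_iff x ⟨b, hb⟩]
    simp [ArcTo, hb]
  · simp [hs.holds.last, ArcTo]

theorem Env.arcTo_zero {s : State} (hs : Env G L s) (x : Fin n) {b : ℕ} (hb : b ≤ n) :
    s.nat aGraph x b = 0 ↔ ¬ ArcTo G L x b := by
  rcases Nat.lt_or_eq_of_le hb with hb | rfl
  · rw [hs.arc_zero x ⟨b, hb⟩]
    simp [ArcTo, hb]
  · simp [hs.holds.last, ArcTo]

theorem Env.confAt_eq {s : State} (hs : Env G L s) {b : ℕ} (hb : b ≤ n) :
    s.nat aConf b 0 = confAt L b := by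
  rcases Nat.lt_or_eq_of_le hb with hb | rfl
  · rw [confAt, dif_pos hb]
    exact hs.holds.conf ⟨b, hb⟩
  · simp [confAt, hs.holds.confLast]

/-- The node `y` inherits the base `b` of its sink. -/
def Takes (G : Digraph (Fin n)) (L : List (Triangle n)) (y : Fin n) (v b : ℕ) : Prop :=
  v ≠ y ∧ confAt L b = 0 ∧ ∀ z, ArcTo G L z b → Arc G L z y

/-- The recursion for the base of the node `y`. -/
def BaseSpec (G : Digraph (Fin n)) (L : List (Triangle n)) (sink base : ℕ → ℕ) (y : Fin n) : Prop :=
  base y ≤ n ∧ ((Takes G L y (sink y) (base (sink y)) ∧ base y = base (sink y)) ∨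
    (¬ Takes G L y (sink y) (base (sink y)) ∧ base y = y))

/-- The node `y` can be treated next. -/
def Eligible (s : State) (y : Fin n) : Prop :=
  s.nat aDone y 0 = 0 ∧ (s.nat aSink y 0 = y ∨ s.nat aDone (s.nat aSink y 0) 0 = 1)

theorem runs_pickNode {s : State} (hs : Env G L s) (hex : ∃ y : Fin n, Eligible s y) :
    Runs pickNode s (n * 60 + 12) (fun s' => ∃ y : Fin n, Eligible s y ∧ s'.nat vCur 0 0 = y) := by
  refine (Runs.for_const (N := n) (T := 44) (fun i s' =>
      (∃ y : Fin n, Eligible s y ∧ s'.nat vCur 0 0 = y) ∨ ∀ y : Fin n, y.val < i → ¬ Eligible s y)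
    rfl (by simp [NExpr.cost]) ?_ ?_ (by simp) ?_ le_rfl).mono le_rfl ?_
  · exact fun s' hA => (hs.agree hA rfl).n_eq
  · intro i s' v hI
    simpa using hI
  · intro i hi s' As hv hI
    have ht : (Test.and (.natEq (entryAt aDone (var vB)) (.const 0))
        (.not (.and (.not (.natEq (entryAt aSink (var vB)) (var vB)))
          (.not (.natEq (entryAt aDone (entryAt aSink (var vB))) (.const 1)))))).Holds s' ↔
        Eligible s ⟨i, hi⟩ := by
      simp only [Test.Holds, NExpr.eval, hv, As.1 aDone rfl, As.1 aSink rfl, Eligible]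
      tauto
    refine Runs.of_wp (by simp [Program.maxCost, Test.cost, NExpr.cost]) ?_
    rw [wp_ite_iff, ht]
    refine ⟨fun h => .inl ⟨⟨i, hi⟩, h, ?_⟩, fun h => ?_⟩
    · simp [NExpr.eval, hv]
    · refine hI.imp id fun hI => ?_
      rw [forall_lt_succ_fin hi]
      exact ⟨hI, h⟩
  · intro s' _ hI
    refine hI.resolve_right fun h => ?_
    obtain ⟨y, hy⟩ := hex
    exact h y y.2 hy

theorem runs_inheritTest {s : State} (hs : Env G L s) {y : Fin n} (hy : s.nat vCur 0 0 = y)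
    (hb : s.nat aSink y 0 ≠ y → s.nat aBase (s.nat aSink y 0) 0 ≤ n) :
    Runs inheritTest s (n * 60 + 70) (fun s' => s'.nat vOk 0 0 = 1 ↔
      Takes G L y (s.nat aSink y 0) (s.nat aBase (s.nat aSink y 0) 0)) := by
  have hset : Runs (assign vOk (.const 1)) s 4 (fun s' => s'.nat vOk 0 0 = 1) := by
    refine Runs.of_wp (by simp [Program.maxCost, NExpr.cost]) ?_
    simp [Program.wp, NExpr.eval]
  refine hset.seq (T₂ := n * 60 + 60) ?_ (by omega)
  intro s1 A1 o1
  have hE1 : Env G L s1 := hs.agree A1 rfl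
  have y1 : s1.nat vCur 0 0 = y := by rw [A1.1 vCur rfl, hy]
  have k1 : s1.nat aSink = s.nat aSink := A1.1 aSink rfl
  have b1 : s1.nat aBase = s.nat aBase := A1.1 aBase rfl
  refine Runs.ite (T := n * 60 + 40) (fun h => ?_) (fun h => ?_)
    (by simp only [Test.cost, NExpr.cost]; omega)
  · simp only [Test.Holds, NExpr.eval, y1, k1] at h
    refine Runs.of_wp (by simp only [Program.maxCost, NExpr.cost]; omega) ?_
    simp [Program.wp, NExpr.eval, Takes, h]
  simp only [Test.Holds, NExpr.eval, y1, k1] at h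
  have hbn := hb h
  refine Runs.ite (T := n * 60 + 12) (fun h' => ?_) (fun h' => ?_)
    (by simp only [Test.cost, NExpr.cost]; omega)
  swap
  · simp only [Test.Holds, NExpr.eval, y1, k1, b1, hE1.confAt_eq hbn] at h'
    refine Runs.of_wp (by simp only [Program.maxCost, NExpr.cost]; omega) ?_
    simp [Program.wp, NExpr.eval, Takes, h']
  simp only [Test.Holds, NExpr.eval, y1, k1, b1, hE1.confAt_eq hbn] at h'
  simp only [Takes, ne_eq, h, not_false_eq_true, h', true_and]
  generalize hbdef : s.nat aBase (s.nat aSink y 0) 0 = b at *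
  refine (Runs.for_const (N := n) (T := 44) (fun i s' => s'.nat vOk 0 0 = 1 ↔
      ∀ z : Fin n, z.val < i → (ArcTo G L z b → Arc G L z y))
    rfl (by simp [NExpr.cost]) ?_ ?_ (by simp [o1]) ?_ le_rfl).mono le_rfl ?_
  · exact fun s' hA => (hE1.agree hA rfl).n_eq
  · intro i s' v hI
    simpa using hI
  · intro i hi s' As hv hI
    have hE := hE1.agree As rfl
    have ys : s'.nat vCur 0 0 = y := by rw [As.1 vCur rfl, y1]
    have ht : (Test.and (.natEq (.get aGraph (var vA) eSinkBase) (.const 1))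
            (.natEq (.get aGraph (var vA) (var vCur)) (.const 0))).Holds s' ↔
        ¬ (ArcTo G L ⟨i, hi⟩ b → Arc G L ⟨i, hi⟩ y) := by
      have h1 := hE.arcTo_iff ⟨i, hi⟩ hbn
      have h2 := hE.arc_zero ⟨i, hi⟩ y
      simp only [Test.Holds, NExpr.eval, hv, ys, As.1 aSink rfl, As.1 aBase rfl, k1, b1, hbdef, h1,
        h2]
      tauto
    refine Runs.of_wp (by simp [Program.maxCost, Test.cost, NExpr.cost]) ?_
    rw [wp_ite_iff, ht]
    refine ⟨fun h => ?_, fun h => ?_⟩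
    · simp only [Program.wp, NExpr.eval, State.setNat_nat_self, and_self, if_true, zero_ne_one,
        false_iff, forall_lt_succ_fin hi]
      exact fun h' => h h'.2
    · simp only [Program.wp, hI, forall_lt_succ_fin hi]
      exact ⟨fun h' => ⟨h', not_not.1 h⟩, fun h' => h'.1⟩
  · intro s' _ hI
    simpa using hI

/-- The invariant of the rounds: the nodes in `S` are done. -/
structure RoundInv (G : Digraph (Fin n)) (L : List (Triangle n)) (S : Finset (Fin n)) (s : State) :
    Prop where
  sink : ∀ y : Fin n, SinkSpec G L y (s.nat aSink y 0)
  done : ∀ y : Fin n, s.nat aDone y 0 = if y ∈ S then 1 else 0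
  doneLast : s.nat aDone n 0 = 1
  baseLast : s.nat aBase n 0 = n
  -- The sink of a done node is done or is the dummy, so later rounds do not alter the base from
  -- which that node was computed.
  closed : ∀ y ∈ S, s.nat aSink y 0 = n ∨ ∃ x ∈ S, s.nat aSink y 0 = x.val
  base : ∀ y ∈ S, BaseSpec G L (fun v => s.nat aSink v 0) (fun v => s.nat aBase v 0) y

/-- A node that is not done and has no ancestor in `G` of this kind: its sink is a parent, hence
done, or the dummy, which is done from the start, or the node itself. -/
theorem RoundInv.exists_eligible (hG : IsDAG G) {S : Finset (Fin n)} {s : State}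
    (hI : RoundInv G L S s) (hS : S.card < n) : ∃ y : Fin n, Eligible s y := by
  have hne : {y | y ∉ S}.Nonempty := by
    by_contra hcon
    have : S = Finset.univ := by
      ext y
      simp only [Finset.mem_univ, iff_true]
      by_contra hy
      exact hcon ⟨y, hy⟩
    rw [this, Finset.card_univ, Fintype.card_fin] at hS
    omega
  obtain ⟨y, hy, hmin⟩ := hG.wellFounded.has_min _ hne
  refine ⟨y, ?_, ?_⟩
  · rw [hI.done, if_neg hy]
  · rcases hI.sink y with ⟨x, -, hx, hv⟩ | ⟨-, -, hv⟩ | ⟨hv, -⟩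
    · refine .inr ?_
      rw [hv, hI.done, if_pos]
      by_contra hxS
      exact hmin x hxS (.single hx.1.1)
    · refine .inr ?_
      rw [hv, hI.doneLast]
    · exact .inl hv

theorem runs_baseRound (hG : IsDAG G) {S : Finset (Fin n)} {s : State} (hs : Env G L s)
    (hI : RoundInv G L S s) (hS : S.card < n) :
    Runs baseRound s (n * 120 + 130) (fun s' => ∃ S' : Finset (Fin n), S'.card = S.card + 1 ∧
      RoundInv G L S' s') := by
  refine (runs_pickNode hs (hI.exists_eligible hG hS)).seq (T₂ := n * 60 + 118) ?_ (by omega)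
  rintro s1 A1 ⟨y, hy, c1⟩
  have hE1 : Env G L s1 := hs.agree A1 rfl
  have k1 : s1.nat aSink = s.nat aSink := A1.1 aSink rfl
  have b1 : s1.nat aBase = s.nat aBase := A1.1 aBase rfl
  have hyS : y ∉ S := by
    intro h
    have := hy.1
    rw [hI.done, if_pos h] at this
    omega
  have hsink : s.nat aSink y 0 = y ∨ s.nat aSink y 0 = n ∨ ∃ x ∈ S, s.nat aSink y 0 = x.val := by
    refine hy.2.imp id fun hd => ?_
    rcases hI.sink y with ⟨x, -, hx, hv⟩ | ⟨-, -, hv⟩ | ⟨hv, -⟩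
    · refine .inr ⟨x, ?_, hv⟩
      rw [hv, hI.done] at hd
      by_contra hxS
      simp [hxS] at hd
    · exact .inl hv
    · rw [hv, hI.done, if_neg hyS] at hd
      omega
  have hle : s.nat aSink y 0 ≠ y → s.nat aBase (s.nat aSink y 0) 0 ≤ n := by
    intro hne
    rcases hsink with h | h | ⟨x, hx, h⟩
    · exact absurd h hne
    · rw [h, hI.baseLast]
    · rw [h]
      exact (hI.base x hx).1
  refine (runs_inheritTest hE1 c1 (by rw [k1, b1]; exact hle)).seq (T₂ := 48) ?_ (by omega)
  intro s2 A2 o2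
  rw [k1, b1] at o2
  have c2 : s2.nat vCur 0 0 = y := by rw [A2.1 vCur rfl, c1]
  have k2 : s2.nat aSink = s.nat aSink := by rw [A2.1 aSink rfl, k1]
  have b2 : s2.nat aBase = s.nat aBase := by rw [A2.1 aBase rfl, b1]
  have d2 : s2.nat aDone = s.nat aDone := by rw [A2.1 aDone rfl, A1.1 aDone rfl]
  have hset : Runs (.ite (.natEq (var vOk) (.const 1)) (.setNat aBase (var vCur) (.const 0) eSinkBase)
      (.setNat aBase (var vCur) (.const 0) (var vCur)) ⨟
      .setNat aDone (var vCur) (.const 0) (.const 1)) s2 48 (fun s' =>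
        (∀ v : ℕ, s'.nat aDone v 0 = if v = y then 1 else s.nat aDone v 0) ∧
        (∀ v : ℕ, v ≠ y → s'.nat aBase v 0 = s.nat aBase v 0) ∧
        ((Takes G L y (s.nat aSink y 0) (s.nat aBase (s.nat aSink y 0) 0) ∧
          s'.nat aBase y 0 = s.nat aBase (s.nat aSink y 0) 0) ∨
        (¬ Takes G L y (s.nat aSink y 0) (s.nat aBase (s.nat aSink y 0) 0) ∧
          s'.nat aBase y 0 = y))) := by
    refine Runs.of_wp (by simp [Program.maxCost, Test.cost, NExpr.cost]) ?_
    simp only [Program.wp, Test.Holds, NExpr.eval, o2]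
    refine ⟨fun h => ⟨?_, ?_, .inl ⟨h, ?_⟩⟩, fun h => ⟨?_, ?_, .inr ⟨h, ?_⟩⟩⟩
    · intro v; simp [c2, d2]
    · intro v hv; simp [c2, b2, hv]
    · simp [c2, b2, k2]
    · intro v; simp [c2, d2]
    · intro v hv; simp [c2, b2, hv]
    · simp [c2]
  refine hset.mono le_rfl ?_
  rintro s3 A3 ⟨d3, b3, h3⟩
  have k3 : s3.nat aSink = s.nat aSink := by rw [A3.1 aSink rfl, k2]
  have hyn : n ≠ y.val := by have := y.2; omega
  have hneS : ∀ x ∈ S, x.val ≠ y.val := fun x hx h => hyS (Fin.ext h ▸ hx)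
  have hbs : s.nat aSink y 0 ≠ y →
      s3.nat aBase (s.nat aSink y 0) 0 = s.nat aBase (s.nat aSink y 0) 0 := fun hne => b3 _ hne
  refine ⟨insert y S, Finset.card_insert_of_notMem hyS, ?_, ?_, ?_, ?_, ?_, ?_⟩
  · rw [k3]; exact hI.sink
  · intro z
    rw [d3, hI.done]
    by_cases hz : z = y
    · simp [hz]
    · simp [hz, Fin.val_inj]
  · rw [d3, if_neg hyn, hI.doneLast]
  · rw [b3 n hyn, hI.baseLast]
  · intro z hz
    rw [k3]
    rcases Finset.mem_insert.1 hz with rfl | hz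
    · rcases hsink with h | h | ⟨x, hx, h⟩
      · exact .inr ⟨z, by simp, h⟩
      · exact .inl h
      · exact .inr ⟨x, by simp [hx], h⟩
    · rcases hI.closed z hz with h | ⟨x, hx, h⟩
      · exact .inl h
      · exact .inr ⟨x, by simp [hx], h⟩
  · intro z hz
    rcases Finset.mem_insert.1 hz with rfl | hz
    · simp only [BaseSpec, k3]
      by_cases hne : s.nat aSink z 0 = z
      · have hnt : ∀ b, ¬ Takes G L z (s.nat aSink z 0) b := fun b h => h.1 hne
        rcases h3 with ⟨h, -⟩ | ⟨-, h⟩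
        · exact absurd h (hnt _)
        · refine ⟨?_, .inr ⟨hnt _, h⟩⟩
          have := z.2
          omega
      · rw [hbs hne]
        refine ⟨?_, h3⟩
        rcases h3 with ⟨-, h⟩ | ⟨-, h⟩
        · rw [h]; exact hle hne
        · have := z.2
          omega
    · have h1 : s3.nat aBase z 0 = s.nat aBase z 0 := b3 z (hneS z hz)
      have h2 : s3.nat aBase (s.nat aSink z 0) 0 = s.nat aBase (s.nat aSink z 0) 0 := by
        refine b3 _ ?_
        rcases hI.closed z hz with h | ⟨x, hx, h⟩
        · rw [h]; exact hyn
        · rw [h]; exact hneS x hx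
      simp only [BaseSpec, k3, h1, h2]
      exact hI.base z hz

theorem runs_computeBases (hG : IsDAG G) {s : State} (hs : Env G L s)
    (hsink : ∀ y : Fin n, SinkSpec G L y (s.nat aSink y 0) ∧ s.nat aDone y 0 = 0) :
    Runs computeBases s (n * (n * 120 + 150) + 40) (fun s' =>
      s'.nat aBase n 0 = n ∧ ∀ y : Fin n, SinkSpec G L y (s'.nat aSink y 0) ∧
        BaseSpec G L (fun v => s'.nat aSink v 0) (fun v => s'.nat aBase v 0) y) := by
  -- The dummy node `n` starts as done, with itself as its base.
  have hset : Runs (.setNat aDone eN (.const 0) (.const 1) ⨟ .setNat aBase eN (.const 0) eN) s 20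
      (RoundInv G L ∅) := by
    refine Runs.of_wp (by simp [Program.maxCost, NExpr.cost]) ?_
    refine ⟨fun y => ?_, fun y => ?_, ?_, ?_, by simp, by simp⟩
    · simpa using (hsink y).1
    · have hne : y.val ≠ n := by have := y.2; omega
      simp [NExpr.eval, hs.n_eq, hne, (hsink y).2]
    · simp [NExpr.eval, hs.n_eq]
    · simp [NExpr.eval, hs.n_eq]
  refine (hset.seq (T₂ := n * (n * 120 + 150) + 12) ?_ (by omega)).assoc
  intro s1 A1 I1
  have hE1 : Env G L s1 := hs.agree A1 rfl
  refine (Runs.for_const (N := n) (T := n * 120 + 130) (fun i s' =>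
      ∃ S : Finset (Fin n), S.card = i ∧ RoundInv G L S s')
    rfl (by simp [NExpr.cost]) ?_ ?_ ⟨∅, Finset.card_empty, I1⟩ ?_ le_rfl).mono ?_ ?_
  · exact fun s' hA => (hE1.agree hA rfl).n_eq
  · rintro i s' v ⟨S, hS, hI⟩
    refine ⟨S, hS, ?_, ?_, ?_, ?_, ?_, ?_⟩
    · simpa using hI.sink
    · simpa using hI.done
    · simpa using hI.doneLast
    · simpa using hI.baseLast
    · simpa using hI.closed
    · simpa using hI.base
  · rintro i hi s' As hv ⟨S, hS, hI⟩
    subst hS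
    exact runs_baseRound hG (hE1.agree As rfl) hI hi
  · exact Nat.add_le_add_right (Nat.mul_le_mul_left _ (by omega)) _
  · rintro s' - ⟨S, hS, hI⟩
    have hmem : ∀ y, y ∈ S := by
      have : S = Finset.univ := by
        rw [← Finset.card_eq_iff_eq_univ, hS, Fintype.card_fin]
      simp [this]
    exact ⟨hI.baseLast, fun y => ⟨hI.sink y, hI.base y (hmem y)⟩⟩

end BaseRounds

/-! ### The arcs of the learnt CPDAG -/

section Compelled

variable {n : ℕ} {D : Dataset n} {G : Digraph (Fin n)} {h : ℕ} {α : ℝ} {L : List (Triangle n)}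

theorem latent_adj {T : Triangle n} (hT : T ∈ latent D G h α) : G.Adj T.A T.B :=
  (mem_latent_type hT).elim (fun h => h.2.1) fun h => h.1

theorem withConfounders_adj_inl (hL : ∀ T, T ∈ L ↔ T ∈ latent D G h α) (x y : Fin n) :
    (withConfounders D G h α).Adj (.inl x) (.inl y) ↔ Arc G L x y := by
  simp only [withConfounders, RemainingArc, Removes, Set.mem_ofPred_eq, hL, not_or]

theorem withConfounders_adj_inr (T : {T : Triangle n // T ∈ latent D G h α}) (x : Fin n) :
    (withConfounders D G h α).Adj (.inr T) (.inl x) ↔ x = T.1.A ∨ x = T.1.B := Iff.rfl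

theorem not_withConfounders_adj_inr (u : Node D G h α)
    (T : {T : Triangle n // T ∈ latent D G h α}) :
    ¬ (withConfounders D G h α).Adj u (.inr T) := by
  cases u <;> exact id

/-- No arc enters a confounder, so walks end at observed nodes, and those that start at an observed
node are walks of `G`. -/
theorem transGen_withConfounders {u v : Node D G h α}
    (huv : Relation.TransGen (withConfounders D G h α).Adj u v) :
    ∃ y, v = .inl y ∧ ∀ x, u = .inl x → Relation.TransGen G.Adj x y := by
  induction huv with
  | @single v huv =>
    cases v with
    | inr T => exact absurd huv (not_withConfounders_adj_inr _ T)
    | inl y =>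
      refine ⟨y, rfl, ?_⟩
      rintro x rfl
      exact .single huv.1
  | @tail v w _ hvw ih =>
    obtain ⟨y, rfl, hy⟩ := ih
    cases w with
    | inr T => exact absurd hvw (not_withConfounders_adj_inr _ T)
    | inl z => exact ⟨z, rfl, fun x hx => (hy x hx).tail hvw.1⟩

theorem isDAG_withConfounders (hG : IsDAG G) : IsDAG (withConfounders D G h α) := by
  intro v hv
  obtain ⟨y, rfl, hy⟩ := transGen_withConfounders hv
  exact hG y (hy y rfl)

theorem numConf_eq_zero_iff (hL : ∀ T, T ∈ L ↔ T ∈ latent D G h α) (x : Fin n) :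
    numConf L x = 0 ↔ ∀ T, ¬ (withConfounders D G h α).Adj (.inr T) (.inl x) := by
  simp only [numConf, List.countP_eq_zero, decide_eq_true_eq, hL, withConfounders_adj_inr,
    Subtype.forall, eq_comm (a := x)]

theorem exists_unique_of_numConf (hL : ∀ T, T ∈ L ↔ T ∈ latent D G h α) {x : Fin n}
    (hx : numConf L x = 1) : ∃ T, (withConfounders D G h α).Adj (.inr T) (.inl x) ∧
      ∀ T', (withConfounders D G h α).Adj (.inr T') (.inl x) → T' = T := by
  classical
  rw [numConf, List.countP_eq_length_filter, List.length_eq_one_iff] at hx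
  obtain ⟨T, hT⟩ := hx
  have hmem : ∀ T', (T' ∈ L ∧ (T'.A = x ∨ T'.B = x)) ↔ T' = T := by
    intro T'
    rw [← List.mem_singleton (a := T'), ← hT]
    simp
  obtain ⟨h1, h2⟩ := (hmem T).2 rfl
  refine ⟨⟨T, (hL T).1 h1⟩, ?_, fun T' hT' => Subtype.ext ((hmem T'.1).1 ⟨(hL _).2 T'.2, ?_⟩)⟩
  · simpa [withConfounders_adj_inr, eq_comm] using h2
  · simpa [withConfounders_adj_inr, eq_comm] using hT'

theorem numConf_eq_one (hnd : L.Nodup) (hL : ∀ T, T ∈ L ↔ T ∈ latent D G h α) {x : Fin n}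
    {T : {T : Triangle n // T ∈ latent D G h α}}
    (hT : (withConfounders D G h α).Adj (.inr T) (.inl x))
    (huniq : ∀ T', (withConfounders D G h α).Adj (.inr T') (.inl x) → T' = T) :
    numConf L x = 1 := by
  classical
  have hne : numConf L x ≠ 0 := fun h0 => (numConf_eq_zero_iff hL x).1 h0 T hT
  have hle : numConf L x ≤ 1 := by
    rw [numConf, List.countP_eq_length_filter]
    refine ((hnd.filter _).subperm (l₂ := [T.1]) fun T' hT' => ?_).length_le
    simp only [List.mem_filter, decide_eq_true_eq, hL] at hT'
    have := huniq ⟨T', hT'.1⟩ (by simpa [withConfounders_adj_inr, eq_comm] using hT'.2)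
    simp [← this]
  omega

/-- The compelled parents of a node whose base is known: the parents of the base. -/
def compelled (D : Dataset n) (G : Digraph (Fin n)) (h : ℕ) (α : ℝ) (base : ℕ → ℕ) :
    Node D G h α → Set (Node D G h α)
  | .inl y => {u | ∃ b : Fin n, base y = b ∧ (withConfounders D G h α).Adj u (.inl b)}
  | .inr _ => ∅

variable {sink base : ℕ → ℕ}

theorem inl_mem_compelled (hL : ∀ T, T ∈ L ↔ T ∈ latent D G h α) (x y : Fin n) :
    .inl x ∈ compelled D G h α base (.inl y) ↔ ArcTo G L x (base y) := by
  simp only [compelled, Set.mem_ofPred_eq, withConfounders_adj_inl hL]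
  constructor
  · rintro ⟨b, hb, hx⟩
    rw [hb]
    exact ⟨b.2, hx⟩
  · rintro ⟨hb, hx⟩
    exact ⟨⟨_, hb⟩, rfl, hx⟩

theorem compelled_eq_parents {y : Fin n} (hy : base y = y) :
    compelled D G h α base (.inl y) = parents (withConfounders D G h α) (.inl y) := by
  ext u
  simp only [compelled, parents, Set.mem_ofPred_eq, hy, Fin.val_inj, exists_eq_left']

/-- The dummy node has neither parents nor confounders above it, so the conditions for taking over
its base are void. -/
theorem base_eq_of_sink_last (hn : base n = n) {y : Fin n} (hb : BaseSpec G L sink base y)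
    (hy : sink y = n) : base y = n := by
  have ht : Takes G L y (sink y) (base (sink y)) := by
    rw [hy, hn]
    refine ⟨fun h => ?_, ?_, ?_⟩
    · have := y.2
      omega
    · simp [confAt]
    · rintro z ⟨hz, -⟩
      exact absurd hz (lt_irrefl _)
  rcases hb.2 with ⟨-, h⟩ | ⟨h, -⟩
  · rw [h, hy, hn]
  · exact absurd ht h

theorem base_eq_of_sink_self {y : Fin n} (hb : BaseSpec G L sink base y) (hy : sink y = y) :
    base y = y := by
  rcases hb.2 with ⟨h, -⟩ | ⟨-, h⟩
  · exact absurd hy h.1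
  · exact h

/-- A confounder above `x` rules out an observed sink. Either it is the only parent of `x`, and the
base is the dummy with no compelled parents, or `x` is its own base and all of its parents are
compelled. -/
theorem inr_notMem_compelled (hL : ∀ T, T ∈ L ↔ T ∈ latent D G h α) (hn : base n = n)
    {x : Fin n} (hs : SinkSpec G L x (sink x)) (hb : BaseSpec G L sink base x)
    {T : {T : Triangle n // T ∈ latent D G h α}}
    (hT : (withConfounders D G h α).Adj (.inr T) (.inl x)) :
    .inr T ∉ compelled D G h α base (.inl x) ↔ base x = n := by
  rcases hs with ⟨_, h0, -⟩ | ⟨-, -, hv⟩ | ⟨hv, -⟩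
  · exact absurd hT ((numConf_eq_zero_iff hL x).1 h0 T)
  · have := base_eq_of_sink_last hn hb hv
    simp only [this, iff_true]
    rintro ⟨b, hb', -⟩
    have := b.2
    omega
  · have := base_eq_of_sink_self hb hv
    rw [compelled_eq_parents this, this]
    have hx := x.2
    simp only [parents, Set.mem_ofPred_eq, hT, not_true_eq_false, false_iff]
    omega

/-- A confounder has no parents, so `y` can inherit from it only if it is the sole parent of `y`,
and then `K y = ∅`; this is the sink `n`. From an observed `x`, `y` can inherit only if no
confounder lies above `y`: it would also have to point to `x`, but the arc between its two children
has been removed. A sink equal to `y` means that there is nothing to inherit from. -/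
theorem compelledSpec_compelled (hG : IsDAG G) (hnd : L.Nodup)
    (hL : ∀ T, T ∈ L ↔ T ∈ latent D G h α) (hn : base n = n)
    (hs : ∀ y : Fin n, SinkSpec G L y (sink y)) (hb : ∀ y, BaseSpec G L sink base y) :
    CompelledSpec (withConfounders D G h α) (compelled D G h α base) := by
  have hW := withConfounders_adj_inl hL
  rintro (y | T)
  swap
  · refine .inr ⟨fun x hx => not_withConfounders_adj_inr _ _ hx.1, ?_⟩
    ext u
    simpa [compelled, parents] using not_withConfounders_adj_inr u T
  have hsink : ∀ x, Inherits (withConfounders D G h α) (compelled D G h α base) (.inl x) (.inl y) →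
      IsSink G L x y := by
    intro x hx
    refine ⟨(hW x y).1 hx.1, fun z hz hzx => (hW z x).1 (hx.2.1 _ ((hW z y).2 hz) ?_)⟩
    simpa using hzx
  rcases hs y with ⟨x, h0, hx, hv⟩ | ⟨h1, hno, hv⟩ | ⟨hv, h0, h1⟩
  · have h0' := (numConf_eq_zero_iff hL y).1 h0
    have hbx := hb y
    rw [BaseSpec, hv] at hbx
    rcases hbx.2 with ⟨ht, hbe⟩ | ⟨ht, hbe⟩
    · refine .inl ⟨.inl x, ⟨(hW x y).2 hx.1, ?_, ?_⟩, ?_⟩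
      · rintro (z | T) hz hzx
        · exact (hW z x).2 (hx.2 z ((hW z y).1 hz) (by simpa using hzx))
        · exact absurd hz (h0' T)
      · rintro (z | T) hz
        · exact (hW z y).2 (ht.2.2 z ((inl_mem_compelled hL z x).1 hz))
        · obtain ⟨b, hb', hT⟩ := hz
          have hc := ht.2.1
          rw [hb', confAt, dif_pos b.2] at hc
          exact absurd hT ((numConf_eq_zero_iff hL b).1 hc T)
      · simp only [compelled, hbe]
    · refine .inr ⟨?_, compelled_eq_parents hbe⟩
      rintro (x' | T) hx'
      swap
      · exact h0' T hx'.1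
      -- Two different sinks of `y` would point to each other.
      have hxx : x' = x := by
        by_contra hne
        have hx'' := hsink x' hx'
        have h1 := hx.2 x' hx''.1 hne
        have h2 := hx''.2 x hx.1 (Ne.symm hne)
        exact hG.not_symm h1.1 h2.1
      subst hxx
      refine ht ⟨fun h' => hG.ne hx.1.1 (Fin.ext h'), ?_, fun z hz => ?_⟩
      · rw [confAt]
        split_ifs with hlt
        · rw [numConf_eq_zero_iff hL]
          exact fun T hT => h0' T (hx'.2.2 (.inr T) ⟨⟨_, hlt⟩, rfl, hT⟩)
        · rfl
      · exact (hW z y).1 (hx'.2.2 (.inl z) ((inl_mem_compelled hL z x').2 hz))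
  · obtain ⟨T, hT, huniq⟩ := exists_unique_of_numConf hL h1
    have hby := base_eq_of_sink_last hn (hb y) hv
    refine .inl ⟨.inr T, ⟨hT, ?_, fun z hz => hz.elim⟩, ?_⟩
    · rintro (z | T') hz hzT
      · exact absurd ((hW z y).1 hz) (hno z)
      · exact absurd (congrArg Sum.inr (huniq T' hz)) hzT
    · ext u
      simp only [compelled, Set.mem_ofPred_eq, hby, Set.mem_empty_iff_false, iff_false]
      rintro ⟨b, hb', -⟩
      have := b.2
      omega
  · refine .inr ⟨?_, compelled_eq_parents (base_eq_of_sink_self (hb y) hv)⟩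
    rintro (x | T) hx
    · by_cases hy0 : numConf L y = 0
      · exact h0 hy0 x (hsink x hx)
      · simp only [numConf_eq_zero_iff hL, not_forall, not_not] at hy0
        obtain ⟨T, hT⟩ := hy0
        -- The confounder is a parent of `y` other than `x`, so it points to `x` as well, and `x`,
        -- `y` are its two children.
        have hTx := hx.2.1 _ hT (by simp)
        have hxy := (hW x y).1 hx.1
        have hAB := latent_adj T.2
        rw [withConfounders_adj_inr] at hT hTx
        have hne := hG.ne hxy.1
        rcases hTx with rfl | rfl <;> rcases hT with rfl | rfl
        · exact hne rfl
        · exact hxy.2 T.1 ((hL _).2 T.2) (.inl ⟨rfl, rfl⟩)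
        · exact hG.not_symm hAB hxy.1
        · exact hne rfl
    -- Any further parent of `y` would have to point to `T`, so `T` is the only confounder above
    -- `y`, and an observed parent is impossible too.
    · obtain ⟨x, hxy⟩ := h1 (numConf_eq_one hnd hL hx.1 fun T' hT' => by
        by_contra hne
        exact not_withConfounders_adj_inr _ _ (hx.2.1 _ hT' (by simpa using hne)))
      exact not_withConfounders_adj_inr _ _ (hx.2.1 _ ((hW x y).2 hxy) (by simp))

/-- The pairs of numbers to be listed because of the arc `x → y`. -/
def ObservedPair (G : Digraph (Fin n)) (L : List (Triangle n)) (base : ℕ → ℕ) (x y : Fin n)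
    (p q : ℕ) : Prop :=
  Arc G L x y ∧ ((p = x ∧ q = y) ∨ (¬ ArcTo G L x (base y) ∧ p = y ∧ q = x))

/-- The pairs of numbers to be listed because of the arc from the confounder with number `c`
to `x`. -/
def ConfounderPair (base : ℕ → ℕ) (c : ℕ) (x : Fin n) (p q : ℕ) : Prop :=
  (p = c ∧ q = x) ∨ (base x = n ∧ p = x ∧ q = c)

theorem isOutput_of_list (hG : IsDAG G) (hnd : L.Nodup) (hL : ∀ T, T ∈ L ↔ T ∈ latent D G h α)
    (hn : base n = n) (hs : ∀ y : Fin n, SinkSpec G L y (sink y))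
    (hb : ∀ y, BaseSpec G L sink base y) {s : State} (hH : Holds G L s)
    (hlist : ∀ p q, (∃ j < s.nat 6 0 0, s.nat 7 j 0 = p ∧ s.nat 7 j 1 = q) ↔
      (∃ y x, ObservedPair G L base x y p q) ∨
      ∃ (j : ℕ) (hj : j < L.length), ConfounderPair base (n + j) L[j].A p q ∨
        ConfounderPair base (n + j) L[j].B p q) :
    IsOutput D G h α s := by
  let f : Fin L.length → {T : Triangle n // T ∈ latent D G h α} :=
    fun i => ⟨L[i.val], (hL _).1 (List.getElem_mem _)⟩
  have hf : Function.Bijective f := by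
    constructor
    · intro i j hij
      exact Fin.ext ((List.Nodup.getElem_inj_iff hnd).1 (congrArg Subtype.val hij))
    · rintro ⟨T, hT⟩
      obtain ⟨i, hi, rfl⟩ := List.getElem_of_mem ((hL T).2 hT)
      exact ⟨⟨i, hi⟩, rfl⟩
  let e : {T : Triangle n // T ∈ latent D G h α} ≃ Fin (s.nat 4 0 0) :=
    (Equiv.ofBijective f hf).symm.trans (finCongr hH.length_eq.symm)
  have he : ∀ T, ∃ hlt : (e T).val < L.length, L[(e T).val] = T.1 := by
    intro T
    have h1 : f ((Equiv.ofBijective f hf).symm T) = T := (Equiv.ofBijective f hf).apply_symm_apply T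
    exact ⟨((Equiv.ofBijective f hf).symm T).2, congrArg Subtype.val h1⟩
  -- The description of the CPDAG needs a finite set of nodes.
  have hfin : Finite {T : Triangle n // T ∈ latent D G h α} := .of_equiv _ e.symm
  refine ⟨e, fun T => ?_, fun p q => ?_⟩
  · obtain ⟨hlt, hT⟩ := he T
    have := hH.row _ hlt
    rwa [hT] at this
  have hspec := compelledSpec_compelled hG hnd hL hn hs hb
  have hadj := hspec.cpdag_adj_iff (isDAG_withConfounders hG)
  have hW := withConfounders_adj_inl hL
  have hK : ∀ (T : {T : Triangle n // T ∈ latent D G h α}) (x : Fin n),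
      (withConfounders D G h α).Adj (.inr T) (.inl x) →
      (Sum.inr T ∉ compelled D G h α base (.inl x) ↔ base x = n) :=
    fun T x hT => inr_notMem_compelled hL hn (hs x) (hb x) hT
  have hconf : ∀ (T : {T : Triangle n // T ∈ latent D G h α}) (x : Fin n),
      (withConfounders D G h α).Adj (.inr T) (.inl x) →
      ConfounderPair base (n + (e T).val) x p q →
      ∃ u v, label D G h α e u = p ∧ label D G h α e v = q ∧ (learntCPDAG D G h α).Adj u v := by
    rintro T x hT (⟨rfl, rfl⟩ | ⟨hbx, rfl, rfl⟩)
    · exact ⟨.inr T, .inl x, rfl, rfl, (hadj _ _).2 (.inl hT)⟩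
    · exact ⟨.inl x, .inr T, rfl, rfl, (hadj _ _).2 (.inr ⟨hT, (hK T x hT).2 hbx⟩)⟩
  have hconf' : ∀ (T : {T : Triangle n // T ∈ latent D G h α}) (x : Fin n),
      (withConfounders D G h α).Adj (.inr T) (.inl x) →
      ConfounderPair base (n + (e T).val) x p q →
      ∃ (j : ℕ) (hj : j < L.length), ConfounderPair base (n + j) L[j].A p q ∨
        ConfounderPair base (n + j) L[j].B p q := by
    intro T x hT hp
    obtain ⟨hlt, hTL⟩ := he T
    refine ⟨(e T).val, hlt, ?_⟩
    rw [hTL]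
    rcases hT with rfl | rfl
    · exact .inl hp
    · exact .inr hp
  rw [hlist]
  constructor
  · rintro (⟨y, x, hxy, ⟨rfl, rfl⟩ | ⟨hnot, rfl, rfl⟩⟩ | ⟨j, hj, hp⟩)
    · exact ⟨.inl x, .inl y, rfl, rfl, (hadj _ _).2 (.inl ((hW x y).2 hxy))⟩
    · refine ⟨.inl y, .inl x, rfl, rfl, (hadj _ _).2 (.inr ⟨(hW x y).2 hxy, ?_⟩)⟩
      rwa [inl_mem_compelled hL]
    · have hej : (e (f ⟨j, hj⟩)).val = j := by
        change ((Equiv.ofBijective f hf).symm (Equiv.ofBijective f hf ⟨j, hj⟩)).val = j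
        rw [Equiv.symm_apply_apply]
      rcases hp with hp | hp
      · exact hconf (f ⟨j, hj⟩) _ (.inl rfl) (by rw [hej]; exact hp)
      · exact hconf (f ⟨j, hj⟩) _ (.inr rfl) (by rw [hej]; exact hp)
  · rintro ⟨u, v, rfl, rfl, huv⟩
    rcases (hadj u v).1 huv with huv | ⟨hvu, hnot⟩
    · rcases v with y | T
      swap
      · exact absurd huv (not_withConfounders_adj_inr _ _)
      rcases u with x | T
      · exact .inl ⟨y, x, (hW x y).1 huv, .inl ⟨rfl, rfl⟩⟩
      · exact .inr (hconf' T y huv (.inl ⟨rfl, rfl⟩))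
    · rcases u with x | T
      swap
      · exact absurd hvu (not_withConfounders_adj_inr _ _)
      rcases v with y | T
      · rw [inl_mem_compelled hL] at hnot
        exact .inl ⟨x, y, (hW y x).1 hvu, .inr ⟨hnot, rfl, rfl⟩⟩
      · exact .inr (hconf' T x hvu (.inr ⟨(hK T x hvu).1 hnot, rfl, rfl⟩))

end Compelled

/-! ### Listing the arcs of the CPDAG, and the complete program -/

section Output

/-- Appends a pair to the list of arcs. -/
def emit (e f : NExpr) : Program :=
  .setNat 7 (var 6) (.const 0) e ⨟ .setNat 7 (var 6) (.const 1) f ⨟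
  assign 6 (.add (var 6) (.const 1))

/-- Lists the pairs that come from the arc between `vA` and `vB`. -/
def listObserved : Program :=
  .ite (.natEq (.get aGraph (var vA) (var vB)) (.const 1))
    (emit (var vA) (var vB) ⨟
      .ite (.natEq (.get aGraph (var vA) (entryAt aBase (var vB))) (.const 0))
        (emit (var vB) (var vA)) .skip)
    .skip

/-- Lists the pairs that come from the arc from the confounder with number `c` to `e`. -/
def listConfounder (c e : NExpr) : Program :=
  emit c e ⨟ .ite (.natEq (entryAt aBase e) eN) (emit e c) .skip

/-- The number of the confounder `vStep`. -/
abbrev eConf : NExpr := .add eN (var vStep)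

/-- Lists the arcs of the CPDAG. -/
def listArcs : Program :=
  assign 6 (.const 0) ⨟
  forLoop vB eN (forLoop vA eN listObserved) ⨟
  forLoop vStep (var 4)
    (listConfounder eConf (.get 5 (var vStep) (.const 0)) ⨟
      listConfounder eConf (.get 5 (var vStep) (.const 1)))

variable {n : ℕ} {G : Digraph (Fin n)} {L : List (Triangle n)} {base : ℕ → ℕ}

/-- The list of arcs consists of the pairs that satisfy `P`. -/
def Lists (P : ℕ → ℕ → Prop) (s : State) : Prop :=
  ∀ p q, (∃ j < s.nat 6 0 0, s.nat 7 j 0 = p ∧ s.nat 7 j 1 = q) ↔ P p q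

theorem Lists.congr {P P' : ℕ → ℕ → Prop} {s : State} (hs : Lists P s)
    (hP : ∀ p q, P p q ↔ P' p q) : Lists P' s := fun p q => (hs p q).trans (hP p q)

theorem Lists.setNat {P : ℕ → ℕ → Prop} {s : State} (hs : Lists P s) {a : ℕ} (ha : 7 < a)
    (i j x : ℕ) : Lists P (s.setNat a i j x) := by
  have h6 : 6 ≠ a := by omega
  have h7 : 7 ≠ a := by omega
  simpa [Lists, h6, h7] using hs

/-- `f` is evaluated only after the tail has been written to array 7, hence its hypothesis concerns
all the states reachable by the program's own writes. -/
theorem runs_emit {P : ℕ → ℕ → Prop} {s : State} (hs : Lists P s) {e f : NExpr} {a b : ℕ}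
    (he : e.eval s = a) (hf : ∀ s', Agree (emit e f) s s' → f.eval s' = b)
    (hec : e.cost ≤ 7) (hfc : f.cost ≤ 7) :
    Runs (emit e f) s 32 (Lists fun p q => P p q ∨ (p = a ∧ q = b)) := by
  have hw : (emit e f).writesNat 7 = true := rfl
  have hf' : f.eval (s.setNat 7 (s.nat 6 0 0) 0 a) = b :=
    hf _ ((Agree.refl _ s).setNat _ _ _ hw)
  refine Runs.of_wp (by simp only [emit, Program.maxCost, NExpr.cost]; omega) ?_
  intro p q
  simp only [NExpr.eval, he, ne_eq, Nat.reduceEqDiff, not_false_eq_true, State.setNat_nat_of_ne,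
    State.setNat_nat_self, hf', and_true, and_false, if_false, and_self, if_true, zero_ne_one,
    one_ne_zero, ← hs p q]
  generalize s.nat 6 0 0 = l
  constructor
  · rintro ⟨j, hj, h0, h1⟩
    by_cases hjl : j = l
    · simp only [hjl, if_true] at h0 h1
      exact .inr ⟨h0.symm, h1.symm⟩
    · simp only [hjl, if_false] at h0 h1
      exact .inl ⟨j, by omega, h0, h1⟩
  · rintro (⟨j, hj, h0, h1⟩ | ⟨rfl, rfl⟩)
    · have hjl : j ≠ l := by omega
      exact ⟨j, by omega, by simpa [hjl] using h0, by simpa [hjl] using h1⟩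
    · exact ⟨l, by omega, by simp⟩

theorem runs_listObserved {P : ℕ → ℕ → Prop} {s : State} (hs : Env G L s) (hP : Lists P s)
    {x y : Fin n} (hx : s.nat vA 0 0 = x) (hy : s.nat vB 0 0 = y)
    (hb : s.nat aBase y 0 = base y) (hbn : base y ≤ n) :
    Runs listObserved s 120 (Lists fun p q => P p q ∨ ObservedPair G L base x y p q) := by
  have ht : (Test.natEq (.get aGraph (var vA) (var vB)) (.const 1)).Holds s ↔ Arc G L x y := by
    simp [Test.Holds, NExpr.eval, hx, hy, hs.arc_iff]
  refine Runs.ite (T := 100) (fun h => ?_) (fun h => ?_) (by simp [Test.cost, NExpr.cost])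
  swap
  · rw [ht] at h
    refine Runs.of_wp (by simp [Program.maxCost]) (hP.congr fun p q => ?_)
    simp [ObservedPair, h]
  rw [ht] at h
  refine (runs_emit hP (a := x) (b := y) (by simp [NExpr.eval, hx]) ?_ (by simp [NExpr.cost])
    (by simp [NExpr.cost])).seq (T₂ := 60) ?_ (by omega)
  · intro s' A'
    simp [NExpr.eval, A'.1 vB rfl, hy]
  intro s1 A1 P1
  have hx1 : s1.nat vA 0 0 = x := by rw [A1.1 vA rfl, hx]
  have hy1 : s1.nat vB 0 0 = y := by rw [A1.1 vB rfl, hy]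
  have ht1 : (Test.natEq (.get aGraph (var vA) (entryAt aBase (var vB))) (.const 0)).Holds s1 ↔
      ¬ ArcTo G L x (base y) := by
    simp [Test.Holds, NExpr.eval, hx1, hy1, A1.1 aBase rfl, hb, (hs.agree A1 rfl).arcTo_zero x hbn]
  refine Runs.ite (T := 32) (fun h' => ?_) (fun h' => ?_) (by simp [Test.cost, NExpr.cost])
  · rw [ht1] at h'
    refine (runs_emit P1 (a := y) (b := x) (by simp [NExpr.eval, hy1]) ?_ (by simp [NExpr.cost])
      (by simp [NExpr.cost])).mono le_rfl fun s2 _ P2 => P2.congr fun p q => ?_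
    · intro s' A'
      simp [NExpr.eval, A'.1 vA rfl, hx1]
    · simp [ObservedPair, h, h', or_assoc]
  · rw [ht1] at h'
    refine Runs.of_wp (by simp [Program.maxCost]) (P1.congr fun p q => ?_)
    simp [ObservedPair, h, h']

theorem runs_listConfounder {P : ℕ → ℕ → Prop} {s : State} (hP : Lists P s) {c e : NExpr}
    {a : ℕ} {x : Fin n} (hn : ∀ s', Agree (listConfounder c e) s s' → s'.nat 0 0 0 = n)
    (hc : ∀ s', Agree (listConfounder c e) s s' → c.eval s' = a)
    (he : ∀ s', Agree (listConfounder c e) s s' → e.eval s' = x)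
    (hcc : c.cost ≤ 7) (hec : e.cost ≤ 7) (hb : s.nat aBase x 0 = base x) :
    Runs (listConfounder c e) s 100 (Lists fun p q => P p q ∨ ConfounderPair base a x p q) := by
  have hA : ∀ {e' f' : NExpr} {s₁ s₂ : State}, Agree (emit e' f') s₁ s₂ →
      Agree (listConfounder c e) s₁ s₂ := by
    intro e' f' s₁ s₂ h
    exact ⟨fun b hb => h.1 b (by simp_all [listConfounder, emit, Program.writesNat]),
      fun b _ => h.2 b rfl⟩
  refine (runs_emit hP (hc s (Agree.refl _ s)) (fun s' A' => he s' (hA A')) hcc hec).seq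
    (T₂ := 60) ?_ (by omega)
  intro s1 A1 P1
  have ht : (Test.natEq (entryAt aBase e) eN).Holds s1 ↔ base x = n := by
    simp only [Test.Holds, NExpr.eval, he s1 (hA A1), hn s1 (hA A1), A1.1 aBase rfl, hb]
  refine Runs.ite (T := 32) (fun h' => ?_) (fun h' => ?_)
    (by simp only [Test.cost, NExpr.cost]; omega)
  · rw [ht] at h'
    refine (runs_emit P1 (he s1 (hA A1)) (fun s' A' => hc s' ((hA A1).trans (hA A'))) hec
      hcc).mono le_rfl fun s2 _ P2 => P2.congr fun p q => ?_
    simp [ConfounderPair, h', or_assoc]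
  · rw [ht] at h'
    refine Runs.of_wp (by simp [Program.maxCost]) (P1.congr fun p q => ?_)
    simp [ConfounderPair, h']

theorem exists_lt_succ_fin {P : Fin n → Prop} {i : ℕ} (hi : i < n) :
    (∃ z : Fin n, z.val < i + 1 ∧ P z) ↔ (∃ z : Fin n, z.val < i ∧ P z) ∨ P ⟨i, hi⟩ := by
  have := forall_lt_succ_fin (P := fun z => ¬ P z) hi
  rw [← not_iff_not]
  push Not
  exact this

theorem runs_listArcs {s : State} (hs : Env G L s) (hb : ∀ y : Fin n, s.nat aBase y 0 = base y)
    (hbn : ∀ y : Fin n, base y ≤ n) :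
    Runs listArcs s (n * (n * 136 + 28) + L.length * 216 + 28) (Lists fun p q =>
      (∃ y x, ObservedPair G L base x y p q) ∨
      ∃ (j : ℕ) (hj : j < L.length), ConfounderPair base (n + j) L[j].A p q ∨
        ConfounderPair base (n + j) L[j].B p q) := by
  have hstart : Runs (assign 6 (.const 0)) s 4 (Lists fun _ _ => False) := by
    refine Runs.of_wp (by simp [Program.maxCost, NExpr.cost]) ?_
    simp [Program.wp, Lists, NExpr.eval]
  refine hstart.seq (T₂ := n * (n * 136 + 28) + L.length * 216 + 24) ?_ (by omega)
  intro s1 A1 P1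
  have hE1 : Env G L s1 := hs.agree A1 rfl
  have b1 : s1.nat aBase = s.nat aBase := A1.1 aBase rfl
  have hobs : Runs (forLoop vB eN (forLoop vA eN listObserved)) s1 (n * (n * 136 + 28) + 12)
      (Lists fun p q => ∃ y x, ObservedPair G L base x y p q) := by
    refine (Runs.for_const (N := n) (T := n * 136 + 12) (fun i => Lists fun p q =>
        ∃ y : Fin n, y.val < i ∧ ∃ x, ObservedPair G L base x y p q)
      rfl (by simp [NExpr.cost]) ?_ (fun i s' v hI => hI.setNat (by omega) _ _ _)
      (P1.congr (by simp)) ?_ le_rfl).mono le_rfl fun s' _ hI => hI.congr fun p q => by simp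
    · exact fun s' hA => (hE1.agree hA rfl).n_eq
    · intro i hi s2 A2 hv hI
      have hE2 : Env G L s2 := hE1.agree A2 rfl
      refine (Runs.for_const (N := n) (T := 120) (fun j => Lists fun p q =>
          (∃ y : Fin n, y.val < i ∧ ∃ x, ObservedPair G L base x y p q) ∨
          ∃ x : Fin n, x.val < j ∧ ObservedPair G L base x ⟨i, hi⟩ p q)
        rfl (by simp [NExpr.cost]) ?_ (fun i s' v hI => hI.setNat (by omega) _ _ _)
        (hI.congr (by simp)) ?_ le_rfl).mono le_rfl fun s' _ hI => hI.congr fun p q => ?_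
      · exact fun s' hA => (hE2.agree hA rfl).n_eq
      · intro j hj s3 A3 hv' hI'
        refine (runs_listObserved (base := base) (x := ⟨j, hj⟩) (y := ⟨i, hi⟩) (hE2.agree A3 rfl)
          hI' hv' (by rw [A3.1 vB rfl, hv]) ?_ (hbn _)).mono le_rfl
            fun s' _ hI => hI.congr fun p q => ?_
        · rw [A3.1 aBase rfl, A2.1 aBase rfl, b1]
          exact hb ⟨i, hi⟩
        · rw [exists_lt_succ_fin hj, or_assoc]
      · rw [exists_lt_succ_fin hi]
        simp
  refine hobs.seq (T₂ := L.length * 216 + 12) ?_ (by omega)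
  intro s2 A2 P2
  have hE2 : Env G L s2 := hE1.agree A2 rfl
  have b2 : s2.nat aBase = s.nat aBase := by rw [A2.1 aBase rfl, b1]
  refine (Runs.for_const (N := L.length) (T := 200) (fun i => Lists fun p q =>
      (∃ y x, ObservedPair G L base x y p q) ∨
      ∃ (j : ℕ) (hj : j < L.length), j < i ∧ (ConfounderPair base (n + j) L[j].A p q ∨
        ConfounderPair base (n + j) L[j].B p q))
    rfl (by simp [NExpr.cost]) ?_ (fun i s' v hI => hI.setNat (by omega) _ _ _)
    (P2.congr (by simp)) ?_ le_rfl).mono le_rfl fun s' _ hI => hI.congr fun p q => ?_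
  · exact fun s' hA => (hE2.agree hA rfl).holds.length_eq
  · intro i hi s3 A3 hv hI
    have hE3 : Env G L s3 := hE2.agree A3 rfl
    have b3 : s3.nat aBase = s.nat aBase := by rw [A3.1 aBase rfl, b2]
    have hrow := hE3.holds.row i hi
    refine (runs_listConfounder (base := base) (a := n + i) (x := L[i].A) hI ?_ ?_ ?_
      (by simp [NExpr.cost]) (by simp [NExpr.cost]) (by rw [b3, hb])).seq (T₂ := 100) ?_ (by omega)
    · exact fun s' A' => (hE3.agree A' rfl).n_eq
    · intro s' A'
      simp [NExpr.eval, (hE3.agree A' rfl).n_eq, A'.1 vStep rfl, hv]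
    · intro s' A'
      simp [NExpr.eval, A'.1 vStep rfl, A'.1 5 rfl, hv, hrow.1]
    intro s4 A4 P4
    have hE4 : Env G L s4 := hE3.agree A4 rfl
    have hv4 : s4.nat vStep 0 0 = i := by rw [A4.1 vStep rfl, hv]
    have hrow4 := hE4.holds.row i hi
    refine (runs_listConfounder (base := base) (a := n + i) (x := L[i].B) P4 ?_ ?_ ?_
      (by simp [NExpr.cost]) (by simp [NExpr.cost]) (by rw [A4.1 aBase rfl, b3, hb])).mono le_rfl
        fun s' _ hI => hI.congr fun p q => ?_
    · exact fun s' A' => (hE4.agree A' rfl).n_eq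
    · intro s' A'
      simp [NExpr.eval, (hE4.agree A' rfl).n_eq, A'.1 vStep rfl, hv4]
    · intro s' A'
      simp [NExpr.eval, A'.1 vStep rfl, A'.1 5 rfl, hv4, hrow4.2.1]
    · rw [or_assoc, or_assoc]
      refine or_congr_right ?_
      constructor
      · rintro (⟨j, hj, hji, hp⟩ | hp)
        · exact ⟨j, hj, by omega, hp⟩
        · exact ⟨i, hi, by omega, hp⟩
      · rintro ⟨j, hj, hji, hp⟩
        rcases Nat.lt_succ_iff_lt_or_eq.1 hji with hji | rfl
        · exact .inl ⟨j, hj, hji, hp⟩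
        · exact .inr hp
  · refine or_congr_right (exists_congr fun j => exists_congr fun hj => ?_)
    simp [hj]

/-- A triangle is determined by the pair `(B, C)` and one of the at most `k` parents `A` of `B`. -/
theorem length_le_of_adj (hnd : L.Nodup) (hL : ∀ T ∈ L, G.Adj T.A T.B) :
    L.length ≤ maxDegree G * (n * n) := by
  classical
  rw [← List.toFinset_card_of_nodup hnd]
  refine (Finset.card_le_mul_card_image (f := fun T : Triangle n => (T.B, T.C)) L.toFinset
    (maxDegree G) ?_).trans (Nat.mul_le_mul_left _ ((Finset.card_le_univ _).trans (by simp)))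
  rintro ⟨b, c⟩ -
  rw [← Set.ncard_coe_finset]
  refine (Set.ncard_le_ncard_of_injOn (t := parents G b) Triangle.A ?_ ?_ (Set.toFinite _)).trans
    (ncard_parents_le G b)
  · intro T hT
    simp only [Finset.coe_filter, List.mem_toFinset, Set.mem_ofPred_eq, Prod.mk.injEq] at hT
    obtain ⟨hT, rfl, -⟩ := hT
    exact hL T hT
  · rintro ⟨a, b, c⟩ hT ⟨a', b', c'⟩ hT' heq
    simp only [Finset.coe_filter, Set.mem_ofPred_eq, Prod.mk.injEq] at hT hT' heq
    obtain ⟨-, rfl, rfl⟩ := hT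
    obtain ⟨-, rfl, rfl⟩ := hT'
    rw [heq]

/-- The learning algorithm after the call of the score-based learner. -/
def learn : Program := copyGraph ⨟ collect ⨟ findSinks ⨟ computeBases ⨟ listArcs

theorem runs_learn {D : Dataset n} {h : ℕ} {α : ℝ} (hG : IsDAG G) (hk : 1 ≤ maxDegree G)
    (hh : 1 ≤ h) (hD : 1 ≤ D.size) :
    Runs learn (input D G h α) (70500 * (n * maxDegree G ^ 3 * (n * h * D.size)))
      (IsOutput D G h α) := by
  have hn := pos_of_maxDegree hk
  -- All the work after the collection is `O(n² k)` and fits under the main term `M`.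
  have hM : n * n * maxDegree G ≤ n * maxDegree G ^ 3 * (n * h * D.size) := by
    calc n * n * maxDegree G ≤ (n * n * maxDegree G) * (maxDegree G ^ 2 * h * D.size) :=
          Nat.le_mul_of_pos_right _ (by positivity)
      _ = _ := by ring
  have hnn : n * n ≤ n * n * maxDegree G := Nat.le_mul_of_pos_right _ hk
  have hn1 : n ≤ n * n := Nat.le_mul_of_pos_right _ hn
  generalize hMdef : n * maxDegree G ^ 3 * (n * h * D.size) = M at *
  have hcopy := runs_copyGraph (G := G) (D := D) (h := h) (α := α) hk hh hD
  rw [hMdef] at hcopy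
  refine hcopy.seq (T₂ := 70390 * M) ?_ (by omega)
  intro s1 A1 I1
  have hcoll := runs_collect hG hk hD hh I1
  rw [hMdef] at hcoll
  refine hcoll.seq (T₂ := 1390 * M) ?_ (by omega)
  intro s2 A2 I2
  obtain ⟨L, hnd, hL, hH⟩ := I2.coll
  have hE2 : Env G L s2 := ⟨I2.loaded.n_eq, hH⟩
  have hlen : L.length ≤ n * n * maxDegree G := by
    rw [mul_comm]
    exact length_le_of_adj hnd fun T hT => latent_adj ((hL T).1 hT)
  refine (runs_findSinks hE2).seq (T₂ := 1000 * M) ?_ ?_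
  swap
  · have : n * (n * 36 + maxDegree G * (n * 60 + 80) + 100) =
      36 * (n * n) + 60 * (n * n * maxDegree G) + 80 * (n * maxDegree G) + 100 * n := by ring
    have : n * maxDegree G ≤ n * n * maxDegree G := Nat.mul_le_mul_right _ hn1
    omega
  intro s3 A3 hsink
  have hE3 : Env G L s3 := hE2.agree A3 rfl
  refine (runs_computeBases hG hE3 hsink).seq (T₂ := 600 * M) ?_ ?_
  swap
  · have : n * (n * 120 + 150) = 120 * (n * n) + 150 * n := by ring
    omega
  rintro s4 A4 ⟨hlast, hspec⟩
  have hE4 : Env G L s4 := hE3.agree A4 rfl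
  refine (runs_listArcs (base := fun v => s4.nat aBase v 0) hE4 (fun _ => rfl)
    fun y => (hspec y).2.1).mono ?_ ?_
  · have : n * (n * 136 + 28) = 136 * (n * n) + 28 * n := by ring
    omega
  · intro s5 A5 hlist
    exact isOutput_of_list hG hnd hL hlast (fun y => (hspec y).1) (fun y => (hspec y).2)
      (hE4.agree A5 rfl).holds hlist

end Output

end ConfounderSearch

open ConfounderSearch in
/-- One program implements the learning algorithm (after the call of the score-based learner, whose
result is the arbitrary DAG `G`), and it runs in time `O(n² k³ h |D| + m log n)` on all inputs. -/
theorem proposition6 :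
    ∃ (P : Program) (c : ℝ),
      ∀ (n : ℕ) (D : Dataset n) (G : Digraph (Fin n)) (h : ℕ) (α : ℝ),
        IsDAG G → 1 ≤ maxDegree G → 1 ≤ h → 1 ≤ D.size → 0 < α → α < 1 →
          ∃ (t : ℕ) (s : State),
            Exec P (input D G h α) t s ∧ IsOutput D G h α s ∧
            (t : ℝ) ≤ c * ((n : ℝ) ^ 2 * (maxDegree G : ℝ) ^ 3 * (h : ℝ) * (D.size : ℝ)
              + (numArcs G : ℝ) * Real.log (n : ℝ)) := by
  refine ⟨learn, 70500, fun n D G h α hG hk hh hD _ _ => ?_⟩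
  obtain ⟨t, s, hexec, ht, hout⟩ := runs_learn (D := D) (h := h) (α := α) hG hk hh hD
  refine ⟨t, s, hexec, hout, ?_⟩
  -- The main term alone suffices; of `m log n` only the sign is used.
  have hlog : 0 ≤ (numArcs G : ℝ) * Real.log (n : ℝ) :=
    mul_nonneg (Nat.cast_nonneg _) (Real.log_natCast_nonneg n)
  have ht' : (t : ℝ) ≤ 70500 * (n * maxDegree G ^ 3 * (n * h * D.size)) := by exact_mod_cast ht
  nlinarith
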